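/- Let $k\ge 1$, let $Q$ be a finite-dimensional smooth manifold (Hausdorff, second countable), and let $T^{(k)}Q$ be its tangent bundle of order $k$, i.e. the manifold of classes $[\gamma]_0^{(k)}$ of smooth curves $\gamma:\mathbb R\to Q$ up to contact of order $k$ at $0$, with the natural coordinates $q_{(r)}^i=\frac{d^r}{dt^r}\big|_0 q^i(\gamma(t))$, $0\le r\le k$, the projections $\tau^{(r,k)}:T^{(k)}Q\to T^{(r)}Q$ for $r\le k$, and the canonical immersion $j_k:T^{(k)}Q\to T(T^{(k-1)}Q)$, which sends $[\gamma]_0^{(k)}$ to the velocity at $t=0$ of the lifted curve $t\mapsto[\gamma(t+\cdot)]_0^{(k-1)}$. Let $d_T$ be the total derivative, $d_Tf(x)=\langle df,j_{r+1}(x)\rangle$ for a (local) function $f$ on $T^{(r)}Q$ and $x\in T^{(r+1)}Q$. Let $L\in C^\infty(T^{(k)}Q)$ be a $k$th-order Lagrangian, with Jacobi–Ostrogradsky momenta $\hat p^{(s)}_i=\sum_{j=0}^{k-1-s}(-1)^j d_T^j\big(\partial L/\partial q^i_{(s+1+j)}\big)$, $0\le s\le k-1$, Legendre–Ostrogradsky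 map $\operatorname{leg}_L:T^{(2k-1)}Q\to T^*T^{(k-1)}Q$ over $T^{(k-1)}Q$ given by the covector $\sum_{s,i}\hat p^{(s)}_i\,dq^i_{(s)}$, and energy $E_L=\sum_{s,i}\hat p^{(s)}_i q^i_{(s+1)}-L$ on $T^{(2k-1)}Q$. The Lagrangian is regular if the matrix $\big(\partial^2L/\partial q^i_{(k)}\partial q^j_{(k)}\big)$ is nonsingular at every point, and hyperregular if $\operatorname{leg}_L$ is a global diffeomorphism. On any open set where a smooth (local or global) inverse of $\operatorname{leg}_L$ is given, put $H=E_L\circ\operatorname{leg}_L^{-1}$; let $\mathcal FH$ be its fiber derivative, with values in $T(T^{(k-1)}Q)$, and let $\mathcal FH_o$ be the map with values in $T^{(k)}Q$ determined by $\mathcal FH=j_k\circ\mathcal FH_o$. (i) If $L$ is regular, then every point of $T^{(2k-1)}Q$ has an open neighbourhood $U$ which $\operatorname{leg}_L$ maps diffeomorphically onto an open subset $V$ of $T^*T^{(k-1)}Q$; and for every pair of open sets $U$, $V$ such that $\operatorname{leg}_L|_U:U\to V$ is a diffeomorphism, the function $H=E_L\circ(\operatorname{leg}_L|_U)^{-1}$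 is smooth on $V$, $\mathcal FH(V)\subseteq j_k(T^{(k)}Q)$, and $$\mathcal FH_o=\tau^{(k,2k-1)}\circ(\operatorname{leg}_L|_U)^{-1}\quad\text{on } V .$$ (ii) If $L$ is hyperregular, then $H=E_L\circ\operatorname{leg}_L^{-1}$ is smooth on $T^*T^{(k-1)}Q$, there is a unique map $\mathcal FH_o:T^*T^{(k-1)}Q\to T^{(k)}Q$ with $\mathcal FH=j_k\circ\mathcal FH_o$, and $\mathcal FH_o$ is a smooth submersion onto $T^{(k)}Q$. (iii) If $L$ is hyperregular, then $\tau^{(k,2k-1)}:T^{(2k-1)}Q\to T^{(k)}Q$ has a smooth global section, and for every smooth global section $\Psi$ of $\tau^{(k,2k-1)}$ the map $\Upsilon=\operatorname{leg}_L\circ\Psi:T^{(k)}Q\to T^*T^{(k-1)}Q$ is a smooth global section of $\mathcal FH_o$. -/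

import Mathlib

open Set Function
open scoped Manifold ContDiff Topology Bundle

noncomputable section

namespace HigherOrder

universe u v

/-! ### Higher-order tangent bundles

`Q` is a smooth manifold modelled on a finite-dimensional real normed space `E`. -/

section Jets

variable (E : Type u) [NormedAddCommGroup E] [NormedSpace ℝ E]
  (Q : Type v) [TopologicalSpace Q] [ChartedSpace E Q]

/-- Smooth curves `ℝ → Q`. -/
abbrev SmoothCurve : Type v := C^∞⟮𝓘(ℝ, ℝ), ℝ; 𝓘(ℝ, E), Q⟯

/-- Contact of order `k` at `0`: the two curves have the same value at `0`, and the same derivatives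
at `0` up to order `k` in the charts of `Q`. -/
def contact (k : ℕ) : Setoid (SmoothCurve E Q) where
  r γ₁ γ₂ := γ₁ 0 = γ₂ 0 ∧ ∀ e ∈ atlas E Q, γ₁ 0 ∈ e.source → ∀ r ≤ k,
    iteratedDeriv r (fun t => e (γ₁ t)) 0 = iteratedDeriv r (fun t => e (γ₂ t)) 0
  iseqv :=
    { refl := fun _ => ⟨rfl, fun _ _ _ _ _ => rfl⟩
      symm := fun h => ⟨h.1.symm, fun e he h0 r hr => (h.2 e he (h.1 ▸ h0) r hr).symm⟩
      trans := fun h h' => ⟨h.1.trans h'.1, fun e he h0 r hr =>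
        (h.2 e he h0 r hr).trans (h'.2 e he (h.1 ▸ h0) r hr)⟩ }

/-- The tangent bundle of order `k`, i.e. `T^(k)Q`: classes of curves up to contact of order `k`. -/
def HOTangent (k : ℕ) : Type v := Quotient (contact E Q k)

variable {E Q}

/-- The class `[γ]_0^(k)`. -/
def jet (k : ℕ) (γ : SmoothCurve E Q) : HOTangent E Q k := Quotient.mk (contact E Q k) γ

/-- The projection `T^(k)Q → Q`, `[γ] ↦ γ 0`. -/
def base {k : ℕ} (x : HOTangent E Q k) : Q :=
  Quotient.lift (fun γ : SmoothCurve E Q => γ 0)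
    (fun γ₁ γ₂ (h : contact E Q k γ₁ γ₂) => h.1) x

/-- The projection `τ^(r,k) : T^(k)Q → T^(r)Q`, `[γ]^(k) ↦ [γ]^(r)`, for `r ≤ k`. -/
def proj {r k : ℕ} (h : r ≤ k) (x : HOTangent E Q k) : HOTangent E Q r :=
  Quotient.map' (s₁ := contact E Q k) (s₂ := contact E Q r) id
    (fun γ₁ γ₂ (hc : contact E Q k γ₁ γ₂) =>
      ⟨hc.1, fun e he h0 i hi => hc.2 e he h0 i (hi.trans h)⟩) x

open Classical in
/-- The natural coordinates `(q_(0), …, q_(k))` on `T^(k)Q` induced by a chart `e` of `Q`;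
the value is `0` outside the domain of the coordinates. -/
def coords {k : ℕ} (e : atlas E Q) (x : HOTangent E Q k) : Fin (k + 1) → E :=
  Quotient.lift (fun γ : SmoothCurve E Q => fun r : Fin (k + 1) =>
      if γ 0 ∈ e.1.source then iteratedDeriv r (fun t => e.1 (γ t)) 0 else 0)
    (fun γ₁ γ₂ (h : contact E Q k γ₁ γ₂) => by
      funext r
      by_cases h1 : γ₁ 0 ∈ e.1.source
      · have h2 : γ₂ 0 ∈ e.1.source := h.1 ▸ h1
        simp only [h1, h2, if_true]
        exact h.2 e.1 e.2 h1 r (Nat.lt_succ_iff.mp r.2)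
      · have h2 : γ₂ 0 ∉ e.1.source := h.1 ▸ h1
        simp only [h1, h2, if_false]) x

@[simp] theorem base_jet (k : ℕ) (γ : SmoothCurve E Q) : base (jet k γ) = γ 0 := rfl

@[simp] theorem proj_jet {r k : ℕ} (h : r ≤ k) (γ : SmoothCurve E Q) :
    proj h (jet k γ) = jet r γ := rfl

theorem coords_jet {k : ℕ} (e : atlas E Q) {γ : SmoothCurve E Q} (h : γ 0 ∈ e.1.source)
    (r : Fin (k + 1)) :
    coords e (jet k γ) r = iteratedDeriv r (fun t => e.1 (γ t)) 0 := if_pos h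

theorem exists_jet {k : ℕ} (x : HOTangent E Q k) : ∃ γ : SmoothCurve E Q, jet k γ = x :=
  Quotient.exists_rep x

/-- The polynomial curve with prescribed derivatives at `0`. -/
def taylorCurve {k : ℕ} (q : Fin (k + 1) → E) (t : ℝ) : E :=
  ∑ r : Fin (k + 1), (t ^ (r : ℕ) / (Nat.factorial r : ℝ)) • q r

theorem contDiff_taylorCurve (k : ℕ) :
    ContDiff ℝ ∞ (fun p : (Fin (k + 1) → E) × ℝ => taylorCurve p.1 p.2) := by
  unfold taylorCurve
  refine ContDiff.sum fun r _ => ContDiff.smul ?_ ?_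
  · fun_prop
  · fun_prop

theorem iteratedDeriv_taylorCurve {k : ℕ} (q : Fin (k + 1) → E) (r : Fin (k + 1)) :
    iteratedDeriv r (taylorCurve q) 0 = q r := by
  have h : ∀ s : Fin (k + 1), iteratedDeriv (r : ℕ)
      (fun t : ℝ => (t ^ (s : ℕ) / (Nat.factorial s : ℝ)) • q s) 0 = if s = r then q r else 0 := by
    intro s
    have h1 : (fun t : ℝ => (t ^ (s : ℕ) / (Nat.factorial s : ℝ)) • q s) =
        fun t : ℝ => t ^ (s : ℕ) • ((Nat.factorial s : ℝ)⁻¹ • q s) := by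
      funext t; rw [smul_smul]; rfl
    rw [h1, iteratedDeriv_smul_const (by fun_prop), iteratedDeriv_fun_pow_zero]
    by_cases hs : s = r
    · subst hs
      simp [smul_smul, Nat.factorial_ne_zero]
    · have : (r : ℕ) ≠ s := fun h => hs (Fin.ext h.symm)
      simp [hs, this]
  unfold taylorCurve
  rw [iteratedDeriv_fun_sum (fun s _ => by fun_prop)]
  simp [h]

theorem taylorCurve_zero {k : ℕ} (q : Fin (k + 1) → E) : taylorCurve q 0 = q 0 := by
  simpa using iteratedDeriv_taylorCurve q 0

/-- Partial derivatives in the last variable of a smooth map are smooth. -/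
theorem contDiffOn_iteratedDeriv_snd {X F : Type*} [NormedAddCommGroup X] [NormedSpace ℝ X]
    [NormedAddCommGroup F] [NormedSpace ℝ F] {G : X × ℝ → F} {U : Set (X × ℝ)} (hU : IsOpen U)
    (hG : ContDiffOn ℝ ∞ G U) (r : ℕ) :
    ContDiffOn ℝ ∞ (fun p : X × ℝ => iteratedDeriv r (fun t => G (p.1, t)) p.2) U := by
  induction r with
  | zero => simpa using hG
  | succ r ih =>
    have h1 : ContDiffOn ℝ ∞ (fun p : X × ℝ =>
        fderiv ℝ (fun p : X × ℝ => iteratedDeriv r (fun t => G (p.1, t)) p.2) p (0, 1)) U :=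
      (ih.fderiv_of_isOpen hU (by simp)).clm_apply contDiffOn_const
    refine h1.congr fun p hp => ?_
    rw [iteratedDeriv_succ]
    have h2 : HasFDerivAt (fun p : X × ℝ => iteratedDeriv r (fun t => G (p.1, t)) p.2)
        (fderiv ℝ (fun p : X × ℝ => iteratedDeriv r (fun t => G (p.1, t)) p.2) p) (p.1, p.2) :=
      ((ih.contDiffAt (hU.mem_nhds hp)).differentiableAt (by simp)).hasFDerivAt
    have h3 : HasDerivAt (fun t : ℝ => (p.1, t)) ((0 : X), (1 : ℝ)) p.2 :=
      (hasDerivAt_const _ _).prodMk (hasDerivAt_id _)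
    exact (h2.comp_hasDerivAt p.2 h3).deriv

theorem isOpen_transition {E Q : Type*} [TopologicalSpace E] [TopologicalSpace Q]
    (e e' : OpenPartialHomeomorph Q E) :
    IsOpen (e.target ∩ e.symm ⁻¹' e'.source) :=
  e.symm.isOpen_inter_preimage e'.open_source

theorem eventually_chart_curve {e e' : OpenPartialHomeomorph Q E} {γ : SmoothCurve E Q}
    (h : γ 0 ∈ e.source) :
    (fun t => e' (γ t)) =ᶠ[𝓝 0] (fun v => e' (e.symm v)) ∘ (fun t => e (γ t)) := by
  have hc : ContinuousAt γ 0 := γ.contMDiff.continuous.continuousAt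
  filter_upwards [hc.preimage_mem_nhds (e.open_source.mem_nhds h)] with t ht
  simp [e.left_inv ht]

theorem coords_mem {k : ℕ} (e : atlas E Q) {x : HOTangent E Q k} (h : base x ∈ e.1.source) :
    coords e x 0 = e.1 (base x) := by
  obtain ⟨γ, rfl⟩ := exists_jet x
  rw [coords_jet e h]; simp

section Charts

variable [IsManifold 𝓘(ℝ, E) ∞ Q]

theorem contDiffAt_chart_curve {e : OpenPartialHomeomorph Q E} (he : e ∈ atlas E Q)
    {γ : SmoothCurve E Q} {t : ℝ} (h : γ t ∈ e.source) :
    ContDiffAt ℝ ∞ (fun s => e (γ s)) t := by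
  have h1 : ContMDiffAt 𝓘(ℝ, E) 𝓘(ℝ, E) ∞ e (γ t) :=
    contMDiffAt_of_mem_maximalAtlas (IsManifold.subset_maximalAtlas he) h
  exact (h1.comp t (γ.contMDiff t)).contDiffAt

theorem contDiffOn_transition {e e' : OpenPartialHomeomorph Q E} (he : e ∈ atlas E Q)
    (he' : e' ∈ atlas E Q) :
    ContDiffOn ℝ ∞ (fun v => e' (e.symm v)) (e.target ∩ e.symm ⁻¹' e'.source) := by
  have h1 : ContMDiffOn 𝓘(ℝ, E) 𝓘(ℝ, E) ∞ e' e'.source :=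
    contMDiffOn_of_mem_maximalAtlas (IsManifold.subset_maximalAtlas he')
  have h2 : ContMDiffOn 𝓘(ℝ, E) 𝓘(ℝ, E) ∞ e.symm e.target :=
    contMDiffOn_symm_of_mem_maximalAtlas (IsManifold.subset_maximalAtlas he)
  exact (h1.comp (h2.mono inter_subset_left) fun v hv => hv.2).contDiffOn

/-- Contact of order `k` can be checked in one chart. -/
theorem contact_of_chart {k : ℕ} {e : OpenPartialHomeomorph Q E} (he : e ∈ atlas E Q)
    {γ₁ γ₂ : SmoothCurve E Q} (h₁ : γ₁ 0 ∈ e.source) (h₂ : γ₂ 0 ∈ e.source)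
    (h : ∀ r ≤ k, iteratedDeriv r (fun t => e (γ₁ t)) 0 = iteratedDeriv r (fun t => e (γ₂ t)) 0) :
    contact E Q k γ₁ γ₂ := by
  have h0 : e (γ₁ 0) = e (γ₂ 0) := by simpa using h 0 (Nat.zero_le _)
  have hb : γ₁ 0 = γ₂ 0 := e.injOn h₁ h₂ h0
  refine ⟨hb, fun e' he' h' r hr => ?_⟩
  have hφ : ContDiffAt ℝ ∞ (fun v => e' (e.symm v)) (e (γ₁ 0)) :=
    (contDiffOn_transition he he').contDiffAt
      ((isOpen_transition e e').mem_nhds ⟨e.map_source h₁, by simpa [e.left_inv h₁] using h'⟩)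
  have hr' : ((r : ℕ) : ℕ∞ω) ≤ ∞ := by exact_mod_cast le_top
  rw [(eventually_chart_curve h₁).iteratedDeriv_eq, (eventually_chart_curve h₂).iteratedDeriv_eq,
    iteratedDeriv_vcomp_eq_sum_orderedFinpartition (n := ∞) hφ (contDiffAt_chart_curve he h₁) hr',
    iteratedDeriv_vcomp_eq_sum_orderedFinpartition (n := ∞) (h0 ▸ hφ)
      (contDiffAt_chart_curve he h₂) hr']
  refine Finset.sum_congr rfl fun c _ => ?_
  have : (fun j => iteratedDeriv (c.partSize j) (fun t => e (γ₁ t)) 0) =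
      fun j => iteratedDeriv (c.partSize j) (fun t => e (γ₂ t)) 0 :=
    funext fun j => h _ ((c.partSize_le j).trans hr)
  rw [this, h0]

/-- Every point of the coordinate domain comes from a smooth curve. -/
theorem exists_curve {k : ℕ} {e : OpenPartialHomeomorph Q E} (he : e ∈ atlas E Q)
    {q : Fin (k + 1) → E} (hq : q 0 ∈ e.target) :
    ∃ γ : SmoothCurve E Q, γ 0 ∈ e.source ∧ (fun t => e (γ t)) =ᶠ[𝓝 0] taylorCurve q := by
  have hP : ContDiff ℝ ∞ (taylorCurve q) :=
    (contDiff_taylorCurve k).comp (contDiff_const.prodMk contDiff_id)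
  have hmem : taylorCurve q ⁻¹' e.target ∈ 𝓝 (0 : ℝ) :=
    hP.continuous.continuousAt.preimage_mem_nhds
      (e.open_target.mem_nhds (by rwa [taylorCurve_zero]))
  obtain ⟨ε, hε, hball⟩ := Metric.mem_nhds_iff.mp hmem
  let f : ContDiffBump (0 : ℝ) := ⟨ε / 4, ε / 2, by positivity, by linarith⟩
  let σ : ℝ → ℝ := fun t => t * f t
  have hσ : ContDiff ℝ ∞ σ := contDiff_id.mul f.contDiff
  have hσ0 : σ =ᶠ[𝓝 0] id := by
    filter_upwards [f.eventuallyEq_one] with t ht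
    simp only [σ, id, ht, Pi.one_apply, mul_one]
  have hσball : ∀ t, σ t ∈ Metric.ball (0 : ℝ) ε := by
    intro t
    rw [mem_ball_zero_iff, Real.norm_eq_abs]
    by_cases ht : |t| < ε / 2
    · have h1 : |f t| ≤ 1 := by rw [abs_of_nonneg f.nonneg]; exact f.le_one
      calc |σ t| = |t| * |f t| := abs_mul _ _
        _ ≤ |t| * 1 := by gcongr
        _ < ε := by linarith
    · have : f t = 0 := f.zero_of_le_dist (by
        rw [dist_zero_right, Real.norm_eq_abs]; exact not_lt.mp ht)
      simpa [σ, this] using hε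
  have htgt : ∀ t, taylorCurve q (σ t) ∈ e.target := fun t => hball (hσball t)
  have hsm : ContMDiff 𝓘(ℝ, ℝ) 𝓘(ℝ, E) ∞ (fun t => e.symm (taylorCurve q (σ t))) := by
    have h2 : ContMDiffOn 𝓘(ℝ, E) 𝓘(ℝ, E) ∞ e.symm e.target :=
      contMDiffOn_symm_of_mem_maximalAtlas (IsManifold.subset_maximalAtlas he)
    exact h2.comp_contMDiff (hP.comp hσ).contMDiff htgt
  refine ⟨⟨_, hsm⟩, e.map_target (htgt 0), ?_⟩
  filter_upwards [hσ0] with t ht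
  change e (e.symm (taylorCurve q (σ t))) = _
  rw [e.right_inv (htgt t), ht, id]

open Classical in
/-- The inverse of the coordinate map. -/
def ofCoords {k : ℕ} (e : atlas E Q) (q : Fin (k + 1) → E) : HOTangent E Q k :=
  if h : q 0 ∈ e.1.target then jet k (exists_curve e.2 h).choose
  else jet k (⟨fun _ => e.1.symm (q 0), contMDiff_const⟩ : SmoothCurve E Q)

theorem ofCoords_spec {k : ℕ} (e : atlas E Q) {q : Fin (k + 1) → E} (h : q 0 ∈ e.1.target) :
    ∃ γ : SmoothCurve E Q, ofCoords e q = jet k γ ∧ γ 0 ∈ e.1.source ∧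
      (fun t => e.1 (γ t)) =ᶠ[𝓝 0] taylorCurve q :=
  ⟨_, dif_pos h, (exists_curve e.2 h).choose_spec⟩

/-- The natural chart of `T^(k)Q` induced by the chart `e` of `Q`. -/
def jetChart (k : ℕ) (e : atlas E Q) : PartialEquiv (HOTangent E Q k) (Fin (k + 1) → E) where
  toFun := coords e
  invFun := ofCoords e
  source := {x | base x ∈ e.1.source}
  target := {q | q 0 ∈ e.1.target}
  map_source' x hx := by
    change coords e x 0 ∈ e.1.target
    rw [coords_mem e hx]; exact e.1.map_source hx
  map_target' q hq := by
    obtain ⟨γ, h1, h2, -⟩ := ofCoords_spec e hq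
    change base (ofCoords e q) ∈ e.1.source
    rw [h1]; exact h2
  left_inv' x hx := by
    have hq : coords e x 0 ∈ e.1.target := by
      rw [coords_mem e hx]; exact e.1.map_source hx
    obtain ⟨γ, h1, h2, h3⟩ := ofCoords_spec e hq
    obtain ⟨δ, rfl⟩ := exists_jet x
    rw [h1]
    refine Quotient.sound (contact_of_chart e.2 h2 hx fun r hr => ?_)
    rw [h3.iteratedDeriv_eq,
      iteratedDeriv_taylorCurve (coords e (jet k δ)) ⟨r, Nat.lt_succ_of_le hr⟩]
    exact coords_jet e hx _
  right_inv' q hq := by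
    obtain ⟨γ, h1, h2, h3⟩ := ofCoords_spec e hq
    funext r
    rw [h1, coords_jet e h2, h3.iteratedDeriv_eq, iteratedDeriv_taylorCurve]

theorem jetChart_trans_source (k : ℕ) (e e' : atlas E Q) :
    ((jetChart k e).symm.trans (jetChart k e')).source =
      (fun q : Fin (k + 1) → E => q 0) ⁻¹' (e.1.target ∩ e.1.symm ⁻¹' e'.1.source) := by
  ext q
  simp only [PartialEquiv.trans_source, PartialEquiv.symm_source, mem_inter_iff, mem_preimage]
  refine and_congr_right fun hq => ?_
  obtain ⟨γ, h1, h2, h3⟩ := ofCoords_spec e (q := q) hq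
  change base (ofCoords e q) ∈ e'.1.source ↔ _
  have h4 : e.1 (γ 0) = q 0 := by rw [← taylorCurve_zero q]; exact h3.eq_of_nhds
  rw [h1, base_jet, ← h4, e.1.left_inv h2]

theorem coords_ofCoords {k : ℕ} (e e' : atlas E Q) {q : Fin (k + 1) → E}
    (hq : q 0 ∈ e.1.target ∩ e.1.symm ⁻¹' e'.1.source) (r : Fin (k + 1)) :
    coords e' (ofCoords e q) r =
      iteratedDeriv r (fun t => e'.1 (e.1.symm (taylorCurve q t))) 0 := by
  obtain ⟨γ, g1, g2, g3⟩ := ofCoords_spec e (q := q) hq.1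
  have h4 : e.1 (γ 0) = q 0 := by rw [← taylorCurve_zero q]; exact g3.eq_of_nhds
  have h5 : γ 0 ∈ e'.1.source := by
    have := hq.2
    rw [mem_preimage, ← h4, e.1.left_inv g2] at this
    exact this
  rw [g1, coords_jet e' h5]
  refine Filter.EventuallyEq.iteratedDeriv_eq _ ?_
  filter_upwards [eventually_chart_curve (e' := e'.1) g2, g3] with t ht1 ht2
  rw [ht1, comp_apply, ht2]

/-- The changes of natural coordinates are smooth. -/
theorem contDiffOn_jetChart_trans (k : ℕ) (e e' : atlas E Q) :
    ContDiffOn ℝ ∞ ((jetChart k e).symm.trans (jetChart k e'))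
      ((jetChart k e).symm.trans (jetChart k e')).source := by
  rw [jetChart_trans_source]
  have hVo : IsOpen (e.1.target ∩ e.1.symm ⁻¹' e'.1.source) := isOpen_transition e.1 e'.1
  have hP := contDiff_taylorCurve (E := E) k
  refine contDiffOn_pi.2 fun r => ?_
  have h1 := contDiffOn_iteratedDeriv_snd (hVo.preimage hP.continuous)
    ((contDiffOn_transition e.2 e'.2).comp hP.contDiffOn fun _ hp => hp) r
  have h2 := h1.comp (s := (fun q : Fin (k + 1) → E => q 0) ⁻¹'
      (e.1.target ∩ e.1.symm ⁻¹' e'.1.source)) (f := fun q => (q, (0 : ℝ)))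
    (contDiff_id.prodMk contDiff_const).contDiffOn fun q hq => by
      rw [mem_preimage, taylorCurve_zero]; exact hq
  exact h2.congr fun q hq => coords_ofCoords e e' hq r

variable (E Q) in
/-- The natural charts of `T^(k)Q` as an atlas. -/
def chartedSpaceCore (k : ℕ) : ChartedSpaceCore (Fin (k + 1) → E) (HOTangent E Q k) where
  atlas := range (jetChart k)
  chartAt x := jetChart k (achart E (base x))
  mem_chart_source x := mem_chart_source E (base x)
  chart_mem_atlas x := mem_range_self _
  open_source := by
    rintro _ _ ⟨e, rfl⟩ ⟨e', rfl⟩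
    rw [jetChart_trans_source]
    exact (isOpen_transition e.1 e'.1).preimage (continuous_apply 0)
  continuousOn_toFun := by
    rintro _ _ ⟨e, rfl⟩ ⟨e', rfl⟩
    exact (contDiffOn_jetChart_trans k e e').continuousOn

instance (k : ℕ) : TopologicalSpace (HOTangent E Q k) := (chartedSpaceCore E Q k).toTopologicalSpace

instance (k : ℕ) : ChartedSpace (Fin (k + 1) → E) (HOTangent E Q k) :=
  (chartedSpaceCore E Q k).toChartedSpace

instance (k : ℕ) : IsManifold 𝓘(ℝ, Fin (k + 1) → E) ∞ (HOTangent E Q k) := by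
  refine isManifold_of_contDiffOn _ _ _ fun e e' he he' => ?_
  obtain ⟨_, ⟨c, rfl⟩, hc⟩ := mem_iUnion₂.1 he
  obtain ⟨_, ⟨c', rfl⟩, hc'⟩ := mem_iUnion₂.1 he'
  obtain rfl := mem_singleton_iff.1 hc
  obtain rfl := mem_singleton_iff.1 hc'
  have h := contDiffOn_jetChart_trans k c c'
  rw [modelWithCornersSelf_coe, modelWithCornersSelf_coe_symm, id_comp, comp_id, preimage_id,
    range_id, inter_univ]
  exact h

end Charts

end Jets

/-! ### Prolongation of curves and the canonical immersion -/

section Immersion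

variable {E : Type u} [NormedAddCommGroup E] [NormedSpace ℝ E]
  {Q : Type v} [TopologicalSpace Q] [ChartedSpace E Q]

/-- The curve `s ↦ γ (t + s)`. -/
def shift (γ : SmoothCurve E Q) (t : ℝ) : SmoothCurve E Q :=
  ⟨fun s => γ (t + s), γ.contMDiff.comp (contDiff_const.add contDiff_id).contMDiff⟩

/-- The lift `γ^(k)(t) = [γ_t]_0^(k)` of a curve to `T^(k)Q`, where `γ_t(s) = γ (t + s)`. -/
def prolong (k : ℕ) (γ : SmoothCurve E Q) (t : ℝ) : HOTangent E Q k := jet k (shift γ t)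

theorem prolong_zero (k : ℕ) (γ : SmoothCurve E Q) : prolong k γ 0 = jet k γ := by
  have : shift γ 0 = γ := by
    ext s
    change γ (0 + s) = γ s
    rw [zero_add]
  rw [prolong, this]

theorem coords_prolong {k : ℕ} (e : atlas E Q) (γ : SmoothCurve E Q) {t : ℝ}
    (h : γ t ∈ e.1.source) (r : Fin (k + 1)) :
    coords e (prolong k γ t) r = iteratedDeriv r (fun s => e.1 (γ s)) t := by
  have h' : shift γ t 0 ∈ e.1.source := by
    change γ (t + 0) ∈ _
    rwa [add_zero]
  rw [prolong, coords_jet e h']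
  have h1 := congrFun (iteratedDeriv_comp_const_add (r : ℕ) (fun s => e.1 (γ s)) t) 0
  rw [add_zero] at h1
  exact h1

variable [IsManifold 𝓘(ℝ, E) ∞ Q]

theorem extChartAt_apply {k : ℕ} (x y : HOTangent E Q k) :
    extChartAt 𝓘(ℝ, Fin (k + 1) → E) x y = coords (achart E (base x)) y := rfl

theorem hasDerivAt_coords_prolong {k : ℕ} (e : atlas E Q) (γ : SmoothCurve E Q) {t : ℝ}
    (h : γ t ∈ e.1.source) :
    HasDerivAt (fun s => coords e (prolong k γ s))
      (fun r : Fin (k + 1) => iteratedDeriv (r + 1) (fun s => e.1 (γ s)) t) t := by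
  refine hasDerivAt_pi.2 fun r => ?_
  have hc : ContDiffAt ℝ ∞ (fun s => e.1 (γ s)) t := contDiffAt_chart_curve e.2 h
  have h1 : DifferentiableAt ℝ (iteratedDeriv r (fun s => e.1 (γ s))) t := by
    simp only [funext (fun s => iteratedDeriv_eq_iteratedFDeriv (n := (r : ℕ))
      (f := fun s => e.1 (γ s)) (x := s))]
    exact (hc.differentiableAt_iteratedFDeriv (m := r)
      (by exact_mod_cast ENat.natCast_lt_top _)).continuousMultilinear_apply_const _
  have h2 : HasDerivAt (iteratedDeriv r (fun s => e.1 (γ s)))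
      (iteratedDeriv (r + 1) (fun s => e.1 (γ s)) t) t := by
    rw [iteratedDeriv_succ]; exact h1.hasDerivAt
  refine h2.congr_of_eventuallyEq ?_
  have hγ : ContinuousAt γ t := γ.contMDiff.continuous.continuousAt
  filter_upwards [hγ.preimage_mem_nhds (e.1.open_source.mem_nhds h)] with s hs
  exact coords_prolong e γ hs r

theorem hasMFDerivAt_prolong (k : ℕ) (γ : SmoothCurve E Q) (t : ℝ) :
    HasMFDerivAt 𝓘(ℝ, ℝ) 𝓘(ℝ, Fin (k + 1) → E) (prolong k γ) t
      (ContinuousLinearMap.toSpanSingleton ℝ (fun r : Fin (k + 1) =>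
        iteratedDeriv (r + 1) (fun s => chartAt E (base (prolong k γ t)) (γ s)) t)) := by
  have hb : ∀ s, base (prolong k γ s) = γ s := fun s => by
    change γ (s + 0) = _
    rw [add_zero]
  have hmem : γ t ∈ (achart E (base (prolong k γ t))).1.source := by
    rw [hb]; exact mem_chart_source E _
  have hd := hasDerivAt_coords_prolong (k := k) (achart E (base (prolong k γ t))) γ hmem
  have hγ : ContinuousAt γ t := γ.contMDiff.continuous.continuousAt
  refine ⟨?_, ?_⟩
  · rw [(chartAt (Fin (k + 1) → E) (prolong k γ t)).continuousAt_iff_continuousAt_comp_left]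
    · exact hd.continuousAt
    · filter_upwards [hγ.preimage_mem_nhds
        ((achart E (base (prolong k γ t))).1.open_source.mem_nhds hmem)] with s hs
      change base (prolong k γ s) ∈ (achart E (base (prolong k γ t))).1.source
      rw [hb s]; exact hs
  · exact hd.hasFDerivAt.hasFDerivWithinAt

theorem velocity_eq (k : ℕ) (γ : SmoothCurve E Q) (t : ℝ) :
    mfderiv 𝓘(ℝ, ℝ) 𝓘(ℝ, Fin (k + 1) → E) (prolong k γ) t (1 : ℝ) = fun r : Fin (k + 1) =>
      iteratedDeriv (r + 1) (fun s => chartAt E (base (prolong k γ t)) (γ s)) t := by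
  rw [(hasMFDerivAt_prolong k γ t).mfderiv]
  exact one_smul ℝ _

/-- The canonical immersion `j_(k+1) : T^(k+1)Q → T(T^(k)Q)`, sending `[γ]^(k+1)` to the velocity
at `0` of the lift `γ^(k)`. -/
def canonicalImmersion {k : ℕ} (x : HOTangent E Q (k + 1)) :
    TangentBundle 𝓘(ℝ, Fin (k + 1) → E) (HOTangent E Q k) :=
  Quotient.lift (fun γ : SmoothCurve E Q =>
      (⟨prolong k γ 0, mfderiv 𝓘(ℝ, ℝ) 𝓘(ℝ, Fin (k + 1) → E) (prolong k γ) 0 (1 : ℝ)⟩ :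
        TangentBundle 𝓘(ℝ, Fin (k + 1) → E) (HOTangent E Q k)))
    (fun γ₁ γ₂ (h : contact E Q (k + 1) γ₁ γ₂) => by
      have h1 : prolong k γ₁ 0 = prolong k γ₂ 0 := by
        rw [prolong_zero, prolong_zero]
        exact congrArg (proj k.le_succ) (Quotient.sound h : jet (k + 1) γ₁ = jet (k + 1) γ₂)
      have key : ∀ (x y : HOTangent E Q k) (v w : Fin (k + 1) → E), x = y → v = w →
          (⟨x, v⟩ : TangentBundle 𝓘(ℝ, Fin (k + 1) → E) (HOTangent E Q k)) = ⟨y, w⟩ := by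
        rintro x y v w rfl rfl; rfl
      refine key _ _ _ _ h1 ?_
      rw [velocity_eq, velocity_eq, ← h1]
      funext r
      have hb : base (prolong k γ₁ 0) = γ₁ 0 := by rw [prolong_zero, base_jet]
      refine h.2 _ (chart_mem_atlas E _) ?_ _ (Nat.succ_le_of_lt r.2)
      rw [hb]; exact mem_chart_source E _) x

end Immersion

/-! ### Cotangent bundles and the fiber derivative of a Hamiltonian -/

section FiberDerivative

variable (F : Type u) [NormedAddCommGroup F] [NormedSpace ℝ F]
  (M : Type v) [TopologicalSpace M] [ChartedSpace F M]

/-- The cotangent bundle `T^*M` of a manifold `M` modelled on `F`. -/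
abbrev CotangentBundle : Type (max u v) :=
  Bundle.TotalSpace (F →L[ℝ] ℝ) (fun x : M => TangentSpace 𝓘(ℝ, F) x →L[ℝ] ℝ)

/-- The model of the cotangent bundle. -/
abbrev cotangentModel : ModelWithCorners ℝ (F × (F →L[ℝ] ℝ)) (ModelProd F (F →L[ℝ] ℝ)) :=
  𝓘(ℝ, F).prod 𝓘(ℝ, F →L[ℝ] ℝ)

variable {F M} [FiniteDimensional ℝ F]

/-- The fiber derivative `𝓕H : T^*M → TM`: the derivative at `α` of the restriction of `H` to the
fiber `T^*_x M` is an element of `T^{**}_x M`, which is identified with `T_x M`. -/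
def fiberDeriv (H : CotangentBundle F M → ℝ) (α : CotangentBundle F M) :
    TangentBundle 𝓘(ℝ, F) M :=
  ⟨α.1, ((Module.evalEquiv ℝ F).symm
    ((fderiv ℝ (fun β : F →L[ℝ] ℝ => H ⟨α.1, β⟩) α.2 : (F →L[ℝ] ℝ) →ₗ[ℝ] ℝ) ∘ₗ
      (LinearMap.toContinuousLinearMap : (F →ₗ[ℝ] ℝ) ≃ₗ[ℝ] (F →L[ℝ] ℝ)).toLinearMap) : F)⟩

/-- The characterization of the fiber derivative: `⟨β, 𝓕H(α)⟩ = d/dt H(α + tβ)` at `t = 0`. -/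
theorem fiberDeriv_spec (H : CotangentBundle F M → ℝ) (α : CotangentBundle F M) (β : F →L[ℝ] ℝ) :
    β ((fiberDeriv H α).2 : F) = fderiv ℝ (fun β : F →L[ℝ] ℝ => H ⟨α.1, β⟩) α.2 β := by
  have h := LinearMap.congr_fun ((Module.evalEquiv ℝ F).apply_symm_apply
    ((fderiv ℝ (fun β : F →L[ℝ] ℝ => H ⟨α.1, β⟩) α.2 : (F →L[ℝ] ℝ) →ₗ[ℝ] ℝ) ∘ₗ
      (LinearMap.toContinuousLinearMap : (F →ₗ[ℝ] ℝ) ≃ₗ[ℝ] (F →L[ℝ] ℝ)).toLinearMap))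
    (β : F →ₗ[ℝ] ℝ)
  exact h

end FiberDerivative

/-! ### Lagrangians of order `k = m + 1` -/

section Lagrangian

variable {E : Type u} [NormedAddCommGroup E] [NormedSpace ℝ E]
  {Q : Type v} [TopologicalSpace Q] [ChartedSpace E Q] [IsManifold 𝓘(ℝ, E) ∞ Q]

/-- The total (Tulczyjew) derivative `d_T f : T^(k+1)Q → V` of `f : T^(k)Q → V`, that is,
`d_T f (x) = ⟨df, j_(k+1)(x)⟩`. -/
def totalDeriv {V : Type*} [NormedAddCommGroup V] [NormedSpace ℝ V] {k : ℕ}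
    (f : HOTangent E Q k → V) (x : HOTangent E Q (k + 1)) : V :=
  mfderiv 𝓘(ℝ, Fin (k + 1) → E) 𝓘(ℝ, V) f (canonicalImmersion x).1 (canonicalImmersion x).2

/-- The iterated total derivative `d_T^j f : T^(k+j)Q → V`. -/
def iterTotalDeriv {V : Type*} [NormedAddCommGroup V] [NormedSpace ℝ V] {k : ℕ}
    (f : HOTangent E Q k → V) : (j : ℕ) → HOTangent E Q (k + j) → V
  | 0 => f
  | j + 1 => totalDeriv (iterTotalDeriv f j)

/-- The partial derivative `∂L/∂q_(r)` in the natural coordinates induced by the chart `e`, as a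
covector on `E` (its components are the `∂L/∂q_(r)^i`). -/
def partialCoord {k : ℕ} (e : atlas E Q) (L : HOTangent E Q k → ℝ) (r : Fin (k + 1))
    (x : HOTangent E Q k) : E →L[ℝ] ℝ :=
  fderiv ℝ (fun v : E => L (ofCoords e (update (coords e x) r v))) (coords e x r)

/-- The Hessian `∂²L/∂q_(k)∂q_(k)` of `L` with respect to the highest-order velocities, in the
natural coordinates induced by the chart `e`. -/
def highestHessian {k : ℕ} (e : atlas E Q) (L : HOTangent E Q k → ℝ) (x : HOTangent E Q k) :
    E →L[ℝ] E →L[ℝ] ℝ :=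
  fderiv ℝ (fderiv ℝ (fun v : E => L (ofCoords e (update (coords e x) (Fin.last k) v))))
    (coords e x (Fin.last k))

/-- `L` is regular if its Hessian with respect to the highest-order velocities is nondegenerate at
every point, in all natural coordinates. -/
def IsRegularLagrangian {k : ℕ} (L : HOTangent E Q k → ℝ) : Prop :=
  ∀ (e : atlas E Q) (x : HOTangent E Q k), base x ∈ e.1.source →
    ∀ v : E, (∀ w : E, highestHessian e L x v w = 0) → v = 0

variable {m : ℕ}

/-- The Jacobi-Ostrogradsky momenta
`p̂^(s) = ∑_{j=0}^{k-1-s} (-1)^j d_T^j (∂L/∂q_(s+1+j))`, `0 ≤ s ≤ k - 1`, for `k = m + 1`, in the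
natural coordinates induced by the chart `e`, as covectors on `E`. -/
def momentum (e : atlas E Q) (L : HOTangent E Q (m + 1) → ℝ) (s : Fin (m + 1))
    (x : HOTangent E Q (2 * m + 1)) : E →L[ℝ] ℝ :=
  ∑ j : Fin (m + 1 - s), (-1 : ℝ) ^ (j : ℕ) •
    iterTotalDeriv (partialCoord e L ⟨s + 1 + j, by omega⟩) j
      (proj (show m + 1 + (j : ℕ) ≤ 2 * m + 1 by omega) x)

/-- The Legendre-Ostrogradsky map `leg_L : T^(2k-1)Q → T^*T^(k-1)Q`, `k = m + 1`: the covector at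
`τ^(k-1,2k-1)(x)` is `∑_s p̂^(s)(x) dq_(s)`, the Poincaré-Cartan form at `x`. -/
def leg (L : HOTangent E Q (m + 1) → ℝ) (x : HOTangent E Q (2 * m + 1)) :
    CotangentBundle (Fin (m + 1) → E) (HOTangent E Q m) :=
  ⟨proj (by omega) x, ∑ s : Fin (m + 1),
    (momentum (achart E (base x)) L s x).comp
      (mfderiv 𝓘(ℝ, Fin (m + 1) → E) 𝓘(ℝ, E)
        (fun y : HOTangent E Q m => coords (achart E (base x)) y s) (proj (by omega) x))⟩

/-- The Lagrangian energy `E_L = ∑_s p̂^(s) q_(s+1) - L` on `T^(2k-1)Q`, `k = m + 1`. -/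
def energy (L : HOTangent E Q (m + 1) → ℝ) (x : HOTangent E Q (2 * m + 1)) : ℝ :=
  ∑ s : Fin (m + 1), momentum (achart E (base x)) L s x
    (coords (achart E (base x)) x ⟨s + 1, by omega⟩) - L (proj (by omega) x)

variable [FiniteDimensional ℝ E]

/-- `L` is hyperregular if the Legendre-Ostrogradsky map is a global diffeomorphism. -/
def IsHyperregular (L : HOTangent E Q (m + 1) → ℝ) : Prop :=
  ∃ Φ : Diffeomorph 𝓘(ℝ, Fin (2 * m + 1 + 1) → E) (cotangentModel (Fin (m + 1) → E))
    (HOTangent E Q (2 * m + 1)) (CotangentBundle (Fin (m + 1) → E) (HOTangent E Q m)) ∞,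
    ⇑Φ = leg L

/-- The inverse `leg_L⁻¹` of the Legendre-Ostrogradsky map of a hyperregular Lagrangian. -/
def IsHyperregular.legInv {L : HOTangent E Q (m + 1) → ℝ} (hL : IsHyperregular L) :
    CotangentBundle (Fin (m + 1) → E) (HOTangent E Q m) → HOTangent E Q (2 * m + 1) :=
  hL.choose.symm

/-- The Hamiltonian `E_L ∘ leg_L⁻¹`; the second argument is the (local or global) inverse of the
Legendre-Ostrogradsky map. -/
def hamiltonian (L : HOTangent E Q (m + 1) → ℝ)
    (legInv : CotangentBundle (Fin (m + 1) → E) (HOTangent E Q m) → HOTangent E Q (2 * m + 1)) :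
    CotangentBundle (Fin (m + 1) → E) (HOTangent E Q m) → ℝ :=
  fun α => energy L (legInv α)

/-- `G = 𝓕H_o` on the set `s`, that is, `𝓕H = j_k ∘ G` on `s`, with `k = m + 1`. -/
def IsFiberDerivO (H : CotangentBundle (Fin (m + 1) → E) (HOTangent E Q m) → ℝ)
    (s : Set (CotangentBundle (Fin (m + 1) → E) (HOTangent E Q m)))
    (G : CotangentBundle (Fin (m + 1) → E) (HOTangent E Q m) → HOTangent E Q (m + 1)) : Prop :=
  ∀ α ∈ s, fiberDeriv H α = canonicalImmersion (G α)

end Lagrangian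

end HigherOrder

namespace HigherOrder

universe u v

/-! ### Jets of curves in normed spaces -/

section JetsNormed

variable {E F : Type*} [NormedAddCommGroup E] [NormedSpace ℝ E]
  [NormedAddCommGroup F] [NormedSpace ℝ F]

/-! Write k = m + 1. The heart is `fiberDeriv_hamiltonian`: for a smooth right inverse X of leg_L on
an open set, 𝓕H = j_k ∘ τ^(k,2k-1) ∘ X. On one fibre of T^*T^(k-1)Q let q(β) be the coordinates of
X(β). Since the covector of leg_L at q(β) is β itself, H(β) = ⟨β, (q_(1), …, q_(k))⟩ − L(q_(0), …,
q_(k)). The base point is fixed, so q_(0), …, q_(k-1) are constant on the fibre, and the variation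
of q enters only through δq_(k), with total coefficient p̂^(k-1) − ∂L/∂q_(k) = 0. What remains of
dH(η) is ⟨η, (q_(1), …, q_(k))⟩, which pairs η with j_k of the truncated jet. As j_k is injective,
𝓕H_o is unique and equals τ^(k,2k-1) ∘ X. In the hyperregular case it is a diffeomorphism followed
by a projection that is a truncation in natural charts, hence a surjective submersion, and composing
with leg_L ∘ Ψ gives τ ∘ Ψ = id.

Local inverses exist for regular L because the differential of leg_L is triangular
(`injective_fderiv_coordLeg`): once the components of order below k + i of a kernel vector vanish,
the momentum p̂^(k-1-i) sees the component of order k + i through ± the Hessian of L.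

The momenta are defined chart by chart, so the covector ∑ p̂^(s) dq_(s) and the energy must be shown
to be independent of the chart. No change-of-variables computation with d_T is made. Along a curve
with variation w, the covector is the boundary term of the first variation formula, whose derivative
is δL − EL(w). For two charts the terms δL agree, so the difference of boundary terms has a
derivative involving w only undifferentiated; cutting w off on ever shorter intervals forces that
difference to vanish (`boundaryTerm_eq_of_sum_eq`).

A section of T^(k+1)Q → T^(k)Q is, through j_(k+1), a vector field on T^(k)Q with values in an
affine subspace of each tangent space, so partitions of unity provide one; iterating gives a section
of τ^(k,2k-1). -/

theorem natCast_le_infty (r : ℕ) : ((r : ℕ) : ℕ∞ω) ≤ ∞ := by exact_mod_cast le_top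

/-- The `k`-jet at `t` of a curve in a normed space. -/
def jetVec (k : ℕ) (c : ℝ → E) (t : ℝ) : Fin (k + 1) → E := fun r => iteratedDeriv r c t

/-- The action of a map between normed spaces on `k`-jets of curves. -/
def jetMap (k : ℕ) (φ : E → F) (q : Fin (k + 1) → E) : Fin (k + 1) → F :=
  jetVec k (fun t => φ (taylorCurve q t)) 0

theorem jetVec_taylorCurve {k : ℕ} (q : Fin (k + 1) → E) : jetVec k (taylorCurve q) 0 = q :=
  funext fun r => iteratedDeriv_taylorCurve q r

theorem contDiff_taylorCurve_right {k : ℕ} (q : Fin (k + 1) → E) :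
    ContDiff ℝ ∞ (taylorCurve q) :=
  (contDiff_taylorCurve k).comp (contDiff_const.prodMk contDiff_id)

/-- The jet of a composition depends only on the jet of the inner curve. -/
theorem jetVec_comp_congr {k : ℕ} {φ : E → F} {c d : ℝ → E} {t t' : ℝ}
    (hφ : ContDiffAt ℝ ∞ φ (c t)) (hc : ContDiffAt ℝ ∞ c t) (hd : ContDiffAt ℝ ∞ d t')
    (h : jetVec k c t = jetVec k d t') :
    jetVec k (fun s => φ (c s)) t = jetVec k (fun s => φ (d s)) t' := by
  have h0 : c t = d t' := by simpa [jetVec] using congrFun h 0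
  have h' : ∀ r ≤ k, iteratedDeriv r c t = iteratedDeriv r d t' := fun r hr =>
    congrFun h ⟨r, Nat.lt_succ_of_le hr⟩
  funext r
  change iteratedDeriv r (φ ∘ c) t = iteratedDeriv r (φ ∘ d) t'
  -- Faà di Bruno's formula involves only derivatives of the inner curve of order at most `r`.
  rw [iteratedDeriv_vcomp_eq_sum_orderedFinpartition (n := ∞) hφ hc (natCast_le_infty _),
    iteratedDeriv_vcomp_eq_sum_orderedFinpartition (n := ∞) (h0 ▸ hφ) hd (natCast_le_infty _)]
  refine Finset.sum_congr rfl fun p _ => ?_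
  have : (fun j => iteratedDeriv (p.partSize j) c t) =
      fun j => iteratedDeriv (p.partSize j) d t' :=
    funext fun j => h' _ ((p.partSize_le j).trans (Nat.lt_succ_iff.1 r.2))
  rw [this, h0]

/-- By `jetVec_comp_congr`, the Taylor polynomial in the definition of `jetMap` may be replaced by
any smooth curve with the same jet, at any time. -/
theorem jetMap_jetVec {k : ℕ} {φ : E → F} {c : ℝ → E} {t : ℝ}
    (hφ : ContDiffAt ℝ ∞ φ (c t)) (hc : ContDiffAt ℝ ∞ c t) :
    jetMap k φ (jetVec k c t) = jetVec k (fun s => φ (c s)) t :=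
  (jetVec_comp_congr hφ hc (contDiff_taylorCurve_right _).contDiffAt
    (jetVec_taylorCurve _).symm).symm

theorem hasDerivAt_iteratedDeriv {c : ℝ → E} {t : ℝ} (hc : ContDiffAt ℝ ∞ c t) (r : ℕ) :
    HasDerivAt (iteratedDeriv r c) (iteratedDeriv (r + 1) c t) t := by
  have h1 : DifferentiableAt ℝ (iteratedDeriv r c) t := by
    simp only [funext (fun s => iteratedDeriv_eq_iteratedFDeriv (n := r) (f := c) (x := s))]
    exact (hc.differentiableAt_iteratedFDeriv (m := r)
      (by exact_mod_cast ENat.natCast_lt_top _)).continuousMultilinear_apply_const _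
  rw [iteratedDeriv_succ]; exact h1.hasDerivAt

theorem hasDerivAt_jetVec {k : ℕ} {c : ℝ → E} {t : ℝ} (hc : ContDiffAt ℝ ∞ c t) :
    HasDerivAt (jetVec k c) (fun r => iteratedDeriv (r + 1) c t) t :=
  hasDerivAt_pi.2 fun r => hasDerivAt_iteratedDeriv hc r

theorem contDiffAt_iteratedDeriv {c : ℝ → E} {t : ℝ} (hc : ContDiffAt ℝ ∞ c t) (r : ℕ) :
    ContDiffAt ℝ ∞ (iteratedDeriv r c) t := by
  simp only [funext (fun s => iteratedDeriv_eq_iteratedFDeriv (n := r) (f := c) (x := s))]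
  refine contDiffAt_infty.2 fun n => ?_
  exact ContDiffAt.clm_apply (f := fun s => ContinuousMultilinearMap.apply ℝ (fun _ : Fin r => ℝ) E (fun _ => 1))
    contDiffAt_const (hc.iteratedFDeriv_right (m := n) (i := r) (by exact_mod_cast le_top))

theorem contDiffAt_jetVec {k : ℕ} {c : ℝ → E} {t : ℝ} (hc : ContDiffAt ℝ ∞ c t) :
    ContDiffAt ℝ ∞ (jetVec k c) t :=
  contDiffAt_pi.2 fun r => contDiffAt_iteratedDeriv hc r

/-- The derivative in the last variable of a partial derivative in the last variable. -/
theorem iteratedDeriv_succ_snd {X : Type*} [NormedAddCommGroup X] [NormedSpace ℝ X]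
    {G : X × ℝ → F} {U : Set (X × ℝ)} (hU : IsOpen U) (hG : ContDiffOn ℝ ∞ G U) (r : ℕ)
    {p : X × ℝ} (hp : p ∈ U) :
    iteratedDeriv (r + 1) (fun t => G (p.1, t)) p.2 =
      fderiv ℝ (fun p : X × ℝ => iteratedDeriv r (fun t => G (p.1, t)) p.2) p (0, 1) := by
  rw [iteratedDeriv_succ]
  have h2 : HasFDerivAt (fun p : X × ℝ => iteratedDeriv r (fun t => G (p.1, t)) p.2)
      (fderiv ℝ (fun p : X × ℝ => iteratedDeriv r (fun t => G (p.1, t)) p.2) p) (p.1, p.2) :=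
    (((contDiffOn_iteratedDeriv_snd hU hG r).contDiffAt (hU.mem_nhds hp)).differentiableAt
      (by simp)).hasFDerivAt
  have h3 : HasDerivAt (fun t : ℝ => (p.1, t)) ((0 : X), (1 : ℝ)) p.2 :=
    (hasDerivAt_const _ _).prodMk (hasDerivAt_id _)
  exact (h2.comp_hasDerivAt p.2 h3).deriv

/-- Partial derivatives in the last variable commute with derivatives in the first one. -/
theorem fderiv_iteratedDeriv_snd {X : Type*} [NormedAddCommGroup X] [NormedSpace ℝ X]
    {G : X × ℝ → F} {U : Set (X × ℝ)} (hU : IsOpen U) (hG : ContDiffOn ℝ ∞ G U) (x : X) (r : ℕ)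
    {p : X × ℝ} (hp : p ∈ U) :
    fderiv ℝ (fun p : X × ℝ => iteratedDeriv r (fun t => G (p.1, t)) p.2) p (x, 0) =
      iteratedDeriv r (fun t => fderiv ℝ G (p.1, t) (x, 0)) p.2 := by
  induction r generalizing p with
  | zero => simp
  | succ r ih =>
    set H := fun p : X × ℝ => iteratedDeriv r (fun t => G (p.1, t)) p.2 with hHdef
    have hH : ContDiffOn ℝ ∞ H U := contDiffOn_iteratedDeriv_snd hU hG r
    have hG' : ContDiffOn ℝ ∞ (fun p => fderiv ℝ G p (x, 0)) U :=
      (hG.fderiv_of_isOpen hU (by simp)).clm_apply contDiffOn_const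
    have hHp : ContDiffAt ℝ ∞ H p := hH.contDiffAt (hU.mem_nhds hp)
    have hd : DifferentiableAt ℝ (fderiv ℝ H) p :=
      (hHp.fderiv_right (m := ∞) (by simp)).differentiableAt (by simp)
    have e1 : (fun p : X × ℝ => iteratedDeriv (r + 1) (fun t => G (p.1, t)) p.2) =ᶠ[𝓝 p]
        fun p => fderiv ℝ H p (0, 1) := by
      filter_upwards [hU.mem_nhds hp] with p' hp'
      exact iteratedDeriv_succ_snd hU hG r hp'
    have e2 : (fun p : X × ℝ => iteratedDeriv r (fun t => fderiv ℝ G (p.1, t) (x, 0)) p.2)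
        =ᶠ[𝓝 p] fun p => fderiv ℝ H p (x, 0) := by
      filter_upwards [hU.mem_nhds hp] with p' hp'
      exact (ih hp').symm
    have e3 := iteratedDeriv_succ_snd hU hG' r hp
    rw [e1.fderiv_eq, e3, e2.fderiv_eq, fderiv_clm_apply hd (differentiableAt_const _),
      fderiv_clm_apply hd (differentiableAt_const _)]
    -- Both sides are now the second derivative of `H` in the directions `(x, 0)` and `(0, 1)`,
    -- taken in opposite orders.
    have hs := (hHp.isSymmSndFDerivAt (n := ∞) (by simpa using natCast_le_infty 2)).eq (x, 0) (0, 1)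
    simpa using hs

theorem contDiffOn_jetMap {k : ℕ} {φ : E → F} {O : Set E} (hO : IsOpen O)
    (hφ : ContDiffOn ℝ ∞ φ O) : ContDiffOn ℝ ∞ (jetMap k φ) {q | q 0 ∈ O} := by
  have hP := contDiff_taylorCurve (E := E) k
  refine contDiffOn_pi.2 fun r => ?_
  exact (contDiffOn_iteratedDeriv_snd (hO.preimage hP.continuous)
    (hφ.comp hP.contDiffOn fun _ hp => hp) r).comp (s := {q | q 0 ∈ O})
    (f := fun q => (q, (0 : ℝ))) (contDiff_id.prodMk contDiff_const).contDiffOn fun q hq => by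
      rw [mem_preimage, taylorCurve_zero]; exact hq

theorem taylorCurve_add_smul {k : ℕ} (q ξ : Fin (k + 1) → E) (t ε : ℝ) :
    taylorCurve (q + ε • ξ) t = taylorCurve q t + ε • taylorCurve ξ t := by
  simp only [taylorCurve, Pi.add_apply, Pi.smul_apply, smul_add, Finset.sum_add_distrib,
    Finset.smul_sum]
  congr 1
  exact Finset.sum_congr rfl fun r _ => smul_comm _ _ _

/-- The derivative of the action on jets. -/
theorem fderiv_jetMap {k : ℕ} {φ : E → F} {O : Set E} (hO : IsOpen O)
    (hφ : ContDiffOn ℝ ∞ φ O) {q : Fin (k + 1) → E} (hq : q 0 ∈ O) (ξ : Fin (k + 1) → E) :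
    fderiv ℝ (jetMap k φ) q ξ =
      jetVec k (fun t => fderiv ℝ φ (taylorCurve q t) (taylorCurve ξ t)) 0 := by
  have hP := contDiff_taylorCurve (E := E) k
  have hU : IsOpen ((fun p : (Fin (k + 1) → E) × ℝ => taylorCurve p.1 p.2) ⁻¹' O) :=
    hO.preimage hP.continuous
  have hG : ContDiffOn ℝ ∞ (fun p : (Fin (k + 1) → E) × ℝ => φ (taylorCurve p.1 p.2))
      ((fun p : (Fin (k + 1) → E) × ℝ => taylorCurve p.1 p.2) ⁻¹' O) :=
    hφ.comp hP.contDiffOn fun _ hp => hp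
  have hq0 : (q, (0 : ℝ)) ∈ (fun p : (Fin (k + 1) → E) × ℝ => taylorCurve p.1 p.2) ⁻¹' O := by
    rw [mem_preimage, taylorCurve_zero]; exact hq
  have hd : DifferentiableAt ℝ (jetMap k φ) q :=
    ((contDiffOn_jetMap hO hφ).contDiffAt
      ((hO.preimage (continuous_apply 0)).mem_nhds hq)).differentiableAt (by simp)
  funext r
  have h1 : fderiv ℝ (jetMap k φ) q ξ r = fderiv ℝ (fun q => jetMap k φ q r) q ξ := by
    rw [fderiv_apply hd]; rfl
  have h2 : DifferentiableAt ℝ (fun p : (Fin (k + 1) → E) × ℝ =>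
      iteratedDeriv r (fun t => φ (taylorCurve p.1 t)) p.2) (q, 0) :=
    ((contDiffOn_iteratedDeriv_snd hU hG r).contDiffAt (hU.mem_nhds hq0)).differentiableAt
      (by simp)
  have h3 : HasFDerivAt (fun q : Fin (k + 1) → E => (q, (0 : ℝ)))
      (ContinuousLinearMap.inl ℝ _ _) q := hasFDerivAt_prodMk_left q 0
  have h4 := (HasFDerivAt.comp q h2.hasFDerivAt h3).fderiv
  have h5 : fderiv ℝ (fun q => jetMap k φ q r) q ξ = fderiv ℝ
      (fun p : (Fin (k + 1) → E) × ℝ => iteratedDeriv r (fun t => φ (taylorCurve p.1 t)) p.2)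
      (q, 0) (ξ, 0) := congrArg (fun A => A ξ) h4
  rw [h1, h5, fderiv_iteratedDeriv_snd hU hG ξ r hq0]
  refine Filter.EventuallyEq.iteratedDeriv_eq _ ?_
  have hc : ContinuousAt (fun t => taylorCurve q t) 0 :=
    (contDiff_taylorCurve_right q).continuous.continuousAt
  filter_upwards [hc.preimage_mem_nhds (hO.mem_nhds (by rwa [taylorCurve_zero]))] with t ht
  have hφt : HasFDerivAt φ (fderiv ℝ φ (taylorCurve q t)) (taylorCurve q t) :=
    ((hφ.contDiffAt (hO.mem_nhds ht)).differentiableAt (by simp)).hasFDerivAt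
  -- At fixed `t`, the derivative along the line `q + ε • ξ` is computed twice: for the two-variable
  -- function in direction `(ξ, 0)`, and for `φ` along a curve that is affine in `ε`.
  have hl : HasDerivAt (fun ε : ℝ => taylorCurve (q + ε • ξ) t) (taylorCurve ξ t) 0 := by
    simp only [taylorCurve_add_smul]
    simpa using ((hasDerivAt_id (0 : ℝ)).smul_const (taylorCurve ξ t)).const_add (taylorCurve q t)
  have hφt' : HasFDerivAt φ (fderiv ℝ φ (taylorCurve q t)) (taylorCurve (q + (0 : ℝ) • ξ) t) := by
    simpa using hφt
  have hGt : DifferentiableAt ℝ (fun p : (Fin (k + 1) → E) × ℝ => φ (taylorCurve p.1 p.2)) (q, t) :=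
    (hG.contDiffAt (hU.mem_nhds ht)).differentiableAt (by simp)
  have hl2 : HasDerivAt (fun ε : ℝ => (q + ε • ξ, t)) (ξ, (0 : ℝ)) 0 := by
    have := ((hasDerivAt_id (0 : ℝ)).smul_const ξ).const_add q
    simpa using this.prodMk (hasDerivAt_const (0 : ℝ) t)
  have hGt' : HasFDerivAt (fun p : (Fin (k + 1) → E) × ℝ => φ (taylorCurve p.1 p.2))
      (fderiv ℝ (fun p : (Fin (k + 1) → E) × ℝ => φ (taylorCurve p.1 p.2)) (q, t))
      (q + (0 : ℝ) • ξ, t) := by simpa using hGt.hasFDerivAt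
  exact (hGt'.comp_hasDerivAt (0 : ℝ) hl2).unique (hφt'.comp_hasDerivAt (0 : ℝ) hl)

theorem jetVec_prodMk {k : ℕ} {c : ℝ → E} {d : ℝ → F} {t : ℝ} (hc : ContDiffAt ℝ ∞ c t)
    (hd : ContDiffAt ℝ ∞ d t) :
    jetVec k (fun s => (c s, d s)) t = fun r => (jetVec k c t r, jetVec k d t r) := by
  funext r
  simp only [jetVec, iteratedDeriv_eq_iteratedFDeriv]
  rw [iteratedFDeriv_prodMk (n := ∞) hc hd (natCast_le_infty _)]
  rfl

/-- Tangent vectors to the jet space are jets of variations. The pair `(c, w)` is a curve in `E × E`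
and (x, v) ↦ dφ_x v is smooth, so both Taylor polynomials in `fderiv_jetMap` can be exchanged for
the given curves. -/
theorem fderiv_jetMap_jetVec {k : ℕ} {φ : E → F} {O : Set E} (hO : IsOpen O)
    (hφ : ContDiffOn ℝ ∞ φ O) {c w : ℝ → E} {t : ℝ} (ht : c t ∈ O) (hc : ContDiffAt ℝ ∞ c t)
    (hw : ContDiffAt ℝ ∞ w t) :
    fderiv ℝ (jetMap k φ) (jetVec k c t) (jetVec k w t) =
      jetVec k (fun s => fderiv ℝ φ (c s) (w s)) t := by
  rw [fderiv_jetMap hO hφ (by simpa [jetVec] using ht)]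
  have hψ : ContDiffAt ℝ ∞ (fun p : E × E => fderiv ℝ φ p.1 p.2) (c t, w t) :=
    (ContDiffAt.comp (c t, w t) (((hφ.contDiffAt (hO.mem_nhds ht)).fderiv_right (m := ∞) (by simp)))
      contDiffAt_fst).clm_apply contDiffAt_snd
  refine (jetVec_comp_congr (c := fun s => (c s, w s)) hψ (hc.prodMk hw)
    (d := fun s => (taylorCurve (jetVec k c t) s, taylorCurve (jetVec k w t) s))
    ((contDiff_taylorCurve_right _).prodMk (contDiff_taylorCurve_right _)).contDiffAt ?_).symm
  rw [jetVec_prodMk hc hw, jetVec_prodMk (contDiff_taylorCurve_right _).contDiffAt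
    (contDiff_taylorCurve_right _).contDiffAt, jetVec_taylorCurve, jetVec_taylorCurve]

end JetsNormed

/-! ### The boundary term of the first variation -/

section FirstVariation

variable {E : Type*} [NormedAddCommGroup E] [NormedSpace ℝ E]

/-- The momenta `∑_j (-1)^j (d/dt)^j a_(s+j)`, `s + j < N`, of a family of coefficients `a`. -/
def ostrogradskySum (N : ℕ) (a : ℕ → ℝ → E →L[ℝ] ℝ) (s : ℕ) (t : ℝ) : E →L[ℝ] ℝ :=
  ∑ j ∈ Finset.range (N - s), (-1 : ℝ) ^ j • iteratedDeriv j (a (s + j)) t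

/-- The boundary term `∑_s p^(s) w^(s)`. -/
def boundaryTerm (n : ℕ) (a : ℕ → ℝ → E →L[ℝ] ℝ) (w : ℝ → E) (t : ℝ) : ℝ :=
  ∑ s ∈ Finset.range n, ostrogradskySum (n + 1) a (s + 1) t (iteratedDeriv s w t)

variable {n N : ℕ} {a : ℕ → ℝ → E →L[ℝ] ℝ} {t : ℝ}

theorem ostrogradskySum_self (N : ℕ) (a : ℕ → ℝ → E →L[ℝ] ℝ) (t : ℝ) :
    ostrogradskySum (N + 1) a N t = a N t := by
  simp [ostrogradskySum]

/-- Ostrogradsky's recursion: the terms with `j ≥ 1` of the sum at `s` are minus the derivatives of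
those of the sum at `s + 1`, and the term `j = 0` is `a s`. -/
theorem hasDerivAt_ostrogradskySum (ha : ∀ r, ContDiffAt ℝ ∞ (a r) t) {s : ℕ} (hs : s < N) :
    HasDerivAt (ostrogradskySum N a (s + 1)) (a s t - ostrogradskySum N a s t) t := by
  have h : HasDerivAt (ostrogradskySum N a (s + 1))
      (∑ j ∈ Finset.range (N - (s + 1)),
        (-1 : ℝ) ^ j • iteratedDeriv (j + 1) (a (s + 1 + j)) t) t := by
    unfold ostrogradskySum
    exact HasDerivAt.fun_sum fun j _ => (hasDerivAt_iteratedDeriv (ha _) j).fun_const_smul _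
  convert h using 1
  rw [ostrogradskySum, show N - s = N - (s + 1) + 1 by omega, Finset.sum_range_succ',
    sub_eq_iff_eq_add]
  simp only [pow_zero, one_smul, iteratedDeriv_zero, add_zero]
  rw [← add_assoc, ← Finset.sum_add_distrib, eq_comm, add_eq_right]
  refine Finset.sum_eq_zero fun j _ => ?_
  rw [show s + (j + 1) = s + 1 + j by omega, pow_succ]
  ext v
  simp

/-- Repeated integration by parts in differential form: by the product rule and the recursion the
terms telescope, leaving the first variation minus the Euler-Lagrange covector `ostrogradskySum (n +
1) a 0` applied to `w`. -/
theorem hasDerivAt_boundaryTerm (ha : ∀ r, ContDiffAt ℝ ∞ (a r) t) {w : ℝ → E}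
    (hw : ContDiffAt ℝ ∞ w t) :
    HasDerivAt (boundaryTerm n a w)
      (∑ r ∈ Finset.range (n + 1), a r t (iteratedDeriv r w t) -
        ostrogradskySum (n + 1) a 0 t (w t)) t := by
  have h : HasDerivAt (boundaryTerm n a w) (∑ s ∈ Finset.range n,
      ((a s t - ostrogradskySum (n + 1) a s t) (iteratedDeriv s w t) +
        ostrogradskySum (n + 1) a (s + 1) t (iteratedDeriv (s + 1) w t))) t := by
    unfold boundaryTerm
    exact HasDerivAt.fun_sum fun s hs =>
      (hasDerivAt_ostrogradskySum ha (by have := Finset.mem_range.1 hs; omega)).clm_apply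
        (hasDerivAt_iteratedDeriv hw s)
  convert h using 1
  have h2 := Finset.sum_range_sub
    (fun s => ostrogradskySum (n + 1) a s t (iteratedDeriv s w t)) n
  simp only [ostrogradskySum_self, iteratedDeriv_zero] at h2
  rw [Finset.sum_range_succ, add_sub_assoc, ← h2, ← Finset.sum_add_distrib]
  refine Finset.sum_congr rfl fun s _ => ?_
  rw [sub_apply]; ring

theorem boundaryTerm_congr {w w' : ℝ → E} (h : w =ᶠ[𝓝 t] w') :
    boundaryTerm n a w t = boundaryTerm n a w' t :=
  Finset.sum_congr rfl fun s _ => by rw [h.iteratedDeriv_eq]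

theorem contDiffAt_ostrogradskySum (ha : ∀ r, ContDiffAt ℝ ∞ (a r) t) (s : ℕ) :
    ContDiffAt ℝ ∞ (ostrogradskySum N a s) t :=
  ContDiffAt.sum fun j _ => (contDiffAt_iteratedDeriv (ha _) j).const_smul _

/-- The boundary terms of two first variation formulas agree as soon as the first variations
themselves agree, for all variations `w`. -/
theorem boundaryTerm_eq_of_sum_eq {I : Set ℝ} (hI : IsOpen I) {a b : ℕ → ℝ → E →L[ℝ] ℝ}
    {A : ℝ → E →L[ℝ] E} (ha : ∀ r, ContDiffOn ℝ ∞ (a r) I) (hb : ∀ r, ContDiffOn ℝ ∞ (b r) I)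
    (hA : ContDiffOn ℝ ∞ A I)
    (h : ∀ w : ℝ → E, ContDiff ℝ ∞ w → ∀ t ∈ I,
      ∑ r ∈ Finset.range (n + 1), a r t (iteratedDeriv r w t) =
        ∑ r ∈ Finset.range (n + 1), b r t (iteratedDeriv r (fun s => A s (w s)) t))
    {w : ℝ → E} (hw : ContDiff ℝ ∞ w) {t₀ : ℝ} (ht₀ : t₀ ∈ I) :
    boundaryTerm n a w t₀ = boundaryTerm n b (fun s => A s (w s)) t₀ := by
  have ha' : ∀ t ∈ I, ∀ r, ContDiffAt ℝ ∞ (a r) t := fun t ht r =>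
    (ha r).contDiffAt (hI.mem_nhds ht)
  have hb' : ∀ t ∈ I, ∀ r, ContDiffAt ℝ ∞ (b r) t := fun t ht r =>
    (hb r).contDiffAt (hI.mem_nhds ht)
  have hA' : ∀ t ∈ I, ContDiffAt ℝ ∞ A t := fun t ht => hA.contDiffAt (hI.mem_nhds ht)
  -- In the derivative of `D w` the first variations cancel by `h`. Only the difference `B` of the
  -- two Euler-Lagrange covectors survives, and it acts on `w` without differentiating it.
  let D : (ℝ → E) → ℝ → ℝ := fun w t =>
    boundaryTerm n a w t - boundaryTerm n b (fun s => A s (w s)) t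
  let B : ℝ → E →L[ℝ] ℝ := fun t =>
    (ostrogradskySum (n + 1) b 0 t).comp (A t) - ostrogradskySum (n + 1) a 0 t
  have hD : ∀ w : ℝ → E, ContDiff ℝ ∞ w → ∀ t ∈ I, HasDerivAt (D w) (B t (w t)) t := by
    intro w hw t ht
    have h1 := (hasDerivAt_boundaryTerm (n := n) (ha' t ht) (w := w) hw.contDiffAt).sub
      (hasDerivAt_boundaryTerm (n := n) (hb' t ht) (w := fun s => A s (w s))
        ((hA' t ht).clm_apply hw.contDiffAt))
    refine h1.congr_deriv ?_
    rw [h w hw t ht]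
    simp [B]
  have hBw : ContinuousOn (fun t => B t (w t)) I := fun t ht => by
    have hB : ContinuousAt B t :=
      ((contDiffAt_ostrogradskySum (hb' t ht) 0).clm_comp (hA' t ht)).continuousAt.sub
        (contDiffAt_ostrogradskySum (ha' t ht) 0).continuousAt
    exact (hB.clm_apply hw.continuous.continuousAt).continuousWithinAt
  obtain ⟨δ, hδ, hball⟩ := Metric.isOpen_iff.1 hI t₀ ht₀
  have hIcc : Icc t₀ (t₀ + δ / 2) ⊆ I := fun t ht => hball (by
    rw [Metric.mem_ball, Real.dist_eq, abs_lt]; constructor <;> linarith [ht.1, ht.2])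
  obtain ⟨C, hC⟩ := isCompact_Icc.exists_bound_of_continuousOn (hBw.mono hIcc)
  -- Multiply `w` by a bump that is 1 near `t₀` and 0 near `t₀ + ε`. This keeps `D` at `t₀`, kills
  -- it at `t₀ + ε`, and multiplies its derivative by a factor in [0, 1], so the bound `C` does not
  -- depend on `ε`.
  have key : ∀ ε, 0 < ε → ε ≤ δ / 2 → |D w t₀| ≤ C * ε := by
    intro ε hε hεδ
    let f : ContDiffBump t₀ := ⟨ε / 4, ε / 2, by positivity, by linarith⟩
    let v : ℝ → E := fun t => f t • w t
    have hv : ContDiff ℝ ∞ v := f.contDiff.smul hw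
    have hv0 : v =ᶠ[𝓝 t₀] w := by
      filter_upwards [f.eventuallyEq_one] with t ht
      simp [v, ht]
    have hv1 : v =ᶠ[𝓝 (t₀ + ε)] fun _ => 0 := by
      have : {t | t₀ + ε / 2 < t} ∈ 𝓝 (t₀ + ε) :=
        (isOpen_lt continuous_const continuous_id).mem_nhds (by simp; linarith)
      filter_upwards [this] with t ht
      have hft : f t = 0 := f.zero_of_le_dist (by
        have h1 : t₀ + ε / 2 < t := ht
        rw [Real.dist_eq]
        exact le_trans (by linarith : ε / 2 ≤ t - t₀) (le_abs_self _))
      simp [v, hft]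
    have hD0 : D v t₀ = D w t₀ := by
      simp only [D]
      rw [boundaryTerm_congr hv0, boundaryTerm_congr
        (show (fun s => A s (v s)) =ᶠ[𝓝 t₀] fun s => A s (w s) by
          filter_upwards [hv0] with t ht using by rw [ht])]
    have hD1 : D v (t₀ + ε) = 0 := by
      simp only [D]
      rw [boundaryTerm_congr hv1, boundaryTerm_congr
        (show (fun s => A s (v s)) =ᶠ[𝓝 (t₀ + ε)] fun s => 0 by
          filter_upwards [hv1] with t ht using by rw [ht]; simp)]
      simp [boundaryTerm]
    have hsub : Icc t₀ (t₀ + ε) ⊆ Icc t₀ (t₀ + δ / 2) := Icc_subset_Icc_right (by linarith)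
    have hmv := (convex_Icc t₀ (t₀ + ε)).norm_image_sub_le_of_norm_hasDerivWithin_le
      (f := D v) (f' := fun t => B t (v t)) (C := C)
      (fun t ht => (hD v hv t (hIcc (hsub ht))).hasDerivWithinAt)
      (fun t ht => by
        have h1 := hC t (hsub ht)
        simp only [v, map_smul, norm_smul]
        calc ‖f t‖ * ‖B t (w t)‖ ≤ 1 * ‖B t (w t)‖ := by
              gcongr
              rw [Real.norm_eq_abs, abs_of_nonneg f.nonneg]; exact f.le_one
          _ ≤ C := by rw [one_mul]; exact h1)
      (left_mem_Icc.2 (by linarith)) (right_mem_Icc.2 (by linarith))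
    rw [hD1, hD0] at hmv
    simpa [abs_of_pos hε] using hmv
  have hlim : |D w t₀| ≤ 0 := by
    have hC' : Filter.Tendsto (fun ε : ℝ => C * ε) (𝓝[>] 0) (𝓝 0) := by
      have : Filter.Tendsto (fun ε : ℝ => C * ε) (𝓝 0) (𝓝 (C * 0)) :=
        (continuous_const.mul continuous_id).tendsto 0
      rw [mul_zero] at this
      exact this.mono_left nhdsWithin_le_nhds
    refine ge_of_tendsto hC' ?_
    filter_upwards [Ioc_mem_nhdsGT (show (0 : ℝ) < δ / 2 by linarith)] with ε hε
    exact key ε hε.1 hε.2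
  exact sub_eq_zero.1 (abs_nonpos_iff.1 hlim)

end FirstVariation

/-! ### Total derivatives and momenta in coordinates -/

section Coordinates

variable {E : Type*} [NormedAddCommGroup E] [NormedSpace ℝ E]
  {V : Type*} [NormedAddCommGroup V] [NormedSpace ℝ V] {k : ℕ}

/-- The total derivative in coordinates. -/
def coordTotalDeriv (f : (Fin (k + 1) → E) → V) (q : Fin (k + 1 + 1) → E) : V :=
  fderiv ℝ f (fun i => q i.castSucc) (fun i => q i.succ)

/-- The iterated total derivative in coordinates. -/
def iterCoordTotalDeriv (f : (Fin (k + 1) → E) → V) : (j : ℕ) → (Fin (k + j + 1) → E) → V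
  | 0 => f
  | j + 1 => coordTotalDeriv (iterCoordTotalDeriv f j)

/-- Truncation of jets, in coordinates. -/
def truncate {r k : ℕ} (h : r ≤ k) : (Fin (k + 1) → E) →L[ℝ] (Fin (r + 1) → E) :=
  ContinuousLinearMap.pi fun i => ContinuousLinearMap.proj (Fin.castLE (by omega) i)

theorem contDiff_truncate {r k : ℕ} (h : r ≤ k) :
    ContDiff ℝ ∞ (fun q : Fin (k + 1) → E => truncate h q) := ContinuousLinearMap.contDiff _

theorem hasFDerivAt_truncate {r k : ℕ} (h : r ≤ k) (q : Fin (k + 1) → E) :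
    HasFDerivAt (fun q : Fin (k + 1) → E => truncate h q) (truncate h) q :=
  ContinuousLinearMap.hasFDerivAt _

theorem truncate_jetVec {r k : ℕ} (h : r ≤ k) (c : ℝ → E) (t : ℝ) :
    truncate h (jetVec k c t) = jetVec r c t := rfl

theorem isOpen_jetDomain {X : Type*} [TopologicalSpace X] {O : Set X} (hO : IsOpen O) (k : ℕ) :
    IsOpen {q : Fin (k + 1) → X | q 0 ∈ O} := hO.preimage (continuous_apply 0)

theorem contDiffOn_coordTotalDeriv {O : Set E} (hO : IsOpen O) {f : (Fin (k + 1) → E) → V}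
    (hf : ContDiffOn ℝ ∞ f {q | q 0 ∈ O}) : ContDiffOn ℝ ∞ (coordTotalDeriv f) {q | q 0 ∈ O} := by
  refine ((hf.fderiv_of_isOpen (isOpen_jetDomain hO k) (m := ∞) (by simp)).comp
    (f := fun q : Fin (k + 1 + 1) → E => fun i : Fin (k + 1) => q i.castSucc)
    (by fun_prop) fun q hq => hq).clm_apply (by fun_prop)

theorem contDiffOn_iterCoordTotalDeriv {O : Set E} (hO : IsOpen O) {f : (Fin (k + 1) → E) → V}
    (hf : ContDiffOn ℝ ∞ f {q | q 0 ∈ O}) (j : ℕ) :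
    ContDiffOn ℝ ∞ (iterCoordTotalDeriv f j) {q | q 0 ∈ O} := by
  induction j with
  | zero => exact hf
  | succ j ih => exact contDiffOn_coordTotalDeriv hO ih

/-- Along the jets of a curve, the total derivative is the derivative in time. -/
theorem hasDerivAt_comp_jetVec {O : Set E} (hO : IsOpen O) {f : (Fin (k + 1) → E) → V}
    (hf : ContDiffOn ℝ ∞ f {q | q 0 ∈ O}) {c : ℝ → E} {t : ℝ} (hc : ContDiffAt ℝ ∞ c t)
    (ht : c t ∈ O) :
    HasDerivAt (fun s => f (jetVec k c s)) (coordTotalDeriv f (jetVec (k + 1) c t)) t := by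
  have h1 : DifferentiableAt ℝ f (jetVec k c t) :=
    (hf.contDiffAt ((isOpen_jetDomain hO k).mem_nhds
      (by simpa [jetVec] using ht))).differentiableAt (by simp)
  exact h1.hasFDerivAt.comp_hasDerivAt t (hasDerivAt_jetVec hc)

/-- Iterates `hasDerivAt_comp_jetVec`. An open set of times is required because each step
differentiates the previous identity. -/
theorem iterCoordTotalDeriv_jetVec {O : Set E} (hO : IsOpen O) {f : (Fin (k + 1) → E) → V}
    (hf : ContDiffOn ℝ ∞ f {q | q 0 ∈ O}) {c : ℝ → E} {I : Set ℝ} (hI : IsOpen I)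
    (hc : ContDiffOn ℝ ∞ c I) (hcI : MapsTo c I O) (j : ℕ) {t : ℝ} (ht : t ∈ I) :
    iterCoordTotalDeriv f j (jetVec (k + j) c t) =
      iteratedDeriv j (fun s => f (jetVec k c s)) t := by
  induction j generalizing t with
  | zero => simp [iterCoordTotalDeriv]
  | succ j ih =>
    have h1 := hasDerivAt_comp_jetVec hO (contDiffOn_iterCoordTotalDeriv hO hf j)
      (hc.contDiffAt (hI.mem_nhds ht)) (hcI ht)
    rw [iteratedDeriv_succ]
    have h2 : (fun s => iterCoordTotalDeriv f j (jetVec (k + j) c s)) =ᶠ[𝓝 t]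
        iteratedDeriv j (fun s => f (jetVec k c s)) := by
      filter_upwards [hI.mem_nhds ht] with s hs using ih hs
    rw [← h2.deriv_eq, h1.deriv]
    rfl

/-- The derivative of an iterated total derivative with respect to the highest-order variable. -/
theorem fderiv_iterCoordTotalDeriv_single {O : Set E} (hO : IsOpen O)
    {f : (Fin (k + 1) → E) → V} (hf : ContDiffOn ℝ ∞ f {q | q 0 ∈ O}) (j : ℕ)
    {q : Fin (k + j + 1) → E} (hq : q 0 ∈ O) (v : E) :
    fderiv ℝ (iterCoordTotalDeriv f j) q (Pi.single (Fin.last _) v) =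
      fderiv ℝ f (truncate (Nat.le_add_right k j) q) (Pi.single (Fin.last _) v) := by
  induction j with
  | zero => rfl
  | succ j ih =>
    have hg := contDiffOn_iterCoordTotalDeriv hO hf j
    set g := iterCoordTotalDeriv f j
    let ini : (Fin (k + j + 1 + 1) → E) →L[ℝ] (Fin (k + j + 1) → E) :=
      ContinuousLinearMap.pi fun i => ContinuousLinearMap.proj i.castSucc
    let tl : (Fin (k + j + 1 + 1) → E) →L[ℝ] (Fin (k + j + 1) → E) :=
      ContinuousLinearMap.pi fun i => ContinuousLinearMap.proj i.succ
    have h1 : DifferentiableAt ℝ (fderiv ℝ g) (ini q) :=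
      ((hg.contDiffAt ((isOpen_jetDomain hO (k + j)).mem_nhds hq)).fderiv_right (m := ∞)
        (by simp)).differentiableAt (by simp)
    have h2 : HasFDerivAt (fun q => fderiv ℝ g (ini q)) ((fderiv ℝ (fderiv ℝ g) (ini q)).comp ini) q :=
      h1.hasFDerivAt.comp q ini.hasFDerivAt
    have h3 := (h2.clm_apply tl.hasFDerivAt).fderiv
    have h4 : fderiv ℝ (iterCoordTotalDeriv f (j + 1)) q = fderiv ℝ (fun q => fderiv ℝ g (ini q) (tl q)) q := rfl
    -- The total derivative is `fderiv ℝ g (ini q) (tl q)`. The highest variable does not occur in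
    -- `ini q` and is the last entry of `tl q`, so it enters linearly, with the highest partial
    -- derivative of `g` as coefficient.
    have e1 : ini (Pi.single (Fin.last _) v) = 0 := by
      funext i
      change (Pi.single (Fin.last _) v : Fin (k + j + 1 + 1) → E) i.castSucc = 0
      rw [Pi.single_eq_of_ne (Fin.castSucc_lt_last i).ne]
    have e2 : tl (Pi.single (Fin.last _) v) = Pi.single (Fin.last _) v := by
      funext i
      change (Pi.single (Fin.last _) v : Fin (k + j + 1 + 1) → E) i.succ = _
      rw [← Fin.succ_last]
      by_cases hi : i = Fin.last _
      · subst hi; rw [Pi.single_eq_same, Pi.single_eq_same]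
      · rw [Pi.single_eq_of_ne hi, Pi.single_eq_of_ne (by simpa using hi)]
    rw [h4, h3]
    have h5 := ih (q := ini q) hq
    change fderiv ℝ g (ini q) (tl (Pi.single (Fin.last (k + j + 1)) v)) +
      fderiv ℝ (fderiv ℝ g) (ini q) (ini (Pi.single (Fin.last (k + j + 1)) v)) (tl q) = _
    rw [e1, e2, map_zero, zero_apply, add_zero, h5]
    rfl

end Coordinates

/-! ### Momenta in coordinates and their invariance -/

section CoordinateMomenta

variable {E : Type*} [NormedAddCommGroup E] [NormedSpace ℝ E] {k m : ℕ}

/-- The partial derivative `∂f/∂q_(r)` in coordinates. -/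
def coordPartial (f : (Fin (k + 1) → E) → ℝ) (r : Fin (k + 1)) (q : Fin (k + 1) → E) :
    E →L[ℝ] ℝ :=
  (fderiv ℝ f q).comp (ContinuousLinearMap.single ℝ (fun _ => E) r)

theorem contDiffOn_coordPartial {O : Set E} (hO : IsOpen O) {f : (Fin (k + 1) → E) → ℝ}
    (hf : ContDiffOn ℝ ∞ f {q | q 0 ∈ O}) (r : Fin (k + 1)) :
    ContDiffOn ℝ ∞ (coordPartial f r) {q | q 0 ∈ O} :=
  (hf.fderiv_of_isOpen (isOpen_jetDomain hO k) (m := ∞) (by simp)).clm_comp contDiffOn_const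

theorem sum_coordPartial (f : (Fin (k + 1) → E) → ℝ) (q ξ : Fin (k + 1) → E) :
    ∑ r, coordPartial f r q (ξ r) = fderiv ℝ f q ξ := by
  conv_rhs => rw [← Finset.univ_sum_single ξ, map_sum]
  rfl

/-- The Jacobi-Ostrogradsky momenta in coordinates. -/
def coordMomentum (f : (Fin (m + 1 + 1) → E) → ℝ) (s : Fin (m + 1)) (q : Fin (2 * m + 1 + 1) → E) :
    E →L[ℝ] ℝ :=
  ∑ j : Fin (m + 1 - s), (-1 : ℝ) ^ (j : ℕ) •
    iterCoordTotalDeriv (coordPartial f ⟨s + 1 + j, by omega⟩) j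
      (truncate (show m + 1 + (j : ℕ) ≤ 2 * m + 1 by omega) q)

theorem contDiffOn_coordMomentum {O : Set E} (hO : IsOpen O) {f : (Fin (m + 1 + 1) → E) → ℝ}
    (hf : ContDiffOn ℝ ∞ f {q | q 0 ∈ O}) (s : Fin (m + 1)) :
    ContDiffOn ℝ ∞ (coordMomentum f s) {q | q 0 ∈ O} := by
  refine ContDiffOn.sum fun j _ => ContDiffOn.const_smul _ ?_
  exact (contDiffOn_iterCoordTotalDeriv hO (contDiffOn_coordPartial hO hf _) j).comp
    (contDiff_truncate _).contDiffOn fun q hq => hq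

/-- For `s = m` only `j = 0` occurs. This identity produces the cancellation in
`fderiv_hamiltonian`. -/
theorem coordMomentum_last (f : (Fin (m + 1 + 1) → E) → ℝ) (q : Fin (2 * m + 1 + 1) → E) :
    coordMomentum f (Fin.last m) q =
      coordPartial f (Fin.last (m + 1)) (truncate (show m + 1 ≤ 2 * m + 1 by omega) q) := by
  have h : m + 1 - ((Fin.last m : Fin (m + 1)) : ℕ) = 1 := by simp
  unfold coordMomentum
  rw [Fintype.sum_eq_single (⟨0, by omega⟩ : Fin (m + 1 - ((Fin.last m : Fin (m + 1)) : ℕ)))]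
  · rw [pow_zero, one_smul]; rfl
  · intro j hj
    exact absurd (Fin.ext (by have := j.2; simp only; omega)) hj

/-- The partial derivatives along the jets of a curve, as a family indexed by `ℕ`. -/
def partialAlong (f : (Fin (k + 1) → E) → ℝ) (c : ℝ → E) (r : ℕ) (t : ℝ) : E →L[ℝ] ℝ :=
  -- The value 0 makes the smoothness hypotheses of the first variation lemmas, required for every
  -- `r`, hold; the sums themselves stop at `r = k`.
  if h : r < k + 1 then coordPartial f ⟨r, h⟩ (jetVec k c t) else 0

theorem partialAlong_of_lt (f : (Fin (k + 1) → E) → ℝ) (c : ℝ → E) {r : ℕ} (h : r < k + 1) :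
    partialAlong f c r = fun t => coordPartial f ⟨r, h⟩ (jetVec k c t) :=
  funext fun _ => dif_pos h

theorem contDiffOn_partialAlong {O : Set E} (hO : IsOpen O) {f : (Fin (k + 1) → E) → ℝ}
    (hf : ContDiffOn ℝ ∞ f {q | q 0 ∈ O}) {c : ℝ → E} {I : Set ℝ} (hI : IsOpen I)
    (hc : ContDiffOn ℝ ∞ c I) (hcI : MapsTo c I O) (r : ℕ) :
    ContDiffOn ℝ ∞ (partialAlong f c r) I := by
  by_cases h : r < k + 1
  · rw [partialAlong_of_lt f c h]
    exact (contDiffOn_coordPartial hO hf _).comp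
      (fun t ht => (contDiffAt_jetVec (hc.contDiffAt (hI.mem_nhds ht))).contDiffWithinAt)
      fun t ht => by simpa [jetVec] using hcI ht
  · have : partialAlong f c r = fun _ => 0 := funext fun _ => dif_neg h
    rw [this]; exact contDiffOn_const

theorem sum_partialAlong (f : (Fin (k + 1) → E) → ℝ) (c w : ℝ → E) (t : ℝ) :
    ∑ r ∈ Finset.range (k + 1), partialAlong f c r t (iteratedDeriv r w t) =
      fderiv ℝ f (jetVec k c t) (jetVec k w t) := by
  rw [Finset.sum_range, ← sum_coordPartial]
  refine Finset.sum_congr rfl fun r _ => ?_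
  rw [partialAlong_of_lt f c r.2]; rfl

/-- The momenta along the jets of a curve. -/
theorem coordMomentum_jetVec {O : Set E} (hO : IsOpen O) {f : (Fin (m + 1 + 1) → E) → ℝ}
    (hf : ContDiffOn ℝ ∞ f {q | q 0 ∈ O}) {c : ℝ → E} {I : Set ℝ} (hI : IsOpen I)
    (hc : ContDiffOn ℝ ∞ c I) (hcI : MapsTo c I O) (s : Fin (m + 1)) {t : ℝ} (ht : t ∈ I) :
    coordMomentum f s (jetVec (2 * m + 1) c t) =
      ostrogradskySum (m + 1 + 1) (partialAlong f c) (s + 1) t := by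
  rw [ostrogradskySum, show m + 1 + 1 - ((s : ℕ) + 1) = m + 1 - s by omega, Finset.sum_range]
  refine Finset.sum_congr rfl fun j _ => ?_
  rw [truncate_jetVec, iterCoordTotalDeriv_jetVec hO (contDiffOn_coordPartial hO hf _) hI hc hcI
    j ht, partialAlong_of_lt f c (show (s : ℕ) + 1 + j < m + 1 + 1 by omega)]

/-- The link between the covector and the calculus of variations. The index shifts by one: p̂^(s) is
`ostrogradskySum` at `s + 1`, the value at 0 being the Euler-Lagrange covector. -/
theorem sum_coordMomentum_jetVec {O : Set E} (hO : IsOpen O) {f : (Fin (m + 1 + 1) → E) → ℝ}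
    (hf : ContDiffOn ℝ ∞ f {q | q 0 ∈ O}) {c : ℝ → E} {I : Set ℝ} (hI : IsOpen I)
    (hc : ContDiffOn ℝ ∞ c I) (hcI : MapsTo c I O) (w : ℝ → E) {t : ℝ} (ht : t ∈ I) :
    ∑ s, coordMomentum f s (jetVec (2 * m + 1) c t) (jetVec m w t s) =
      boundaryTerm (m + 1) (partialAlong f c) w t := by
  rw [boundaryTerm, Finset.sum_range]
  refine Finset.sum_congr rfl fun s _ => ?_
  rw [coordMomentum_jetVec hO hf hI hc hcI s ht]; rfl

/-- The form `∑_s p^(s) dq_(s)` does not depend on the choice of coordinates. -/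
theorem sum_coordMomentum_jetMap {O O' : Set E} (hO : IsOpen O) (hO' : IsOpen O') {φ : E → E}
    (hφ : ContDiffOn ℝ ∞ φ O) (hφO : MapsTo φ O O') {f f' : (Fin (m + 1 + 1) → E) → ℝ}
    (hf : ContDiffOn ℝ ∞ f {q | q 0 ∈ O}) (hf' : ContDiffOn ℝ ∞ f' {q | q 0 ∈ O'})
    (hff' : ∀ q : Fin (m + 1 + 1) → E, q 0 ∈ O → f q = f' (jetMap (m + 1) φ q))
    {q : Fin (2 * m + 1 + 1) → E} (hq : q 0 ∈ O) (ξ : Fin (m + 1) → E) :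
    ∑ s, coordMomentum f s q (ξ s) =
      ∑ s, coordMomentum f' s (jetMap (2 * m + 1) φ q)
        (fderiv ℝ (jetMap m φ) (truncate (by omega) q) ξ s) := by
  -- Realize `q` as the jet at 0 of a curve and `ξ` as the jet of a variation of it; `I` is the set
  -- of times at which the curve stays in `O`.
  set c : ℝ → E := taylorCurve q with hcdef
  have hc : ContDiff ℝ ∞ c := contDiff_taylorCurve_right q
  set I : Set ℝ := c ⁻¹' O with hIdef
  have hI : IsOpen I := hO.preimage hc.continuous
  have h0 : (0 : ℝ) ∈ I := by rw [hIdef, mem_preimage, hcdef, taylorCurve_zero]; exact hq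
  have hcI : MapsTo c I O := fun t ht => ht
  have hc' : ContDiffOn ℝ ∞ (fun t => φ (c t)) I := hφ.comp hc.contDiffOn hcI
  have hA : ContDiffOn ℝ ∞ (fun t => fderiv ℝ φ (c t)) I :=
    (hφ.fderiv_of_isOpen hO (by simp)).comp hc.contDiffOn hcI
  -- The change of chart carries the variation `w` of `c` to the variation dφ(w) of `φ ∘ c`. The
  -- first variations agree by the chain rule for `f = f' ∘ jetMap (m + 1) φ`.
  have key := boundaryTerm_eq_of_sum_eq (n := m + 1) hI (A := fun t => fderiv ℝ φ (c t))
    (contDiffOn_partialAlong hO hf hI hc.contDiffOn hcI)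
    (contDiffOn_partialAlong hO' hf' hI hc' (hφO.comp hcI)) hA (fun w hw t ht => by
      rw [sum_partialAlong, sum_partialAlong]
      have hmem : jetVec (m + 1) c t 0 ∈ O := by simpa [jetVec] using hcI ht
      have h1 : f =ᶠ[𝓝 (jetVec (m + 1) c t)] f' ∘ jetMap (m + 1) φ := by
        filter_upwards [(isOpen_jetDomain hO (m + 1)).mem_nhds hmem] with p hp using hff' p hp
      have h2 : jetMap (m + 1) φ (jetVec (m + 1) c t) = jetVec (m + 1) (fun s => φ (c s)) t :=
        jetMap_jetVec (hφ.contDiffAt (hO.mem_nhds (hcI ht))) hc.contDiffAt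
      have h3 : DifferentiableAt ℝ (jetMap (m + 1) φ) (jetVec (m + 1) c t) :=
        ((contDiffOn_jetMap hO hφ).contDiffAt
          ((isOpen_jetDomain hO _).mem_nhds hmem)).differentiableAt (by simp)
      have h4 : DifferentiableAt ℝ f' (jetMap (m + 1) φ (jetVec (m + 1) c t)) := by
        rw [h2]
        refine (hf'.contDiffAt ((isOpen_jetDomain hO' _).mem_nhds ?_)).differentiableAt (by simp)
        simpa [jetVec] using hφO (hcI ht)
      rw [h1.fderiv_eq, fderiv_comp _ h4 h3, ContinuousLinearMap.comp_apply, h2,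
        fderiv_jetMap_jetVec hO hφ (hcI ht) hc.contDiffAt hw.contDiffAt])
    (contDiff_taylorCurve_right ξ) h0
  rw [← sum_coordMomentum_jetVec hO hf hI hc.contDiffOn hcI _ h0,
    ← sum_coordMomentum_jetVec hO' hf' hI hc' (hφO.comp hcI) _ h0,
    ← fderiv_jetMap_jetVec hO hφ (hcI h0) hc.contDiffAt (contDiff_taylorCurve_right ξ).contDiffAt,
    ← jetMap_jetVec (hφ.contDiffAt (hO.mem_nhds (hcI h0))) hc.contDiffAt, jetVec_taylorCurve,
    jetVec_taylorCurve, ← truncate_jetVec (show m ≤ 2 * m + 1 by omega), jetVec_taylorCurve] at key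
  exact key

/-- The action on jets commutes with the passage from a jet to its velocity. -/
theorem fderiv_jetMap_tail {φ : E → E} {O : Set E} (hO : IsOpen O)
    (hφ : ContDiffOn ℝ ∞ φ O) {q : Fin (k + 1 + 1) → E} (hq : q 0 ∈ O) :
    fderiv ℝ (jetMap k φ) (truncate k.le_succ q) (fun r => q r.succ) =
      fun r => jetMap (k + 1) φ q r.succ := by
  have hc := contDiff_taylorCurve_right q
  have hq' : taylorCurve q 0 ∈ O := by rwa [taylorCurve_zero]
  have hφ0 := hφ.contDiffAt (hO.mem_nhds hq')
  have h1 : jetVec k (taylorCurve q) 0 = truncate k.le_succ q := by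
    rw [← truncate_jetVec k.le_succ, jetVec_taylorCurve]
  have h2 : (fun t => jetMap k φ (jetVec k (taylorCurve q) t)) =ᶠ[𝓝 0]
      jetVec k (fun t => φ (taylorCurve q t)) := by
    filter_upwards [hc.continuous.continuousAt.preimage_mem_nhds (hO.mem_nhds hq')] with t ht
    exact jetMap_jetVec (hφ.contDiffAt (hO.mem_nhds ht)) hc.contDiffAt
  have h3 : HasFDerivAt (jetMap k φ) (fderiv ℝ (jetMap k φ) (jetVec k (taylorCurve q) 0))
      (jetVec k (taylorCurve q) 0) :=
    (((contDiffOn_jetMap hO hφ).contDiffAt ((isOpen_jetDomain hO _).mem_nhds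
      (by simpa [jetVec] using hq'))).differentiableAt (by simp)).hasFDerivAt
  have h4 := (h3.comp_hasDerivAt 0 (hasDerivAt_jetVec hc.contDiffAt)).congr_of_eventuallyEq h2.symm
  -- Both are velocities at 0 of the curve of `k`-jets of `φ ∘ taylorCurve q`.
  have h5 := h4.unique (hasDerivAt_jetVec (k := k) (ContDiffAt.comp (0 : ℝ) hφ0 hc.contDiffAt))
  rw [h1] at h5
  have h6 : (fun r : Fin (k + 1) => iteratedDeriv (r + 1) (taylorCurve q) 0) =
      fun r => q r.succ := funext fun r => iteratedDeriv_taylorCurve q r.succ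
  rw [h6] at h5
  exact h5

end CoordinateMomenta

/-! ### Natural coordinates on the higher-order tangent bundles -/

section NaturalCoordinates

variable {E : Type u} [NormedAddCommGroup E] [NormedSpace ℝ E]
  {Q : Type v} [TopologicalSpace Q] [ChartedSpace E Q]

theorem base_proj {r k : ℕ} (h : r ≤ k) (x : HOTangent E Q k) : base (proj h x) = base x := by
  obtain ⟨γ, rfl⟩ := exists_jet x
  rfl

theorem proj_proj {i r k : ℕ} (h : i ≤ r) (h' : r ≤ k) (x : HOTangent E Q k) :
    proj h (proj h' x) = proj (h.trans h') x := by
  obtain ⟨γ, rfl⟩ := exists_jet x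
  rfl

theorem proj_self {k : ℕ} (x : HOTangent E Q k) : proj le_rfl x = x := by
  obtain ⟨γ, rfl⟩ := exists_jet x
  rfl

theorem proj_surjective {r k : ℕ} (h : r ≤ k) :
    Surjective (proj h : HOTangent E Q k → HOTangent E Q r) := by
  intro x
  obtain ⟨γ, rfl⟩ := exists_jet x
  exact ⟨jet k γ, rfl⟩

theorem coords_proj {r k : ℕ} (h : r ≤ k) (e : atlas E Q) (x : HOTangent E Q k) :
    coords e (proj h x) = truncate h (coords e x) := by
  obtain ⟨γ, rfl⟩ := exists_jet x
  rfl

variable [IsManifold 𝓘(ℝ, E) ∞ Q] {k : ℕ}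

theorem ofCoords_coords (e : atlas E Q) {x : HOTangent E Q k} (h : base x ∈ e.1.source) :
    ofCoords e (coords e x) = x := (jetChart k e).left_inv h

theorem coords_ofCoords_self (e : atlas E Q) {q : Fin (k + 1) → E} (h : q 0 ∈ e.1.target) :
    coords e (ofCoords e q) = q := (jetChart k e).right_inv h

theorem base_ofCoords_mem (e : atlas E Q) {q : Fin (k + 1) → E} (h : q 0 ∈ e.1.target) :
    base (ofCoords e q) ∈ e.1.source := (jetChart k e).map_target h

theorem coords_mem_target (e : atlas E Q) {x : HOTangent E Q k} (h : base x ∈ e.1.source) :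
    coords e x 0 ∈ e.1.target := (jetChart k e).map_source h

theorem coords_transition_mem (e e' : atlas E Q) {x : HOTangent E Q k} (h : base x ∈ e.1.source)
    (h' : base x ∈ e'.1.source) :
    coords e x 0 ∈ e.1.target ∩ e.1.symm ⁻¹' e'.1.source := by
  refine ⟨coords_mem_target e h, ?_⟩
  rw [coords_mem e h, mem_preimage, e.1.left_inv h]; exact h'

/-- The change of natural coordinates is the action on jets of the change of charts. -/
theorem coords_eq_jetMap (e e' : atlas E Q) {x : HOTangent E Q k} (h : base x ∈ e.1.source)
    (h' : base x ∈ e'.1.source) :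
    coords e' x = jetMap k (fun v => e'.1 (e.1.symm v)) (coords e x) := by
  conv_lhs => rw [← ofCoords_coords e h]
  funext r
  exact coords_ofCoords e e' (coords_transition_mem e e' h h') r

theorem coords_ofCoords_eq_jetMap (e e' : atlas E Q) {q : Fin (k + 1) → E}
    (h : q 0 ∈ e.1.target ∩ e.1.symm ⁻¹' e'.1.source) :
    coords e' (ofCoords e q) = jetMap k (fun v => e'.1 (e.1.symm v)) q :=
  funext fun r => coords_ofCoords e e' h r

/-- The natural chart as a homeomorphism. -/
def jetHomeo (k : ℕ) (e : atlas E Q) :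
    OpenPartialHomeomorph (HOTangent E Q k) (Fin (k + 1) → E) :=
  (chartedSpaceCore E Q k).openPartialHomeomorph (jetChart k e) (mem_range_self e)

theorem jetHomeo_mem_atlas (e : atlas E Q) :
    jetHomeo k e ∈ atlas (Fin (k + 1) → E) (HOTangent E Q k) :=
  mem_iUnion₂.2 ⟨jetChart k e, mem_range_self e, rfl⟩

theorem jetHomeo_mem_maximalAtlas (e : atlas E Q) :
    jetHomeo k e ∈ IsManifold.maximalAtlas 𝓘(ℝ, Fin (k + 1) → E) ∞ (HOTangent E Q k) :=
  IsManifold.subset_maximalAtlas (jetHomeo_mem_atlas e)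

theorem isOpen_base_preimage (e : atlas E Q) :
    IsOpen {x : HOTangent E Q k | base x ∈ e.1.source} := (jetHomeo k e).open_source

theorem contMDiffOn_coords (e : atlas E Q) :
    ContMDiffOn 𝓘(ℝ, Fin (k + 1) → E) 𝓘(ℝ, Fin (k + 1) → E) ∞
      (coords e : HOTangent E Q k → _) {x | base x ∈ e.1.source} :=
  contMDiffOn_of_mem_maximalAtlas (jetHomeo_mem_maximalAtlas e)

theorem contMDiffOn_ofCoords (e : atlas E Q) :
    ContMDiffOn 𝓘(ℝ, Fin (k + 1) → E) 𝓘(ℝ, Fin (k + 1) → E) ∞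
      (ofCoords e : _ → HOTangent E Q k) {q | q 0 ∈ e.1.target} :=
  contMDiffOn_symm_of_mem_maximalAtlas (jetHomeo_mem_maximalAtlas e)

theorem contMDiff_proj {r k : ℕ} (h : r ≤ k) :
    ContMDiff 𝓘(ℝ, Fin (k + 1) → E) 𝓘(ℝ, Fin (r + 1) → E) ∞
      (proj h : HOTangent E Q k → HOTangent E Q r) := by
  intro x
  set e := achart E (base x)
  have hx : base x ∈ e.1.source := mem_chart_source E _
  have h1 : ContMDiffOn 𝓘(ℝ, Fin (k + 1) → E) 𝓘(ℝ, Fin (r + 1) → E) ∞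
      (fun y : HOTangent E Q k => (ofCoords e (truncate h (coords e y)) : HOTangent E Q r))
      {x | base x ∈ e.1.source} :=
    (contMDiffOn_ofCoords e).comp ((truncate h).contMDiff.comp_contMDiffOn (contMDiffOn_coords e))
      fun y hy => coords_mem_target e hy
  refine (h1.contMDiffAt ((isOpen_base_preimage e).mem_nhds hx)).congr_of_eventuallyEq ?_
  filter_upwards [(isOpen_base_preimage e).mem_nhds hx] with y hy
  rw [← coords_proj, ofCoords_coords e (by rwa [base_proj])]

/-- A tangent space is the model space read in the preferred chart at its base point, where the
velocity of the lifted curve is the shifted jet. -/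
theorem canonicalImmersion_eq (x : HOTangent E Q (k + 1)) :
    canonicalImmersion x = ⟨proj k.le_succ x,
      (fun r : Fin (k + 1) => coords (achart E (base x)) x r.succ : Fin (k + 1) → E)⟩ := by
  obtain ⟨γ, rfl⟩ := exists_jet x
  -- All tangent spaces unfold to the model space, so vectors over two base points can be compared
  -- without a transport.
  have key : ∀ (x y : HOTangent E Q k) (v w : Fin (k + 1) → E), x = y → v = w →
      (⟨x, v⟩ : TangentBundle 𝓘(ℝ, Fin (k + 1) → E) (HOTangent E Q k)) = ⟨y, w⟩ := by
    rintro x y v w rfl rfl; rfl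
  refine key _ _ _ _ (prolong_zero k γ) ?_
  rw [velocity_eq]
  funext r
  rw [coords_jet _ (mem_chart_source E _), prolong_zero]
  rfl

end NaturalCoordinates

/-! ### The Legendre-Ostrogradsky map in natural coordinates -/

section LegendreCoordinates

variable {E : Type u} [NormedAddCommGroup E] [NormedSpace ℝ E]
  {Q : Type v} [TopologicalSpace Q] [ChartedSpace E Q] [IsManifold 𝓘(ℝ, E) ∞ Q] {k m : ℕ}

/-- Both sides are the derivative at 0 of `g` along the lift of a curve representing `x`, so any
chart around the base point may be used, not only the preferred one. -/
theorem totalDeriv_eq_coordTotalDeriv {V : Type*} [NormedAddCommGroup V] [NormedSpace ℝ V]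
    (e : atlas E Q) {g : HOTangent E Q k → V} {G : (Fin (k + 1) → E) → V}
    (hG : ContDiffOn ℝ ∞ G {q | q 0 ∈ e.1.target})
    (hg : ∀ y, base y ∈ e.1.source → g y = G (coords e y))
    {x : HOTangent E Q (k + 1)} (hx : base x ∈ e.1.source) :
    totalDeriv g x = coordTotalDeriv G (coords e x) := by
  obtain ⟨γ, rfl⟩ := exists_jet x
  have hγ : γ 0 ∈ e.1.source := hx
  have hb : base (prolong k γ 0) ∈ e.1.source := by rw [prolong_zero]; exact hγ
  have hGd : ContDiffAt ℝ ∞ G (coords e (prolong k γ 0)) :=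
    hG.contDiffAt ((isOpen_jetDomain e.1.open_target k).mem_nhds (coords_mem_target e hb))
  have hmd : MDifferentiableAt 𝓘(ℝ, Fin (k + 1) → E) 𝓘(ℝ, V) g (prolong k γ 0) := by
    have h1 : ContMDiffAt 𝓘(ℝ, Fin (k + 1) → E) 𝓘(ℝ, V) ∞ (fun y => G (coords e y))
        (prolong k γ 0) :=
      hGd.contMDiffAt.comp _
        ((contMDiffOn_coords e).contMDiffAt ((isOpen_base_preimage e).mem_nhds hb))
    refine (h1.mdifferentiableAt (by simp)).congr_of_eventuallyEq ?_
    filter_upwards [(isOpen_base_preimage e).mem_nhds hb] with y hy using hg y hy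
  have hpr := hasMFDerivAt_prolong k γ 0
  have h2 : HasMFDerivAt 𝓘(ℝ, ℝ) 𝓘(ℝ, V) (g ∘ prolong k γ) 0
      ((mfderiv 𝓘(ℝ, Fin (k + 1) → E) 𝓘(ℝ, V) g (prolong k γ 0)).comp
        (mfderiv 𝓘(ℝ, ℝ) 𝓘(ℝ, Fin (k + 1) → E) (prolong k γ) 0)) :=
    hmd.hasMFDerivAt.comp 0 hpr.mdifferentiableAt.hasMFDerivAt
  have h3 : HasDerivAt (g ∘ prolong k γ) (totalDeriv g (jet (k + 1) γ)) 0 := by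
    have h : ∃ A : ℝ →L[ℝ] V, A 1 = totalDeriv g (jet (k + 1) γ) ∧
        HasFDerivAt (g ∘ prolong k γ) A 0 :=
      ⟨_, rfl, hasMFDerivAt_iff_hasFDerivAt.1 h2⟩
    obtain ⟨A, hA, h⟩ := h
    rw [← hA]
    exact h.hasDerivAt
  have h4 := hGd.differentiableAt (by simp)
  have h5 := h4.hasFDerivAt.comp_hasDerivAt 0 (hasDerivAt_coords_prolong (k := k) e γ hγ)
  have h6 : g ∘ prolong k γ =ᶠ[𝓝 0] G ∘ fun s => coords e (prolong k γ s) := by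
    filter_upwards [γ.contMDiff.continuous.continuousAt.preimage_mem_nhds
      (e.1.open_source.mem_nhds hγ)] with t ht
    refine hg _ ?_
    change γ (t + 0) ∈ _
    rw [add_zero]; exact ht
  rw [h3.unique (h5.congr_of_eventuallyEq h6), prolong_zero, coordTotalDeriv]
  have h7 : (fun r : Fin (k + 1) => coords e (jet (k + 1) γ) r.succ) =
      fun r : Fin (k + 1) => iteratedDeriv (r + 1) (fun s => e.1 (γ s)) 0 :=
    funext fun r => coords_jet e hγ r.succ
  rw [h7]
  rfl

theorem iterTotalDeriv_eq_iterCoordTotalDeriv {V : Type*} [NormedAddCommGroup V]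
    [NormedSpace ℝ V] (e : atlas E Q) {g : HOTangent E Q k → V} {G : (Fin (k + 1) → E) → V}
    (hG : ContDiffOn ℝ ∞ G {q | q 0 ∈ e.1.target})
    (hg : ∀ y, base y ∈ e.1.source → g y = G (coords e y)) (j : ℕ)
    {x : HOTangent E Q (k + j)} (hx : base x ∈ e.1.source) :
    iterTotalDeriv g j x = iterCoordTotalDeriv G j (coords e x) := by
  induction j with
  | zero => exact hg x hx
  | succ j ih =>
    exact totalDeriv_eq_coordTotalDeriv e (contDiffOn_iterCoordTotalDeriv e.1.open_target hG j)
      (fun y hy => ih hy) hx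

/-- The coordinate expression of a function on `T^(k)Q`. -/
def localRep (e : atlas E Q) (L : HOTangent E Q k → ℝ) (q : Fin (k + 1) → E) : ℝ :=
  L (ofCoords e q)

theorem localRep_coords (e : atlas E Q) (L : HOTangent E Q k → ℝ) {x : HOTangent E Q k}
    (hx : base x ∈ e.1.source) : localRep e L (coords e x) = L x := by
  rw [localRep, ofCoords_coords e hx]

variable {L : HOTangent E Q k → ℝ}

theorem contDiffOn_localRep (hL : ContMDiff 𝓘(ℝ, Fin (k + 1) → E) 𝓘(ℝ, ℝ) ∞ L) (e : atlas E Q) :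
    ContDiffOn ℝ ∞ (localRep e L) {q | q 0 ∈ e.1.target} :=
  (hL.comp_contMDiffOn (contMDiffOn_ofCoords e)).contDiffOn

theorem localRep_eq_comp_jetMap (e e' : atlas E Q) {q : Fin (k + 1) → E}
    (hq : q 0 ∈ e.1.target ∩ e.1.symm ⁻¹' e'.1.source) :
    localRep e L q = localRep e' L (jetMap k (fun v => e'.1 (e.1.symm v)) q) := by
  have h1 : base (ofCoords e q : HOTangent E Q k) ∈ e'.1.source := by
    have : q ∈ ((jetChart k e).symm.trans (jetChart k e')).source := by
      rw [jetChart_trans_source]; exact hq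
    exact this.2
  rw [localRep, localRep, ← coords_ofCoords_eq_jetMap e e' hq, ofCoords_coords e' h1]

theorem partialCoord_eq_coordPartial (hL : ContMDiff 𝓘(ℝ, Fin (k + 1) → E) 𝓘(ℝ, ℝ) ∞ L)
    (e : atlas E Q) (r : Fin (k + 1)) {x : HOTangent E Q k} (hx : base x ∈ e.1.source) :
    partialCoord e L r x = coordPartial (localRep e L) r (coords e x) := by
  have h1 : DifferentiableAt ℝ (localRep e L) (coords e x) :=
    ((contDiffOn_localRep hL e).contDiffAt ((isOpen_jetDomain e.1.open_target k).mem_nhds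
      (coords_mem_target e hx))).differentiableAt (by simp)
  have h2 : HasFDerivAt (localRep e L) (fderiv ℝ (localRep e L) (coords e x))
      (update (coords e x) r (coords e x r)) := by rw [update_eq_self]; exact h1.hasFDerivAt
  refine (h2.comp (coords e x r) (hasFDerivAt_update (coords e x) (coords e x r))).fderiv.trans ?_
  ext v
  rw [ContinuousLinearMap.comp_apply, coordPartial, ContinuousLinearMap.comp_apply]
  congr 1
  funext i
  by_cases hi : i = r
  · subst hi; simp
  · simp [hi]

end LegendreCoordinates

/-! ### Momenta, covector and energy in charts, and their transformation laws -/

section LegendreCoordinates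

variable {E : Type u} [NormedAddCommGroup E] [NormedSpace ℝ E]
  {Q : Type v} [TopologicalSpace Q] [ChartedSpace E Q] [IsManifold 𝓘(ℝ, E) ∞ Q] {m : ℕ}
  {L : HOTangent E Q (m + 1) → ℝ}

theorem momentum_eq_coordMomentum (hL : ContMDiff 𝓘(ℝ, Fin (m + 1 + 1) → E) 𝓘(ℝ, ℝ) ∞ L)
    (e : atlas E Q) (s : Fin (m + 1)) {x : HOTangent E Q (2 * m + 1)}
    (hx : base x ∈ e.1.source) :
    momentum e L s x = coordMomentum (localRep e L) s (coords e x) := by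
  refine Finset.sum_congr rfl fun j _ => ?_
  rw [iterTotalDeriv_eq_iterCoordTotalDeriv e
    (contDiffOn_coordPartial e.1.open_target (contDiffOn_localRep hL e) _)
    (fun y hy => partialCoord_eq_coordPartial hL e _ hy) j (by rwa [base_proj]), coords_proj]

/-- In the preferred chart at `y` itself, q_(s) is a linear projection; hence the form dq_(s)
occurring in `leg` is a constant projection of the model space. -/
theorem mfderiv_coords (y : HOTangent E Q m) (s : Fin (m + 1)) :
    mfderiv 𝓘(ℝ, Fin (m + 1) → E) 𝓘(ℝ, E)
      (fun y' : HOTangent E Q m => coords (achart E (base y)) y' s) y =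
      (ContinuousLinearMap.proj s : (Fin (m + 1) → E) →L[ℝ] E) := by
  have h : MDifferentiableAt 𝓘(ℝ, Fin (m + 1) → E) 𝓘(ℝ, E)
      (fun y' : HOTangent E Q m => coords (achart E (base y)) y' s) y := by
    have h1 := ((contMDiffOn_coords (k := m) (achart E (base y))).contMDiffAt
      ((isOpen_base_preimage _).mem_nhds (mem_chart_source E (base y)))).mdifferentiableAt
        (by simp)
    exact (ContinuousLinearMap.proj (R := ℝ) (φ := fun _ : Fin (m + 1) => E) s).mdifferentiableAt.comp
      y h1
  have hmem : coords (achart E (base y)) y 0 ∈ (achart E (base y)).1.target :=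
    coords_mem_target _ (mem_chart_source E (base y))
  have h2 : writtenInExtChartAt 𝓘(ℝ, Fin (m + 1) → E) 𝓘(ℝ, E) y
      (fun y' : HOTangent E Q m => coords (achart E (base y)) y' s)
      =ᶠ[𝓝 (coords (achart E (base y)) y)] fun q => q s := by
    filter_upwards [(isOpen_jetDomain (achart E (base y)).1.open_target m).mem_nhds hmem]
      with q hq
    exact congrFun (coords_ofCoords_self (achart E (base y)) hq) s
  have h3 : HasFDerivAt (fun q : Fin (m + 1) → E => q s)
      (ContinuousLinearMap.proj s : (Fin (m + 1) → E) →L[ℝ] E) (coords (achart E (base y)) y) :=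
    (ContinuousLinearMap.proj s : (Fin (m + 1) → E) →L[ℝ] E).hasFDerivAt
  exact HasMFDerivAt.mfderiv
    ⟨h.continuousAt, (h3.congr_of_eventuallyEq h2).hasFDerivWithinAt⟩

/-- The covector `∑_s p^(s) dq_(s)` in coordinates. -/
def coordCovector (f : (Fin (m + 1 + 1) → E) → ℝ) (q : Fin (2 * m + 1 + 1) → E) :
    (Fin (m + 1) → E) →L[ℝ] ℝ :=
  ∑ s, (coordMomentum f s q).comp (ContinuousLinearMap.proj s)

theorem coordCovector_apply (f : (Fin (m + 1 + 1) → E) → ℝ) (q : Fin (2 * m + 1 + 1) → E)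
    (ξ : Fin (m + 1) → E) :
    coordCovector f q ξ = ∑ s, coordMomentum f s q (ξ s) := by
  simp [coordCovector]

theorem contDiffOn_coordCovector {O : Set E} (hO : IsOpen O) {f : (Fin (m + 1 + 1) → E) → ℝ}
    (hf : ContDiffOn ℝ ∞ f {q | q 0 ∈ O}) : ContDiffOn ℝ ∞ (coordCovector f) {q | q 0 ∈ O} :=
  ContDiffOn.sum fun s _ => (contDiffOn_coordMomentum hO hf s).clm_comp contDiffOn_const

/-- The Legendre-Ostrogradsky map in the natural coordinates at the point. -/
theorem leg_eq (hL : ContMDiff 𝓘(ℝ, Fin (m + 1 + 1) → E) 𝓘(ℝ, ℝ) ∞ L)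
    (x : HOTangent E Q (2 * m + 1)) :
    leg L x = ⟨proj (by omega) x, coordCovector (localRep (achart E (base x)) L)
      (coords (achart E (base x)) x)⟩ := by
  unfold leg
  congr 1
  -- The chart in `leg` is chosen at `base x`, the tangent space is read in the chart at the base of
  -- the projection; these charts coincide.
  have hb : base (proj (show m ≤ 2 * m + 1 by omega) x) = base x := base_proj _ _
  have h := fun s => mfderiv_coords (proj (show m ≤ 2 * m + 1 by omega) x) s
  rw [hb] at h
  refine Finset.sum_congr rfl fun s _ => ?_
  rw [h s, momentum_eq_coordMomentum hL _ s (mem_chart_source E (base x))]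
  rfl

/-- The tensorial law of a covector on T^(k-1)Q, from `sum_coordMomentum_jetMap`. It allows `leg`
and `energy`, defined with a chart depending on the point, to be computed in one fixed chart. -/
theorem coordCovector_transition (hL : ContMDiff 𝓘(ℝ, Fin (m + 1 + 1) → E) 𝓘(ℝ, ℝ) ∞ L)
    (e e' : atlas E Q) {x : HOTangent E Q (2 * m + 1)} (h : base x ∈ e.1.source)
    (h' : base x ∈ e'.1.source) (ξ : Fin (m + 1) → E) :
    coordCovector (localRep e L) (coords e x) ξ =
      coordCovector (localRep e' L) (coords e' x)
        (fderiv ℝ (jetMap m (fun v => e'.1 (e.1.symm v)))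
          (coords e (proj (show m ≤ 2 * m + 1 by omega) x)) ξ) := by
  have hsub : {q : Fin (m + 1 + 1) → E | q 0 ∈ e.1.target ∩ e.1.symm ⁻¹' e'.1.source} ⊆
      {q | q 0 ∈ e.1.target} := fun q hq => hq.1
  have := sum_coordMomentum_jetMap (isOpen_transition e.1 e'.1) e'.1.open_target
    (contDiffOn_transition e.2 e'.2) (fun v hv => e'.1.map_source hv.2)
    ((contDiffOn_localRep hL e).mono hsub) (contDiffOn_localRep hL e')
    (fun q hq => localRep_eq_comp_jetMap e e' hq) (coords_transition_mem e e' h h') ξ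
  rw [coordCovector_apply, coordCovector_apply, coords_proj, this, ← coords_eq_jetMap e e' h h']

/-- The energy in coordinates. -/
def coordEnergy (f : (Fin (m + 1 + 1) → E) → ℝ) (q : Fin (2 * m + 1 + 1) → E) : ℝ :=
  coordCovector f q (fun s => q ⟨s + 1, by omega⟩) - f (truncate (by omega) q)

theorem contDiffOn_coordEnergy {O : Set E} (hO : IsOpen O) {f : (Fin (m + 1 + 1) → E) → ℝ}
    (hf : ContDiffOn ℝ ∞ f {q | q 0 ∈ O}) : ContDiffOn ℝ ∞ (coordEnergy f) {q | q 0 ∈ O} := by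
  exact ((contDiffOn_coordCovector hO hf).clm_apply (by fun_prop)).sub
    (hf.comp (contDiff_truncate _).contDiffOn fun q hq => hq)

theorem energy_eq_coordEnergy_achart (hL : ContMDiff 𝓘(ℝ, Fin (m + 1 + 1) → E) 𝓘(ℝ, ℝ) ∞ L)
    (x : HOTangent E Q (2 * m + 1)) :
    energy L x = coordEnergy (localRep (achart E (base x)) L) (coords (achart E (base x)) x) := by
  have hx := mem_chart_source E (base x)
  rw [energy, coordEnergy, coordCovector_apply, ← coords_proj, localRep_coords _ _
    (by rw [base_proj]; exact hx)]
  congr 1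
  exact Finset.sum_congr rfl fun s _ => by rw [momentum_eq_coordMomentum hL _ s hx]

/-- The coordinate expression of the energy does not depend on the coordinates. -/
theorem energy_eq_coordEnergy (hL : ContMDiff 𝓘(ℝ, Fin (m + 1 + 1) → E) 𝓘(ℝ, ℝ) ∞ L)
    (e : atlas E Q) {x : HOTangent E Q (2 * m + 1)} (h : base x ∈ e.1.source) :
    energy L x = coordEnergy (localRep e L) (coords e x) := by
  have hx := mem_chart_source E (base x)
  rw [energy_eq_coordEnergy_achart hL]
  set e₀ := achart E (base x)
  have hm : m + 1 ≤ 2 * m + 1 := by omega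
  rw [coordEnergy, coordEnergy, ← coords_proj hm e₀, ← coords_proj hm e,
    localRep_coords e₀ L (by rw [base_proj]; exact hx), localRep_coords e L (by rwa [base_proj]),
    coordCovector_transition hL e₀ e hx h]
  congr 2
  -- The tail (q_(1), …, q_(k)) transforms as a tangent vector, being the fibre part of j_k, so its
  -- pairing with the covector is invariant.
  have h1 := fderiv_jetMap_tail (k := m) (isOpen_transition e₀.1 e.1)
    (contDiffOn_transition e₀.2 e.2) (q := coords e₀ (proj hm x))
    (coords_transition_mem e₀ e (by rw [base_proj]; exact hx) (by rwa [base_proj]))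
  rw [← coords_eq_jetMap e₀ e (by rw [base_proj]; exact hx) (by rwa [base_proj]),
    ← coords_proj, proj_proj, coords_proj hm, coords_proj hm] at h1
  exact h1

theorem contMDiff_energy (hL : ContMDiff 𝓘(ℝ, Fin (m + 1 + 1) → E) 𝓘(ℝ, ℝ) ∞ L) :
    ContMDiff 𝓘(ℝ, Fin (2 * m + 1 + 1) → E) 𝓘(ℝ, ℝ) ∞ (energy L) := by
  intro x
  set e := achart E (base x)
  have hx : base x ∈ e.1.source := mem_chart_source E _
  have h1 := (contDiffOn_coordEnergy e.1.open_target (contDiffOn_localRep hL e)).contMDiffOn.comp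
    (contMDiffOn_coords e) fun y hy => coords_mem_target e hy
  refine (h1.contMDiffAt ((isOpen_base_preimage e).mem_nhds hx)).congr_of_eventuallyEq ?_
  filter_upwards [(isOpen_base_preimage e).mem_nhds hx] with y hy
    using energy_eq_coordEnergy hL e hy

/-- Identifies the cocycle of the tangent bundle with the derivative of `jetMap`, so the coordinate
laws above become statements about bundle trivializations. -/
theorem tangentCoordChange_eq (y₁ y₂ z : HOTangent E Q m)
    (h₁ : base z ∈ (achart E (base y₁)).1.source) (h₂ : base z ∈ (achart E (base y₂)).1.source) :
    (tangentBundleCore 𝓘(ℝ, Fin (m + 1) → E) (HOTangent E Q m)).coordChange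
        (achart (Fin (m + 1) → E) y₁) (achart (Fin (m + 1) → E) y₂) z =
      fderiv ℝ (jetMap m (fun v => (achart E (base y₂)).1 ((achart E (base y₁)).1.symm v)))
        (coords (achart E (base y₁)) z) := by
  rw [tangentBundleCore_coordChange_achart]
  rw [modelWithCornersSelf_coe, range_id, fderivWithin_univ]
  refine Filter.EventuallyEq.fderiv_eq ?_
  have hmem := coords_transition_mem (achart E (base y₁)) (achart E (base y₂)) h₁ h₂
  filter_upwards [(isOpen_jetDomain (isOpen_transition (achart E (base y₁)).1
    (achart E (base y₂)).1) m).mem_nhds hmem] with q hq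
  exact coords_ofCoords_eq_jetMap _ _ hq

/-- The Legendre-Ostrogradsky map in a trivialization of the cotangent bundle. -/
theorem inCoordinates_leg (hL : ContMDiff 𝓘(ℝ, Fin (m + 1 + 1) → E) 𝓘(ℝ, ℝ) ∞ L)
    (y₀ : HOTangent E Q m) {x : HOTangent E Q (2 * m + 1)}
    (hx : base x ∈ (achart E (base y₀)).1.source) :
    ContinuousLinearMap.inCoordinates (Fin (m + 1) → E)
      (TangentSpace 𝓘(ℝ, Fin (m + 1) → E) : HOTangent E Q m → Type _) ℝ
      (fun _ : HOTangent E Q m => ℝ) y₀ (leg L x).1 y₀ (leg L x).1 (leg L x).2 =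
      coordCovector (localRep (achart E (base y₀)) L) (coords (achart E (base y₀)) x) := by
  have hbx : base (proj (show m ≤ 2 * m + 1 by omega) x) = base x := base_proj _ _
  have hy : proj (show m ≤ 2 * m + 1 by omega) x ∈ (chartAt (Fin (m + 1) → E) y₀).source := by
    change base _ ∈ (achart E (base y₀)).1.source
    rw [hbx]; exact hx
  have htr : ∀ (y : HOTangent E Q m) (a : ℝ), (trivializationAt ℝ
      (fun _ : HOTangent E Q m => ℝ) y₀).continuousLinearMapAt ℝ y a = a := fun y a =>
    DFunLike.congr_fun
      (Bundle.Trivial.continuousLinearMapAt_trivialization ℝ (HOTangent E Q m) ℝ y) a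
  have hleg := leg_eq hL x
  rw [← hbx] at hleg
  rw [hleg, ContinuousLinearMap.inCoordinates,
    TangentBundle.symmL_trivializationAt_eq_core hy, tangentCoordChange_eq _ _ _ hy (mem_chart_source E _)]
  ext ξ
  refine Eq.trans ?_ (coordCovector_transition hL (achart E (base y₀))
    (achart E (base (proj (show m ≤ 2 * m + 1 by omega) x))) hx (by rw [hbx]; exact mem_chart_source E _) ξ).symm
  exact htr _ _

end LegendreCoordinates

/-! ### Regular Lagrangians -/

section RegularCoordinates

variable {E : Type*} [NormedAddCommGroup E] [NormedSpace ℝ E] {k m : ℕ}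

/-- Passes from the Hessian of the restriction of `f` to the last variable, as in `highestHessian`,
to the derivative of `coordPartial`, the form in which it appears in the differential of the
momenta. -/
theorem fderiv_fderiv_update_last {O : Set E} (hO : IsOpen O) {f : (Fin (m + 1 + 1) → E) → ℝ}
    (hf : ContDiffOn ℝ ∞ f {q | q 0 ∈ O}) {q : Fin (m + 1 + 1) → E} (hq : q 0 ∈ O) (v : E) :
    fderiv ℝ (fderiv ℝ (fun v => f (update q (Fin.last (m + 1)) v))) (q (Fin.last (m + 1))) v =
      fderiv ℝ (coordPartial f (Fin.last (m + 1))) q (Pi.single (Fin.last (m + 1)) v) := by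
  have hpi : ∀ p : Fin (m + 1 + 1) → E, ∀ v' : E, HasFDerivAt (update p (Fin.last (m + 1)))
      (ContinuousLinearMap.single ℝ (fun _ : Fin (m + 1 + 1) => E) (Fin.last (m + 1))) v' := by
    intro p v'
    refine (hasFDerivAt_update p v').congr_fderiv ?_
    ext v i
    by_cases hi : i = Fin.last (m + 1)
    · subst hi; simp
    · simp [hi]
  -- Since k ≥ 1, changing q_(k) does not move q_(0), so the whole slice stays in the chart domain.
  have hmem : ∀ v' : E, update q (Fin.last (m + 1)) v' 0 ∈ O := fun v' => by
    rw [update_of_ne (by simp [Fin.ext_iff])]; exact hq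
  have h1 : fderiv ℝ (fun v => f (update q (Fin.last (m + 1)) v)) =
      fun v' => coordPartial f (Fin.last (m + 1)) (update q (Fin.last (m + 1)) v') := by
    funext v'
    have h2 : DifferentiableAt ℝ f (update q (Fin.last (m + 1)) v') :=
      (hf.contDiffAt ((isOpen_jetDomain hO _).mem_nhds (hmem v'))).differentiableAt (by simp)
    exact (h2.hasFDerivAt.comp v' (hpi q v')).fderiv
  have h3 : DifferentiableAt ℝ (coordPartial f (Fin.last (m + 1)))
      (update q (Fin.last (m + 1)) (q (Fin.last (m + 1)))) :=
    ((contDiffOn_coordPartial hO hf _).contDiffAt ((isOpen_jetDomain hO _).mem_nhds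
      (hmem _))).differentiableAt (by simp)
  have h4 := (h3.hasFDerivAt.comp (q (Fin.last (m + 1))) (hpi q _)).fderiv
  rw [update_eq_self] at h4
  rw [h1]
  exact congrArg (fun A => A v) h4

/-- The Legendre-Ostrogradsky map in coordinates. -/
def coordLeg (f : (Fin (m + 1 + 1) → E) → ℝ) (q : Fin (2 * m + 1 + 1) → E) :
    (Fin (m + 1) → E) × ((Fin (m + 1) → E) →L[ℝ] ℝ) :=
  (truncate (show m ≤ 2 * m + 1 by omega) q, coordCovector f q)

theorem contDiffOn_coordLeg {O : Set E} (hO : IsOpen O) {f : (Fin (m + 1 + 1) → E) → ℝ}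
    (hf : ContDiffOn ℝ ∞ f {q | q 0 ∈ O}) : ContDiffOn ℝ ∞ (coordLeg f) {q | q 0 ∈ O} := by
  exact (contDiff_truncate _).contDiffOn.prodMk (contDiffOn_coordCovector hO hf)

theorem fderiv_coordMomentum {O : Set E} (hO : IsOpen O) {f : (Fin (m + 1 + 1) → E) → ℝ}
    (hf : ContDiffOn ℝ ∞ f {q | q 0 ∈ O}) {q : Fin (2 * m + 1 + 1) → E} (hq : q 0 ∈ O)
    (s : Fin (m + 1)) (δ : Fin (2 * m + 1 + 1) → E) :
    fderiv ℝ (coordMomentum f s) q δ = ∑ j : Fin (m + 1 - s), (-1 : ℝ) ^ (j : ℕ) •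
      fderiv ℝ (iterCoordTotalDeriv (coordPartial f ⟨s + 1 + j, by omega⟩) j)
        (truncate (show m + 1 + (j : ℕ) ≤ 2 * m + 1 by omega) q)
        (truncate (show m + 1 + (j : ℕ) ≤ 2 * m + 1 by omega) δ) := by
  have h : ∀ j : Fin (m + 1 - s), HasFDerivAt (fun q : Fin (2 * m + 1 + 1) → E =>
      (-1 : ℝ) ^ (j : ℕ) • iterCoordTotalDeriv (coordPartial f ⟨s + 1 + j, by omega⟩) j
        (truncate (show m + 1 + (j : ℕ) ≤ 2 * m + 1 by omega) q))
      ((-1 : ℝ) ^ (j : ℕ) •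
        (fderiv ℝ (iterCoordTotalDeriv (coordPartial f ⟨s + 1 + j, by omega⟩) j)
          (truncate (show m + 1 + (j : ℕ) ≤ 2 * m + 1 by omega) q)).comp
        (truncate (show m + 1 + (j : ℕ) ≤ 2 * m + 1 by omega))) q := by
    intro j
    have hd : DifferentiableAt ℝ (iterCoordTotalDeriv (coordPartial f ⟨s + 1 + j, by omega⟩) j)
        (truncate (show m + 1 + (j : ℕ) ≤ 2 * m + 1 by omega) q) :=
      ((contDiffOn_iterCoordTotalDeriv hO (contDiffOn_coordPartial hO hf _) j).contDiffAt
        ((isOpen_jetDomain hO _).mem_nhds hq)).differentiableAt (by simp)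
    have hc := hd.hasFDerivAt.comp q (hasFDerivAt_truncate _ q)
    exact hc.const_smul ((-1 : ℝ) ^ (j : ℕ))
  have h2 := (HasFDerivAt.fun_sum (u := Finset.univ) fun j _ => h j).fderiv
  have h3 : fderiv ℝ (coordMomentum f s) q δ = _ := congrArg (fun A => A δ) h2
  rw [h3]
  simp

/-- The differential of the Legendre-Ostrogradsky map of a regular Lagrangian is injective. -/
theorem injective_fderiv_coordLeg {O : Set E} (hO : IsOpen O) {f : (Fin (m + 1 + 1) → E) → ℝ}
    (hf : ContDiffOn ℝ ∞ f {q | q 0 ∈ O}) {q : Fin (2 * m + 1 + 1) → E} (hq : q 0 ∈ O)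
    (hreg : ∀ v : E, (∀ w, fderiv ℝ (coordPartial f (Fin.last (m + 1)))
      (truncate (show m + 1 ≤ 2 * m + 1 by omega) q) (Pi.single (Fin.last (m + 1)) v) w = 0) →
        v = 0) :
    Injective (fderiv ℝ (coordLeg f) q) := by
  rw [injective_iff_map_eq_zero]
  intro δ hδ
  have hcov : DifferentiableAt ℝ (coordCovector f) q :=
    ((contDiffOn_coordCovector hO hf).contDiffAt
      ((isOpen_jetDomain hO _).mem_nhds hq)).differentiableAt (by simp)
  have h1 : fderiv ℝ (coordLeg f) q = (truncate (show m ≤ 2 * m + 1 by omega)).prod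
      (fderiv ℝ (coordCovector f) q) :=
    ((hasFDerivAt_truncate _ q).prodMk hcov.hasFDerivAt).fderiv
  rw [h1] at hδ
  have h2 : truncate (show m ≤ 2 * m + 1 by omega) δ = 0 := congrArg Prod.fst hδ
  have h3 : fderiv ℝ (coordCovector f) q δ = 0 := congrArg Prod.snd hδ
  have h4 : ∀ s, fderiv ℝ (coordMomentum f s) q δ = 0 := by
    intro s
    have h5 : coordMomentum f s = fun q => (coordCovector f q).comp
        (ContinuousLinearMap.single ℝ (fun _ : Fin (m + 1) => E) s) := by
      funext q
      ext v
      rw [ContinuousLinearMap.comp_apply, coordCovector_apply, Fintype.sum_eq_single s]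
      · simp
      · intro i hi; simp [hi]
    let B : ((Fin (m + 1) → E) →L[ℝ] ℝ) →L[ℝ] (E →L[ℝ] ℝ) :=
      (ContinuousLinearMap.compL ℝ E (Fin (m + 1) → E) ℝ).flip
        (ContinuousLinearMap.single ℝ (fun _ : Fin (m + 1) => E) s)
    have h6 : HasFDerivAt (coordMomentum f s) (B.comp (fderiv ℝ (coordCovector f) q)) q := by
      rw [h5]
      exact B.hasFDerivAt.comp q hcov.hasFDerivAt
    rw [h6.fderiv, ContinuousLinearMap.comp_apply, h3, map_zero]
  -- Triangularity: the base component of the map gives the vanishing up to order `m`, and each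
  -- further order comes from one momentum, taken from the top downwards.
  have key : ∀ i ≤ m + 1, ∀ r : Fin (2 * m + 1 + 1), (r : ℕ) < m + 1 + i → δ r = 0 := by
    intro i
    induction i with
    | zero =>
      intro _ r hr
      exact congrFun h2 ⟨r, hr⟩
    | succ i ih =>
      intro hi r hr
      by_cases hr' : (r : ℕ) < m + 1 + i
      · exact ih (by omega) r hr'
      obtain ⟨r, hr2⟩ := r
      obtain rfl : r = m + 1 + i := by simp only at hr hr'; omega
      apply hreg
      -- In p̂^(m-i) the term `j = i` is d_T^i of ∂L/∂q_(m+1), whose dependence on q_(m+1+i) is the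
      -- Hessian; the terms `j < i` involve only components already known to vanish.
      have h6 := h4 ⟨m - i, by omega⟩
      rw [fderiv_coordMomentum hO hf hq, Fintype.sum_eq_single ⟨i, by simp only; omega⟩] at h6
      · have h7 : (⟨m - i + 1 + i, by omega⟩ : Fin (m + 1 + 1)) = Fin.last (m + 1) :=
          Fin.ext (by simp only [Fin.val_last]; omega)
        have h8 : truncate (show m + 1 + i ≤ 2 * m + 1 by omega) δ =
            Pi.single (Fin.last (m + 1 + i)) (δ ⟨m + 1 + i, by omega⟩) := by
          funext j
          by_cases hj : j = Fin.last (m + 1 + i)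
          · subst hj; rw [Pi.single_eq_same]; rfl
          · rw [Pi.single_eq_of_ne hj]
            refine ih (by omega) _ ?_
            have := j.2
            have : (j : ℕ) ≠ m + 1 + i := fun h => hj (Fin.ext h)
            simp only [Fin.val_castLE]; omega
        simp only [h7, h8] at h6
        rw [fderiv_iterCoordTotalDeriv_single hO (contDiffOn_coordPartial hO hf _) i hq,
          smul_eq_zero] at h6
        intro w
        have h9 := h6.resolve_left (pow_ne_zero _ (by norm_num))
        exact congrArg (fun A => A w) h9
      · intro j hj
        have hj' : (j : ℕ) < i := by
          have := j.2
          have : (j : ℕ) ≠ i := fun h => hj (Fin.ext h)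
          simp only at *; omega
        have h8 : truncate (show m + 1 + (j : ℕ) ≤ 2 * m + 1 by omega) δ = 0 := by
          funext a
          refine ih (by omega) _ ?_
          have := a.2
          simp only [Fin.val_castLE]; omega
        rw [h8, map_zero, smul_zero]
  funext r
  exact key (m + 1) le_rfl r (by omega)

theorem finrank_coordLeg [FiniteDimensional ℝ E] :
    Module.finrank ℝ (Fin (2 * m + 1 + 1) → E) =
      Module.finrank ℝ ((Fin (m + 1) → E) × ((Fin (m + 1) → E) →L[ℝ] ℝ)) := by
  have h : Module.finrank ℝ ((Fin (m + 1) → E) →L[ℝ] ℝ) = Module.finrank ℝ (Fin (m + 1) → E) := by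
    rw [← (LinearMap.toContinuousLinearMap :
      ((Fin (m + 1) → E) →ₗ[ℝ] ℝ) ≃ₗ[ℝ] _).finrank_eq]
    exact Subspace.dual_finrank_eq
  rw [Module.finrank_prod, h, Module.finrank_pi_fintype, Module.finrank_pi_fintype]
  simp only [Finset.sum_const, Finset.card_univ, Fintype.card_fin, smul_eq_mul]
  ring

/-- The inverse function theorem for maps with invertible differentials at all points. -/
theorem exists_openPartialHomeomorph_of_injective_fderiv {X Y : Type*} [NormedAddCommGroup X]
    [NormedSpace ℝ X] [FiniteDimensional ℝ X] [NormedAddCommGroup Y] [NormedSpace ℝ Y]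
    [FiniteDimensional ℝ Y] (hXY : Module.finrank ℝ X = Module.finrank ℝ Y) {g : X → Y} {W : Set X}
    (hW : IsOpen W) (hg : ContDiffOn ℝ ∞ g W) (hinj : ∀ x ∈ W, Injective (fderiv ℝ g x)) {x : X}
    (hx : x ∈ W) :
    ∃ P : OpenPartialHomeomorph X Y, x ∈ P.source ∧ P.source ⊆ W ∧ (P : X → Y) = g ∧
      ContDiffOn ℝ ∞ P.symm P.target := by
  have hequiv : ∀ y ∈ W, ∃ A : X ≃L[ℝ] Y, HasFDerivAt g (A : X →L[ℝ] Y) y := by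
    intro y hy
    refine ⟨(LinearEquiv.ofInjectiveOfFinrankEq (fderiv ℝ g y : X →ₗ[ℝ] Y) (hinj y hy)
      hXY).toContinuousLinearEquiv, ?_⟩
    exact (((hg.contDiffAt (hW.mem_nhds hy)).differentiableAt (by simp)).hasFDerivAt).congr_fderiv
      (by ext v; rfl)
  obtain ⟨A, hA⟩ := hequiv x hx
  have hgx := hg.contDiffAt (hW.mem_nhds hx)
  let P₀ := hgx.toOpenPartialHomeomorph g hA (by simp)
  let P := P₀.restrOpen W hW
  have hPs : P.source = P₀.source ∩ W := P₀.restrOpen_source W hW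
  refine ⟨P, ?_, ?_, rfl, ?_⟩
  · rw [hPs]; exact ⟨hgx.mem_toOpenPartialHomeomorph_source hA (by simp), hx⟩
  · rw [hPs]; exact inter_subset_right
  · intro a ha
    have h1 : P.symm a ∈ W := by
      have := P.map_target ha
      rw [hPs] at this; exact this.2
    obtain ⟨B, hB⟩ := hequiv _ h1
    exact (P.contDiffAt_symm ha hB (hg.contDiffAt (hW.mem_nhds h1))).contDiffWithinAt

end RegularCoordinates

/-! ### Local inverses of the Legendre-Ostrogradsky map and the fiber derivative -/

section LocalInverses

variable {E : Type u} [NormedAddCommGroup E] [NormedSpace ℝ E]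
  {Q : Type v} [TopologicalSpace Q] [ChartedSpace E Q] [IsManifold 𝓘(ℝ, E) ∞ Q] {m : ℕ}
  {L : HOTangent E Q (m + 1) → ℝ}

theorem chartAt_leg (hL : ContMDiff 𝓘(ℝ, Fin (m + 1 + 1) → E) 𝓘(ℝ, ℝ) ∞ L)
    (α₀ : CotangentBundle (Fin (m + 1) → E) (HOTangent E Q m)) {x : HOTangent E Q (2 * m + 1)}
    (hx : base x ∈ (achart E (base α₀.1)).1.source) :
    chartAt (ModelProd (Fin (m + 1) → E) ((Fin (m + 1) → E) →L[ℝ] ℝ)) α₀ (leg L x) =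
      coordLeg (localRep (achart E (base α₀.1)) L) (coords (achart E (base α₀.1)) x) := by
  rw [hom_chart, inCoordinates_leg hL α₀.1 hx, coordLeg, ← coords_proj]
  rfl

theorem mem_chartAt_source_iff (α₀ α : CotangentBundle (Fin (m + 1) → E) (HOTangent E Q m)) :
    α ∈ (chartAt (ModelProd (Fin (m + 1) → E) ((Fin (m + 1) → E) →L[ℝ] ℝ)) α₀).source ↔
      base α.1 ∈ (achart E (base α₀.1)).1.source := by
  rw [FiberBundle.chartedSpace_chartAt]
  simp only [OpenPartialHomeomorph.trans_source, OpenPartialHomeomorph.prod_source,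
    OpenPartialHomeomorph.refl_source, mem_inter_iff, mem_preimage, mem_prod, mem_univ, and_true]
  constructor
  · rintro ⟨h1, h2⟩
    rw [Bundle.Trivialization.coe_coe, Bundle.Trivialization.coe_fst _ h1] at h2
    exact h2
  · intro h
    have h1 : α ∈ (trivializationAt ((Fin (m + 1) → E) →L[ℝ] ℝ)
        (fun x : HOTangent E Q m => TangentSpace 𝓘(ℝ, Fin (m + 1) → E) x →L[ℝ] ℝ)
          α₀.proj).source := by
      rw [Bundle.Trivialization.mem_source, hom_trivializationAt_baseSet]
      exact ⟨h, mem_univ _⟩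
    refine ⟨h1, ?_⟩
    rw [Bundle.Trivialization.coe_coe, Bundle.Trivialization.coe_fst _ h1]
    exact h

/-- Splits an equality in the total space into base and fibre parts, both read in the chart at the
base point of `α`; that chart is fixed while `α` moves in its fibre. -/
theorem leg_eq_mk (hL : ContMDiff 𝓘(ℝ, Fin (m + 1 + 1) → E) 𝓘(ℝ, ℝ) ∞ L)
    {x : HOTangent E Q (2 * m + 1)} {α : CotangentBundle (Fin (m + 1) → E) (HOTangent E Q m)}
    (h : leg L x = α) :
    proj (by omega) x = α.1 ∧ coordCovector (localRep (achart E (base α.1)) L)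
      (coords (achart E (base α.1)) x) = α.2 := by
  subst h
  have hb : base (proj (show m ≤ 2 * m + 1 by omega) x) = base x := base_proj _ _
  refine ⟨rfl, ?_⟩
  rw [leg_eq hL]
  simp only [hb]

/-- In the trivialization at `b` this map is composition with fixed linear maps on both sides. It
transfers smoothness on the cotangent bundle to the fibres, where `fiberDeriv` differentiates. -/
theorem contMDiff_fiberInclusion (b : HOTangent E Q m) :
    ContMDiff 𝓘(ℝ, (Fin (m + 1) → E) →L[ℝ] ℝ) (cotangentModel (Fin (m + 1) → E)) ∞
      (fun β : (Fin (m + 1) → E) →L[ℝ] ℝ =>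
        (⟨b, β⟩ : CotangentBundle (Fin (m + 1) → E) (HOTangent E Q m))) := by
  intro β₀
  rw [contMDiffAt_hom_bundle]
  refine ⟨contMDiffAt_const, ?_⟩
  let S : (Fin (m + 1) → E) →L[ℝ] (Fin (m + 1) → E) := (trivializationAt (Fin (m + 1) → E)
    (TangentSpace 𝓘(ℝ, Fin (m + 1) → E)) b).symmL ℝ b
  let T : ℝ →L[ℝ] ℝ :=
    (trivializationAt ℝ (fun _ : HOTangent E Q m => ℝ) b).continuousLinearMapAt ℝ b
  have h : ContDiff ℝ ∞ fun β : (Fin (m + 1) → E) →L[ℝ] ℝ => T.comp (β.comp S) :=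
    contDiff_const.clm_comp (contDiff_id.clm_comp contDiff_const)
  exact h.contDiffAt.contMDiffAt

/-- The fiber derivative of the Hamiltonian: the terms coming from the derivative of the inverse of
the Legendre-Ostrogradsky map cancel. -/
theorem fderiv_hamiltonian (hL : ContMDiff 𝓘(ℝ, Fin (m + 1 + 1) → E) 𝓘(ℝ, ℝ) ∞ L)
    {X : CotangentBundle (Fin (m + 1) → E) (HOTangent E Q m) → HOTangent E Q (2 * m + 1)}
    {V : Set (CotangentBundle (Fin (m + 1) → E) (HOTangent E Q m))} (hV : IsOpen V)
    (hX : ContMDiffOn (cotangentModel (Fin (m + 1) → E)) 𝓘(ℝ, Fin (2 * m + 1 + 1) → E) ∞ X V)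
    (hXleg : ∀ α ∈ V, leg L (X α) = α) (b : HOTangent E Q m) {α : (Fin (m + 1) → E) →L[ℝ] ℝ}
    (hα : (⟨b, α⟩ : CotangentBundle (Fin (m + 1) → E) (HOTangent E Q m)) ∈ V)
    (η : (Fin (m + 1) → E) →L[ℝ] ℝ) :
    fderiv ℝ (fun β : (Fin (m + 1) → E) →L[ℝ] ℝ => hamiltonian L X ⟨b, β⟩) α η =
      η fun s => coords (achart E (base b)) (X ⟨b, α⟩) ⟨s + 1, by omega⟩ := by
  set e := achart E (base b) with he
  set f := localRep e L with hfdef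
  have hf : ContDiffOn ℝ ∞ f {q | q 0 ∈ e.1.target} := contDiffOn_localRep hL e
  have hι := contMDiff_fiberInclusion b
  have hm : m ≤ 2 * m + 1 := by omega
  have hm' : m + 1 ≤ 2 * m + 1 := by omega
  let q : ((Fin (m + 1) → E) →L[ℝ] ℝ) → Fin (2 * m + 1 + 1) → E := fun β => coords e (X ⟨b, β⟩)
  have hVb : {β : (Fin (m + 1) → E) →L[ℝ] ℝ |
      (⟨b, β⟩ : CotangentBundle (Fin (m + 1) → E) (HOTangent E Q m)) ∈ V} ∈ 𝓝 α :=
    (hV.preimage hι.continuous).mem_nhds hα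
  have hfacts : ∀ β : (Fin (m + 1) → E) →L[ℝ] ℝ,
      (⟨b, β⟩ : CotangentBundle (Fin (m + 1) → E) (HOTangent E Q m)) ∈ V →
      base (X ⟨b, β⟩) ∈ e.1.source ∧ proj hm (X ⟨b, β⟩) = b ∧ coordCovector f (q β) = β := by
    intro β hβ
    obtain ⟨h1, h2⟩ := leg_eq_mk hL (hXleg _ hβ)
    refine ⟨?_, h1, h2⟩
    rw [← base_proj hm, h1]
    exact mem_chart_source E _
  obtain ⟨hbase, hproj, hcov⟩ := hfacts α hα
  have hqd : DifferentiableAt ℝ q α := by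
    have h1 : ContMDiffAt 𝓘(ℝ, (Fin (m + 1) → E) →L[ℝ] ℝ) 𝓘(ℝ, Fin (2 * m + 1 + 1) → E) ∞ q α :=
      ((contMDiffOn_coords e).contMDiffAt ((isOpen_base_preimage e).mem_nhds hbase)).comp α
        ((hX.contMDiffAt (hV.mem_nhds hα)).comp α (hι α))
    exact h1.contDiffAt.differentiableAt (by simp)
  obtain ⟨q', hqf⟩ : ∃ q', HasFDerivAt q q' α := ⟨_, hqd.hasFDerivAt⟩
  let tl : (Fin (2 * m + 1 + 1) → E) →L[ℝ] (Fin (m + 1) → E) :=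
    ContinuousLinearMap.pi fun s => ContinuousLinearMap.proj ⟨s + 1, by omega⟩
  -- As `X` inverts `leg`, the covector in the energy is `β` itself, so no derivative of the momenta
  -- will be needed.
  have hH : (fun β : (Fin (m + 1) → E) →L[ℝ] ℝ => hamiltonian L X ⟨b, β⟩) =ᶠ[𝓝 α]
      fun β => β (tl (q β)) - f (truncate hm' (q β)) := by
    filter_upwards [hVb] with β hβ
    obtain ⟨h1, -, h3⟩ := hfacts β hβ
    rw [hamiltonian, energy_eq_coordEnergy hL e h1, coordEnergy]
    change coordCovector f (q β) (tl (q β)) - f (truncate hm' (q β)) = _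
    rw [h3]
  have hqmem : truncate hm' (q α) 0 ∈ e.1.target := coords_mem_target e hbase
  have hfd : DifferentiableAt ℝ f (truncate hm' (q α)) :=
    (hf.contDiffAt ((isOpen_jetDomain e.1.open_target _).mem_nhds hqmem)).differentiableAt (by simp)
  have htl : HasFDerivAt (fun β => tl (q β)) (tl.comp q') α := tl.hasFDerivAt.comp α hqf
  have htr : HasFDerivAt (fun β => truncate hm' (q β)) ((truncate hm').comp q') α :=
    (hasFDerivAt_truncate hm' (q α)).comp α hqf
  have hD := ((hasFDerivAt_id α).clm_apply htl).sub (hfd.hasFDerivAt.comp α htr)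
  -- Along a fibre the base point `b` is fixed, and with it q_(0), …, q_(m).
  have h0 : ∀ r : Fin (2 * m + 1 + 1), (r : ℕ) < m + 1 → q' η r = 0 := by
    intro r hr
    have h1 : HasFDerivAt (fun β => truncate hm (q β)) ((truncate hm).comp q') α :=
      (hasFDerivAt_truncate hm (q α)).comp α hqf
    have h2 : (fun β => truncate hm (q β)) =ᶠ[𝓝 α] fun _ => coords e b := by
      filter_upwards [hVb] with β hβ
      rw [← coords_proj, (hfacts β hβ).2.1]
    have h3 := h1.unique ((hasFDerivAt_const (coords e b) α).congr_of_eventuallyEq h2)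
    exact congrFun (congrArg (fun A => A η) h3) ⟨r, hr⟩
  have h1 : tl (q' η) = Pi.single (Fin.last m) (q' η ⟨m + 1, by omega⟩) := by
    funext s
    by_cases hs : s = Fin.last m
    · subst hs; rw [Pi.single_eq_same]; rfl
    · rw [Pi.single_eq_of_ne hs]
      refine h0 _ ?_
      have := s.2
      have : (s : ℕ) ≠ m := fun h => hs (Fin.ext h)
      simp only; omega
  have h2 : truncate hm' (q' η) = Pi.single (Fin.last (m + 1)) (q' η ⟨m + 1, by omega⟩) := by
    funext s
    by_cases hs : s = Fin.last (m + 1)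
    · subst hs; rw [Pi.single_eq_same]; rfl
    · rw [Pi.single_eq_of_ne hs]
      refine h0 _ ?_
      have := s.2
      have : (s : ℕ) ≠ m + 1 := fun h => hs (Fin.ext h)
      simp only [Fin.val_castLE]; omega
  -- The decisive cancellation: the last component of `α` is the top momentum, that is, ∂L/∂q_(m+1).
  have h3 : α (Pi.single (Fin.last m) (q' η ⟨m + 1, by omega⟩)) =
      fderiv ℝ f (truncate hm' (q α)) (Pi.single (Fin.last (m + 1)) (q' η ⟨m + 1, by omega⟩)) := by
    conv_lhs => rw [← hcov]
    rw [coordCovector_apply, Fintype.sum_eq_single (Fin.last m)]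
    · rw [Pi.single_eq_same, coordMomentum_last]; rfl
    · intro i hi
      rw [Pi.single_eq_of_ne hi, map_zero]
  rw [hH.fderiv_eq]
  refine (congrArg (fun A => A η) hD.fderiv).trans ?_
  change α (tl (q' η)) + η (tl (q α)) - fderiv ℝ f (truncate hm' (q α)) (truncate hm' (q' η)) = _
  rw [h1, h2, h3, add_sub_cancel_left]
  rfl

variable [FiniteDimensional ℝ E]

/-- The inverse function theorem applies to `coordLeg`, whose injective differential is invertible
by equality of dimensions; conjugation with the natural chart and the bundle chart at `leg L x`
carries the result back. -/
theorem exists_partialDiffeomorph_leg (hL : ContMDiff 𝓘(ℝ, Fin (m + 1 + 1) → E) 𝓘(ℝ, ℝ) ∞ L)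
    (hreg : IsRegularLagrangian L) (x : HOTangent E Q (2 * m + 1)) :
    ∃ Φ : PartialDiffeomorph 𝓘(ℝ, Fin (2 * m + 1 + 1) → E)
      (cotangentModel (Fin (m + 1) → E)) (HOTangent E Q (2 * m + 1))
      (CotangentBundle (Fin (m + 1) → E) (HOTangent E Q m)) ∞,
      x ∈ Φ.source ∧ EqOn Φ (leg L) Φ.source := by
  have hb : base (leg L x).1 = base x := base_proj (show m ≤ 2 * m + 1 by omega) x
  set e := achart E (base (leg L x).1) with he
  have hx : base x ∈ e.1.source := by rw [← hb]; exact mem_chart_source E _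
  have hf := contDiffOn_localRep hL e
  have hW := isOpen_jetDomain e.1.open_target (2 * m + 1)
  have hinj : ∀ q ∈ {q : Fin (2 * m + 1 + 1) → E | q 0 ∈ e.1.target},
      Injective (fderiv ℝ (coordLeg (localRep e L)) q) := by
    intro q hq
    refine injective_fderiv_coordLeg e.1.open_target hf hq fun v hv => ?_
    have hm : m + 1 ≤ 2 * m + 1 := by omega
    have hq' : truncate hm q 0 ∈ e.1.target := hq
    refine hreg e (ofCoords e (truncate hm q)) (base_ofCoords_mem e hq') v fun w => ?_
    have h := hv w
    rw [← fderiv_fderiv_update_last e.1.open_target hf hq' v] at h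
    unfold highestHessian
    rw [coords_ofCoords_self e hq']
    exact h
  obtain ⟨P, hxP, hPW, hPg, hPsymm⟩ := exists_openPartialHomeomorph_of_injective_fderiv
    finrank_coordLeg hW (contDiffOn_coordLeg e.1.open_target hf) hinj (coords_mem_target e hx)
  let C := chartAt (ModelProd (Fin (m + 1) → E) ((Fin (m + 1) → E) →L[ℝ] ℝ)) (leg L x)
  -- The same map with its codomain read as `ModelProd`, the space in which the charts of the
  -- cotangent bundle take values.
  let P' : OpenPartialHomeomorph (Fin (2 * m + 1 + 1) → E)
    (ModelProd (Fin (m + 1) → E) ((Fin (m + 1) → E) →L[ℝ] ℝ)) := P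
  have hleg : ∀ y : HOTangent E Q (2 * m + 1), base y ∈ e.1.source →
      C (leg L y) = P (coords e y) := fun y hy => by
    rw [hPg]; exact chartAt_leg hL (leg L x) hy
  have hlegC : ∀ y : HOTangent E Q (2 * m + 1), base y ∈ e.1.source → leg L y ∈ C.source :=
    fun y hy => (mem_chartAt_source_iff _ _).2 (by
      change base (proj (show m ≤ 2 * m + 1 by omega) y) ∈ _
      rw [base_proj]; exact hy)
  have hP'1 : ContMDiffOn 𝓘(ℝ, Fin (2 * m + 1 + 1) → E) (cotangentModel (Fin (m + 1) → E)) ∞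
      P' P'.source := by
    have h : ContMDiffOn 𝓘(ℝ, Fin (2 * m + 1 + 1) → E)
        𝓘(ℝ, (Fin (m + 1) → E) × ((Fin (m + 1) → E) →L[ℝ] ℝ)) ∞ P P.source := by
      rw [hPg]
      exact ((contDiffOn_coordLeg e.1.open_target hf).mono hPW).contMDiffOn
    rw [modelWithCornersSelf_prod] at h
    exact h
  have hP'2 : ContMDiffOn (cotangentModel (Fin (m + 1) → E)) 𝓘(ℝ, Fin (2 * m + 1 + 1) → E) ∞
      P'.symm P'.target := by
    have h : ContMDiffOn 𝓘(ℝ, (Fin (m + 1) → E) × ((Fin (m + 1) → E) →L[ℝ] ℝ))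
        𝓘(ℝ, Fin (2 * m + 1 + 1) → E) ∞ P.symm P.target := hPsymm.contMDiffOn
    rw [modelWithCornersSelf_prod] at h
    exact h
  let Ψ := ((jetHomeo (2 * m + 1) e).trans P').trans C.symm
  have hΨs : ∀ y ∈ Ψ.source, base y ∈ e.1.source ∧ coords e y ∈ P.source ∧
      P (coords e y) ∈ C.target := by
    intro y hy
    simp only [Ψ, OpenPartialHomeomorph.trans_source, mem_inter_iff, mem_preimage] at hy
    exact ⟨hy.1.1, hy.1.2, hy.2⟩
  have hΨt : ∀ α ∈ Ψ.target, α ∈ C.source ∧ C α ∈ P.target ∧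
      P.symm (C α) ∈ (jetHomeo (2 * m + 1) e).target := by
    intro α hα
    simp only [Ψ, OpenPartialHomeomorph.trans_target, mem_inter_iff, mem_preimage] at hα
    exact ⟨hα.1, hα.2.1, hα.2.2⟩
  refine ⟨⟨Ψ.toPartialEquiv, Ψ.open_source, Ψ.open_target, ?_, ?_⟩, ?_, ?_⟩
  · exact (contMDiffOn_chart_symm (I := cotangentModel (Fin (m + 1) → E)) (x := leg L x)).comp
      (hP'1.comp ((contMDiffOn_coords e).mono fun y hy => (hΨs y hy).1) fun y hy => (hΨs y hy).2.1)
      fun y hy => (hΨs y hy).2.2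
  · exact (contMDiffOn_ofCoords e).comp
      (hP'2.comp ((contMDiffOn_chart (I := cotangentModel (Fin (m + 1) → E))
        (x := leg L x)).mono fun α hα => (hΨt α hα).1) fun α hα => (hΨt α hα).2.1)
      fun α hα => (hΨt α hα).2.2
  · change x ∈ Ψ.source
    simp only [Ψ, OpenPartialHomeomorph.trans_source, mem_inter_iff, mem_preimage]
    refine ⟨⟨hx, hxP⟩, ?_⟩
    change P (coords e x) ∈ C.target
    rw [← hleg x hx]
    exact C.map_source (hlegC x hx)
  · intro y hy
    change C.symm (P (coords e y)) = leg L y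
    rw [← hleg y (hΨs y hy).1, C.left_inv (hlegC y (hΨs y hy).1)]

theorem fiberDeriv_hamiltonian (hL : ContMDiff 𝓘(ℝ, Fin (m + 1 + 1) → E) 𝓘(ℝ, ℝ) ∞ L)
    {X : CotangentBundle (Fin (m + 1) → E) (HOTangent E Q m) → HOTangent E Q (2 * m + 1)}
    {V : Set (CotangentBundle (Fin (m + 1) → E) (HOTangent E Q m))} (hV : IsOpen V)
    (hX : ContMDiffOn (cotangentModel (Fin (m + 1) → E)) 𝓘(ℝ, Fin (2 * m + 1 + 1) → E) ∞ X V)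
    (hXleg : ∀ α ∈ V, leg L (X α) = α)
    {α : CotangentBundle (Fin (m + 1) → E) (HOTangent E Q m)} (hα : α ∈ V) :
    fiberDeriv (hamiltonian L X) α = canonicalImmersion (proj (by omega) (X α)) := by
  obtain ⟨b, α⟩ := α
  have hproj := (leg_eq_mk hL (hXleg _ hα)).1
  have hm' : m + 1 ≤ 2 * m + 1 := by omega
  have key : ∀ (x y : HOTangent E Q m) (v w : Fin (m + 1) → E), x = y → v = w →
      (⟨x, v⟩ : TangentBundle 𝓘(ℝ, Fin (m + 1) → E) (HOTangent E Q m)) = ⟨y, w⟩ := by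
    rintro x y v w rfl rfl; rfl
  rw [canonicalImmersion_eq, proj_proj]
  refine key _ _ _ _ hproj.symm ?_
  -- A vector is determined by its pairings with covectors, and these are the fibre derivatives of
  -- `H`.
  refine (SeparatingDual.eq_iff_forall_dual_eq (R := ℝ)).2 fun η => ?_
  have hb : base (proj hm' (X ⟨b, α⟩)) = base b := by
    rw [base_proj, ← base_proj (show m ≤ 2 * m + 1 by omega), hproj]
  refine (fiberDeriv_spec (hamiltonian L X) ⟨b, α⟩ η).trans ?_
  refine (fderiv_hamiltonian hL hV hX hXleg b hα η).trans ?_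
  rw [hb, coords_proj]
  rfl

end LocalInverses

/-! ### The canonical immersion and sections of the projections -/

section CanonicalImmersion

variable {E : Type u} [NormedAddCommGroup E] [NormedSpace ℝ E]
  {Q : Type v} [TopologicalSpace Q] [ChartedSpace E Q] [IsManifold 𝓘(ℝ, E) ∞ Q] {k : ℕ}

/-- The base point gives q_(0) and the velocity gives all higher coordinates. Uniqueness of 𝓕H_o
rests on this. -/
theorem canonicalImmersion_injective :
    Injective (canonicalImmersion : HOTangent E Q (k + 1) → _) := by
  intro x y h
  rw [canonicalImmersion_eq, canonicalImmersion_eq] at h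
  have h1 : proj k.le_succ x = proj k.le_succ y := congrArg (fun p => p.1) h
  have hb : base x = base y := by rw [← base_proj k.le_succ x, h1, base_proj]
  have h2 : (fun r : Fin (k + 1) => coords (achart E (base x)) x r.succ) =
      fun r : Fin (k + 1) => coords (achart E (base y)) y r.succ :=
    congrArg (fun p : TangentBundle 𝓘(ℝ, Fin (k + 1) → E) (HOTangent E Q k) =>
      (show Fin (k + 1) → E from p.2)) h
  rw [hb] at h2
  have hy : base y ∈ (achart E (base y)).1.source := mem_chart_source E _
  have hx : base x ∈ (achart E (base y)).1.source := by rw [hb]; exact hy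
  have h3 : coords (achart E (base y)) x = coords (achart E (base y)) y := by
    funext i
    refine Fin.cases ?_ (fun r => congrFun h2 r) i
    rw [coords_mem _ hx, coords_mem _ hy, hb]
  exact (jetChart (k + 1) (achart E (base y))).injOn hx hy h3

/-- The canonical immersion in a trivialization of the tangent bundle. -/
theorem trivializationAt_canonicalImmersion (y₀ : HOTangent E Q k) {x : HOTangent E Q (k + 1)}
    (hx : base x ∈ (achart E (base y₀)).1.source) :
    (trivializationAt (Fin (k + 1) → E) (TangentSpace 𝓘(ℝ, Fin (k + 1) → E)) y₀
      (canonicalImmersion x)).2 = fun r => coords (achart E (base y₀)) x r.succ := by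
  have hb : base (proj k.le_succ x) = base x := base_proj _ _
  rw [canonicalImmersion_eq, ← hb]
  change (tangentBundleCore 𝓘(ℝ, Fin (k + 1) → E) (HOTangent E Q k)).coordChange
    (achart (Fin (k + 1) → E) (proj k.le_succ x)) (achart (Fin (k + 1) → E) y₀)
    (proj k.le_succ x)
    (fun r => coords (achart E (base (proj k.le_succ x))) x r.succ) = _
  have hs := mem_chart_source E (base (proj k.le_succ x))
  rw [tangentCoordChange_eq _ _ _ hs (by rwa [hb]), coords_proj]
  refine (fderiv_jetMap_tail (isOpen_transition _ _) (contDiffOn_transition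
    (achart E (base (proj k.le_succ x))).2 (achart E (base y₀)).2)
    (coords_transition_mem _ _ (by rw [← hb]; exact hs) hx)).trans ?_
  rw [← coords_eq_jetMap _ _ (by rw [← hb]; exact hs) hx]

theorem contMDiff_canonicalImmersion :
    ContMDiff 𝓘(ℝ, Fin (k + 1 + 1) → E) 𝓘(ℝ, Fin (k + 1) → E).tangent ∞
      (canonicalImmersion : HOTangent E Q (k + 1) → _) := by
  intro x
  rw [Bundle.contMDiffAt_totalSpace]
  have h1 : (fun y : HOTangent E Q (k + 1) => (canonicalImmersion y).proj) = proj k.le_succ :=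
    funext fun y => by rw [canonicalImmersion_eq]
  refine ⟨by rw [h1]; exact contMDiff_proj _ x, ?_⟩
  set e := achart E (base (canonicalImmersion x).proj) with he
  have hx : base x ∈ e.1.source := by
    rw [he, canonicalImmersion_eq, base_proj]; exact mem_chart_source E _
  have h2 : ContMDiffAt 𝓘(ℝ, Fin (k + 1 + 1) → E) 𝓘(ℝ, Fin (k + 1) → E) ∞
      (fun y : HOTangent E Q (k + 1) => fun r : Fin (k + 1) => coords e y r.succ) x := by
    have h3 : ContDiff ℝ ∞ fun q : Fin (k + 1 + 1) → E => fun r : Fin (k + 1) => q r.succ := by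
      fun_prop
    exact h3.contMDiff.contMDiffAt.comp x
      ((contMDiffOn_coords e).contMDiffAt ((isOpen_base_preimage e).mem_nhds hx))
  refine h2.congr_of_eventuallyEq ?_
  filter_upwards [(isOpen_base_preimage e).mem_nhds hx] with y hy
  exact trivializationAt_canonicalImmersion _ hy

/-! ### Separation and countability of T^(k)Q, required for partitions of unity -/

instance [T2Space Q] : T2Space (HOTangent E Q k) := by
  refine ⟨fun x y hxy => ?_⟩
  have hbc : Continuous (base : HOTangent E Q k → Q) := by
    refine continuous_iff_continuousAt.2 fun x => ?_
    set e := achart E (base x)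
    have hx : base x ∈ e.1.source := mem_chart_source E _
    have h0 : ContinuousAt (fun y : HOTangent E Q k => coords e y 0) x :=
      (continuous_apply (0 : Fin (k + 1))).continuousAt.comp
        ((contMDiffOn_coords e).contMDiffAt ((isOpen_base_preimage e).mem_nhds hx)).continuousAt
    have h1 : ContinuousAt (fun y : HOTangent E Q k => e.1.symm (coords e y 0)) x :=
      ContinuousAt.comp (f := fun y : HOTangent E Q k => coords e y 0)
        (e.1.continuousAt_symm (coords_mem_target e hx)) h0
    refine h1.congr ?_
    filter_upwards [(isOpen_base_preimage e).mem_nhds hx] with y hy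
    rw [coords_mem e hy, e.1.left_inv hy]
  by_cases hb : base x = base y
  · set e := achart E (base y)
    have hy : base y ∈ e.1.source := mem_chart_source E _
    have hx : base x ∈ e.1.source := by rw [hb]; exact hy
    have hne : coords e x ≠ coords e y := fun h => hxy (by
      rw [← ofCoords_coords e hx, ← ofCoords_coords e hy, h])
    obtain ⟨u, v, hu, hv, hxu, hyv, huv⟩ := t2_separation hne
    refine ⟨_, _, (jetHomeo k e).isOpen_inter_preimage hu, (jetHomeo k e).isOpen_inter_preimage hv,
      ⟨hx, hxu⟩, ⟨hy, hyv⟩, ?_⟩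
    exact (huv.preimage _).mono inter_subset_right inter_subset_right
  · obtain ⟨u, v, hu, hv, hxu, hyv, huv⟩ := t2_separation hb
    exact ⟨_, _, hu.preimage hbc, hv.preimage hbc, hxu, hyv, huv.preimage _⟩

instance [FiniteDimensional ℝ E] [SecondCountableTopology Q] :
    SecondCountableTopology (HOTangent E Q k) := by
  obtain ⟨s, hs, hcov⟩ := TopologicalSpace.countable_cover_nhds
    (fun q : Q => chart_source_mem_nhds E q)
  -- Jets of constant curves serve as chart centres: the chart at `c q` is the natural chart over
  -- the chart of `Q` at `q`.
  let c : Q → HOTangent E Q k := fun q =>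
    jet k (⟨fun _ => q, contMDiff_const⟩ : SmoothCurve E Q)
  refine ChartedSpace.secondCountable_of_countable_cover (Fin (k + 1) → E) (s := c '' s) ?_
    (hs.image c)
  refine eq_univ_of_forall fun x => ?_
  have hx : base x ∈ ⋃ q ∈ s, (chartAt E q).source := by rw [hcov]; trivial
  obtain ⟨q, hq, hxq⟩ := mem_iUnion₂.1 hx
  exact mem_iUnion₂.2 ⟨c q, mem_image_of_mem c hq, hxq⟩

/-- The projection `T^(k+1)Q → T^(k)Q` has a smooth section. -/
theorem exists_contMDiff_section_succ [FiniteDimensional ℝ E] [T2Space Q]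
    [SecondCountableTopology Q] (k : ℕ) :
    ∃ σ : HOTangent E Q k → HOTangent E Q (k + 1),
      ContMDiff 𝓘(ℝ, Fin (k + 1) → E) 𝓘(ℝ, Fin (k + 1 + 1) → E) ∞ σ ∧
      ∀ y, proj k.le_succ (σ y) = y := by
  have : LocallyCompactSpace (HOTangent E Q k) :=
    ChartedSpace.locallyCompactSpace (Fin (k + 1) → E) _
  -- The image of j_(k+1) over `y`: the entries of `v` below the last are prescribed by `y`, the
  -- last is free. This is an affine subspace, hence convex.
  let t : ∀ y : HOTangent E Q k, Set (TangentSpace 𝓘(ℝ, Fin (k + 1) → E) y) := fun y =>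
    {v : Fin (k + 1) → E | ∀ i : Fin k, v i.castSucc = coords (achart E (base y)) y i.succ}
  have ht : ∀ y, Convex ℝ (t y) := by
    intro y v hv w hw a b _ _ hab i
    change a • v i.castSucc + b • w i.castSucc = _
    rw [hv i, hw i, ← add_smul, hab, one_smul]
  have hloc : ∀ y₀ : HOTangent E Q k, ∃ U ∈ 𝓝 y₀,
      ∃ s : (y : HOTangent E Q k) → TangentSpace 𝓘(ℝ, Fin (k + 1) → E) y,
        (ContMDiffOn 𝓘(ℝ, Fin (k + 1) → E) 𝓘(ℝ, Fin (k + 1) → E).tangent ∞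
          (fun y => (⟨y, s y⟩ : TangentBundle 𝓘(ℝ, Fin (k + 1) → E) (HOTangent E Q k))) U) ∧
        ∀ y ∈ U, s y ∈ t y := by
    intro y₀
    set e := achart E (base y₀)
    -- A local section: in the fixed chart `e`, append 0 as the highest coordinate. Its image under
    -- j_(k+1) is the local vector field required.
    let z : HOTangent E Q k → HOTangent E Q (k + 1) := fun y =>
      ofCoords e (Fin.snoc (α := fun _ => E) (coords e y) 0)
    have hcs : ∀ q : Fin (k + 1) → E, (Fin.snoc (α := fun _ => E) q 0 : Fin (k + 1 + 1) → E) 0 = q 0 :=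
      fun q => Fin.snoc_castSucc (α := fun _ => E) (x := 0) (p := q) (i := 0)
    have hzt : ∀ y : HOTangent E Q k, base y ∈ e.1.source →
        (Fin.snoc (α := fun _ => E) (coords e y) 0 : Fin (k + 1 + 1) → E) 0 ∈ e.1.target :=
      fun y hy => by rw [hcs]; exact coords_mem_target e hy
    have hz : ContMDiffOn 𝓘(ℝ, Fin (k + 1) → E) 𝓘(ℝ, Fin (k + 1 + 1) → E) ∞ z
        {y | base y ∈ e.1.source} := by
      have h1 : ContDiff ℝ ∞ fun q : Fin (k + 1) → E =>
          (Fin.snoc (α := fun _ => E) q 0 : Fin (k + 1 + 1) → E) := by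
        refine contDiff_pi.2 fun i => ?_
        refine Fin.lastCases ?_ (fun i => ?_) i
        · simp only [Fin.snoc_last]; exact contDiff_const
        · simp only [Fin.snoc_castSucc]; exact contDiff_apply ℝ E i
      exact (contMDiffOn_ofCoords e).comp (h1.contMDiff.comp_contMDiffOn (contMDiffOn_coords e))
        fun y hy => hzt y hy
    have hzp : ∀ y : HOTangent E Q k, base y ∈ e.1.source → proj k.le_succ (z y) = y := by
      intro y hy
      have hbz : base (proj k.le_succ (z y)) ∈ e.1.source := by
        rw [base_proj]; exact base_ofCoords_mem e (hzt y hy)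
      rw [← ofCoords_coords e hbz, coords_proj, coords_ofCoords_self e (hzt y hy)]
      conv_rhs => rw [← ofCoords_coords e hy]
      congr 1
      funext i
      exact Fin.snoc_castSucc (α := fun _ => E) (x := 0) (p := coords e y) (i := i)
    have hbz : ∀ y : HOTangent E Q k, base y ∈ e.1.source → base (z y) = base y := fun y hy => by
      rw [← base_proj k.le_succ, hzp y hy]
    refine ⟨{y | base y ∈ e.1.source}, (isOpen_base_preimage e).mem_nhds (mem_chart_source E _),
      fun y => (fun r : Fin (k + 1) => coords (achart E (base y)) (z y) r.succ : Fin (k + 1) → E),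
      ?_, ?_⟩
    · refine (contMDiff_canonicalImmersion.comp_contMDiffOn hz).congr fun y hy => ?_
      have key : ∀ (x y : HOTangent E Q k) (v w : Fin (k + 1) → E), x = y → v = w →
          (⟨x, v⟩ : TangentBundle 𝓘(ℝ, Fin (k + 1) → E) (HOTangent E Q k)) = ⟨y, w⟩ := by
        rintro x y v w rfl rfl; rfl
      rw [comp_apply, canonicalImmersion_eq]
      refine key _ _ _ _ (hzp y hy).symm ?_
      rw [hbz y hy]
    · intro y hy i
      change coords (achart E (base y)) (z y) i.castSucc.succ = _
      conv_rhs => rw [← hzp y hy, coords_proj, hzp y hy]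
      rfl
  obtain ⟨s, hs⟩ := exists_contMDiffSection_forall_mem_convex_of_local
    𝓘(ℝ, Fin (k + 1) → E) (n := (⊤ : ℕ∞)) (F_fiber := Fin (k + 1) → E)
    (TangentSpace 𝓘(ℝ, Fin (k + 1) → E) : HOTangent E Q k → Type _) t ht hloc
  let σ : HOTangent E Q k → HOTangent E Q (k + 1) := fun y =>
    ofCoords (achart E (base y))
      (Fin.cons (coords (achart E (base y)) y 0) (s y : Fin (k + 1) → E) : Fin (k + 1 + 1) → E)
  have hmem : ∀ y : HOTangent E Q k, (Fin.cons (coords (achart E (base y)) y 0)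
      (s y : Fin (k + 1) → E) : Fin (k + 1 + 1) → E) 0 ∈ (achart E (base y)).1.target := fun y =>
    coords_mem_target _ (mem_chart_source E (base y))
  have hσb : ∀ y, base (σ y) ∈ (achart E (base y)).1.source := fun y =>
    base_ofCoords_mem _ (hmem y)
  have hσp : ∀ y, proj k.le_succ (σ y) = y := by
    intro y
    rw [← ofCoords_coords (achart E (base y)) (x := proj k.le_succ (σ y))
      (by rw [base_proj]; exact hσb y), coords_proj, coords_ofCoords_self _ (hmem y)]
    conv_rhs => rw [← ofCoords_coords (achart E (base y)) (mem_chart_source E (base y))]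
    congr 1
    funext i
    refine Fin.cases rfl (fun i => ?_) i
    exact hs y i
  refine ⟨σ, fun y₀ => ?_, hσp⟩
  have hbσ : ∀ y, base (σ y) = base y := fun y => by rw [← base_proj k.le_succ, hσp]
  have hcan : ∀ y, canonicalImmersion (σ y) =
      (⟨y, s y⟩ : TangentBundle 𝓘(ℝ, Fin (k + 1) → E) (HOTangent E Q k)) := by
    intro y
    have key : ∀ (x y : HOTangent E Q k) (v w : Fin (k + 1) → E), x = y → v = w →
        (⟨x, v⟩ : TangentBundle 𝓘(ℝ, Fin (k + 1) → E) (HOTangent E Q k)) = ⟨y, w⟩ := by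
      rintro x y v w rfl rfl; rfl
    rw [canonicalImmersion_eq]
    refine key _ _ _ _ (hσp y) ?_
    rw [hbσ, coords_ofCoords_self _ (hmem y)]
    rfl
  set e := achart E (base y₀)
  have hy₀ : base y₀ ∈ e.1.source := mem_chart_source E _
  have h1 : ContMDiffAt 𝓘(ℝ, Fin (k + 1) → E) 𝓘(ℝ, Fin (k + 1) → E) ∞ (fun y =>
      (trivializationAt (Fin (k + 1) → E) (TangentSpace 𝓘(ℝ, Fin (k + 1) → E)) y₀
        (⟨y, s y⟩ : TangentBundle 𝓘(ℝ, Fin (k + 1) → E) (HOTangent E Q k))).2) y₀ :=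
    (Bundle.contMDiffAt_section y₀).1 (s.contMDiff y₀)
  have h2 : ContMDiffAt 𝓘(ℝ, Fin (k + 1) → E) 𝓘(ℝ, Fin (k + 1) → E) ∞
      (coords e : HOTangent E Q k → _) y₀ :=
    (contMDiffOn_coords e).contMDiffAt ((isOpen_base_preimage e).mem_nhds hy₀)
  have h3 : ContDiff ℝ ∞ fun p : (Fin (k + 1) → E) × (Fin (k + 1) → E) =>
      (Fin.cons (p.1 0) p.2 : Fin (k + 1 + 1) → E) := by
    refine contDiff_pi.2 fun i => ?_
    refine Fin.cases ?_ (fun i => ?_) i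
    · simp only [Fin.cons_zero]; fun_prop
    · simp only [Fin.cons_succ]; fun_prop
  have h4 := h3.contMDiff.contMDiffAt.comp y₀ (h2.prodMk_space h1)
  -- `σ` is defined in a chart moving with `y`. In the fixed chart `e` its coordinates are q_(0)
  -- followed by the trivialized vector field, which varies smoothly.
  have h5 : ∀ y : HOTangent E Q k, base y ∈ e.1.source →
      (Fin.cons (coords e y 0) (trivializationAt (Fin (k + 1) → E)
        (TangentSpace 𝓘(ℝ, Fin (k + 1) → E)) y₀
        (⟨y, s y⟩ : TangentBundle 𝓘(ℝ, Fin (k + 1) → E) (HOTangent E Q k))).2 :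
          Fin (k + 1 + 1) → E) = coords e (σ y) := by
    intro y hy
    rw [← hcan, trivializationAt_canonicalImmersion y₀ (by rw [hbσ]; exact hy)]
    funext i
    refine Fin.cases ?_ (fun i => rfl) i
    rw [Fin.cons_zero, coords_mem e hy, coords_mem e (by rw [hbσ]; exact hy), hbσ]
  have h6 := ((contMDiffOn_ofCoords (k := k + 1) e).contMDiffAt
    ((isOpen_jetDomain e.1.open_target _).mem_nhds
      (coords_mem_target e (x := y₀) hy₀ : (Fin.cons (coords e y₀ 0) _ : Fin (k + 1 + 1) → E) 0 ∈ _))).comp y₀ h4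
  refine h6.congr_of_eventuallyEq ?_
  filter_upwards [(isOpen_base_preimage e).mem_nhds hy₀] with y hy
  change σ y = ofCoords e _
  rw [← ofCoords_coords e (x := σ y) (by rw [hbσ]; exact hy), ← h5 y hy]
  rfl

/-- The projections `T^(k)Q → T^(r)Q` have smooth sections. -/
theorem exists_contMDiff_section [FiniteDimensional ℝ E] [T2Space Q]
    [SecondCountableTopology Q] {r k : ℕ} (h : r ≤ k) :
    ∃ σ : HOTangent E Q r → HOTangent E Q k,
      ContMDiff 𝓘(ℝ, Fin (r + 1) → E) 𝓘(ℝ, Fin (k + 1) → E) ∞ σ ∧ ∀ y, proj h (σ y) = y := by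
  induction k, h using Nat.le_induction with
  | base => exact ⟨id, contMDiff_id, proj_self⟩
  | succ k h ih =>
    obtain ⟨σ, hσ, hσp⟩ := ih
    obtain ⟨σ', hσ', hσp'⟩ := exists_contMDiff_section_succ (E := E) (Q := Q) k
    refine ⟨σ' ∘ σ, hσ'.comp hσ, fun y => ?_⟩
    rw [← proj_proj h k.le_succ, comp_apply, hσp', hσp]

end CanonicalImmersion

/-! ### Submersions -/

section Submersions

variable {E : Type u} [NormedAddCommGroup E] [NormedSpace ℝ E] [FiniteDimensional ℝ E]
  {Q : Type v} [TopologicalSpace Q] [ChartedSpace E Q] [IsManifold 𝓘(ℝ, E) ∞ Q]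

/-- A jet is determined by its truncation and its remaining components. -/
theorem exists_truncateEquiv {r d k : ℕ} (h : k = r + d) :
    ∃ A : (Fin (k + 1) → E) ≃L[ℝ] (Fin (r + 1) → E) × (Fin d → E),
      ∀ q, (A q).1 = truncate (by omega) q := by
  let B : (Fin (k + 1) → E) →ₗ[ℝ] (Fin (r + 1) → E) × (Fin d → E) :=
    (LinearMap.pi fun i : Fin (r + 1) => LinearMap.proj (Fin.castLE (by omega) i)).prod
      (LinearMap.pi fun i : Fin d => LinearMap.proj ⟨r + 1 + i, by omega⟩)
  have hB : Injective B := by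
    rw [injective_iff_map_eq_zero]
    intro q hq
    funext i
    by_cases hi : (i : ℕ) < r + 1
    · exact congrFun (congrArg Prod.fst hq) ⟨i, hi⟩
    · have h2 := congrFun (congrArg Prod.snd hq) ⟨i - (r + 1), by omega⟩
      have h3 : (⟨r + 1 + (i - (r + 1)), by omega⟩ : Fin (k + 1)) = i :=
        Fin.ext (by simp only; omega)
      rw [← h3]
      exact h2
  have hrank : Module.finrank ℝ (Fin (k + 1) → E) =
      Module.finrank ℝ ((Fin (r + 1) → E) × (Fin d → E)) := by
    rw [Module.finrank_prod, Module.finrank_pi_fintype, Module.finrank_pi_fintype,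
      Module.finrank_pi_fintype]
    simp only [Finset.sum_const, Finset.card_univ, Fintype.card_fin, smul_eq_mul, h]
    ring
  exact ⟨(LinearEquiv.ofInjectiveOfFinrankEq B hB hrank).toContinuousLinearEquiv, fun q => rfl⟩

/-- The composition of a diffeomorphism with the projection `T^(k)Q → T^(r)Q` is a submersion. -/
theorem isSubmersion_proj_comp_diffeomorph {F : Type u} [NormedAddCommGroup F] [NormedSpace ℝ F]
    [FiniteDimensional ℝ F] {H : Type*} [TopologicalSpace H] {I : ModelWithCorners ℝ F H}
    {N : Type*} [TopologicalSpace N] [ChartedSpace H N] [IsManifold I ∞ N] {r d k : ℕ}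
    (h : k = r + d) (Ξ : Diffeomorph I 𝓘(ℝ, Fin (k + 1) → E) N (HOTangent E Q k) ∞)
    (A : (Fin (k + 1) → E) ≃L[ℝ] F) (a : (Fin (k + 1) → E) ≃ₜ H)
    (ha : ContMDiff 𝓘(ℝ, Fin (k + 1) → E) I ∞ a)
    (ha' : ContMDiff I 𝓘(ℝ, Fin (k + 1) → E) ∞ a.symm)
    (hA : ∀ y, I y = A (a.symm y)) :
    Manifold.IsSubmersion I 𝓘(ℝ, Fin (r + 1) → E) ∞
      (fun α => (proj (show r ≤ k by omega) (Ξ α) : HOTangent E Q r)) := by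
  obtain ⟨B, hB⟩ := exists_truncateEquiv (E := E) h
  refine ⟨Fin d → E, inferInstance, inferInstance, fun α => ?_⟩
  set e := achart E (base (Ξ α))
  have hα : base (Ξ α) ∈ e.1.source := mem_chart_source E _
  -- The natural chart transported through `Ξ`, then moved to the model of `N` by `a`. In this chart
  -- the map is literally the truncation of jets, that is, the first factor of the splitting `B`.
  let C : OpenPartialHomeomorph N H := (Ξ.toHomeomorph.toOpenPartialHomeomorph.trans
    (jetHomeo k e)).trans a.toOpenPartialHomeomorph
  have hCs : C.source = {β | base (Ξ β) ∈ e.1.source} := by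
    ext β
    simp only [C, OpenPartialHomeomorph.trans_source, mem_inter_iff, mem_preimage,
      Homeomorph.toOpenPartialHomeomorph_source, mem_univ, and_true, true_and]
    rfl
  have hCt : ∀ y ∈ C.target, a.symm y 0 ∈ e.1.target := by
    intro y hy
    simp only [C, OpenPartialHomeomorph.trans_target, mem_inter_iff, mem_preimage] at hy
    exact hy.2.1
  refine Manifold.IsSubmersionAtOfComplement.mk_of_charts (A.symm.trans B) C (jetHomeo r e) ?_ ?_ ?_
    (jetHomeo_mem_maximalAtlas e) ?_ ?_
  · rw [hCs]; exact hα
  · change base (proj (show r ≤ k by omega) (Ξ α)) ∈ e.1.source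
    rw [base_proj]; exact hα
  · refine C.mem_maximalAtlas_of_contMDiffOn ?_ ?_
    · rw [hCs]
      exact ha.comp_contMDiffOn ((contMDiffOn_coords e).comp Ξ.contMDiff.contMDiffOn
        fun β hβ => hβ)
    · exact Ξ.symm.contMDiff.comp_contMDiffOn ((contMDiffOn_ofCoords e).comp ha'.contMDiffOn hCt)
  · intro β hβ
    rw [hCs] at hβ
    change base (proj (show r ≤ k by omega) (Ξ β)) ∈ e.1.source
    rw [base_proj]; exact hβ
  · intro y hy
    have hy1 := hy
    rw [OpenPartialHomeomorph.extend_target] at hy1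
    obtain ⟨hy1, hy2⟩ := hy1
    have hq := hCt _ hy1
    have h1 : C.symm (I.symm y) = Ξ.symm (ofCoords e (a.symm (I.symm y))) := rfl
    have h2 : A.symm y = a.symm (I.symm y) := by
      rw [ContinuousLinearEquiv.symm_apply_eq, ← hA, I.right_inv hy2]
    change coords e (proj (show r ≤ k by omega) (Ξ (C.symm (I.symm y)))) = (B (A.symm y)).1
    rw [h1, Ξ.apply_symm_apply, coords_proj, coords_ofCoords_self e hq, hB, h2]

end Submersions

end HigherOrder

/-! ### The main theorem -/

open HigherOrder in
theorem mainTheorem3 {E : Type*} [NormedAddCommGroup E] [NormedSpace ℝ E] [FiniteDimensional ℝ E]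
    {Q : Type*} [TopologicalSpace Q] [T2Space Q] [SecondCountableTopology Q]
    [ChartedSpace E Q] [IsManifold 𝓘(ℝ, E) ∞ Q]
    (m : ℕ) (L : HOTangent E Q (m + 1) → ℝ)
    (hL : ContMDiff 𝓘(ℝ, Fin (m + 1 + 1) → E) 𝓘(ℝ, ℝ) ∞ L) :
    -- (i)
    (IsRegularLagrangian L →
      (∀ x : HOTangent E Q (2 * m + 1),
        ∃ Φ : PartialDiffeomorph 𝓘(ℝ, Fin (2 * m + 1 + 1) → E)
          (cotangentModel (Fin (m + 1) → E)) (HOTangent E Q (2 * m + 1))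
          (CotangentBundle (Fin (m + 1) → E) (HOTangent E Q m)) ∞,
          x ∈ Φ.source ∧ EqOn Φ (leg L) Φ.source) ∧
      ∀ Φ : PartialDiffeomorph 𝓘(ℝ, Fin (2 * m + 1 + 1) → E)
          (cotangentModel (Fin (m + 1) → E)) (HOTangent E Q (2 * m + 1))
          (CotangentBundle (Fin (m + 1) → E) (HOTangent E Q m)) ∞,
        EqOn Φ (leg L) Φ.source →
          ContMDiffOn (cotangentModel (Fin (m + 1) → E)) 𝓘(ℝ, ℝ) ∞
            (hamiltonian L Φ.toPartialEquiv.symm) Φ.target ∧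
          MapsTo (fiberDeriv (hamiltonian L Φ.toPartialEquiv.symm)) Φ.target
            (range canonicalImmersion) ∧
          ∀ FHo : CotangentBundle (Fin (m + 1) → E) (HOTangent E Q m) → HOTangent E Q (m + 1),
            IsFiberDerivO (hamiltonian L Φ.toPartialEquiv.symm) Φ.target FHo →
              EqOn FHo (fun α => proj (by omega) (Φ.toPartialEquiv.symm α)) Φ.target) ∧
    -- (ii) and (iii): `H` is smooth, `FHo` is well defined, and has the asserted properties
    (∀ h : IsHyperregular L,
      ContMDiff (cotangentModel (Fin (m + 1) → E)) 𝓘(ℝ, ℝ) ∞ (hamiltonian L h.legInv) ∧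
      ∃ FHo : CotangentBundle (Fin (m + 1) → E) (HOTangent E Q m) → HOTangent E Q (m + 1),
        IsFiberDerivO (hamiltonian L h.legInv) univ FHo ∧
        (∀ G, IsFiberDerivO (hamiltonian L h.legInv) univ G → G = FHo) ∧
        -- (ii)
        (Manifold.IsSubmersion (cotangentModel (Fin (m + 1) → E)) 𝓘(ℝ, Fin (m + 1 + 1) → E) ∞ FHo ∧
          Surjective FHo) ∧
        -- (iii)
        ((∃ Ψ : HOTangent E Q (m + 1) → HOTangent E Q (2 * m + 1),
            ContMDiff 𝓘(ℝ, Fin (m + 1 + 1) → E) 𝓘(ℝ, Fin (2 * m + 1 + 1) → E) ∞ Ψ ∧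
            ∀ y, proj (by omega) (Ψ y) = y) ∧
          ∀ Ψ : HOTangent E Q (m + 1) → HOTangent E Q (2 * m + 1),
            ContMDiff 𝓘(ℝ, Fin (m + 1 + 1) → E) 𝓘(ℝ, Fin (2 * m + 1 + 1) → E) ∞ Ψ →
            (∀ y, proj (by omega) (Ψ y) = y) →
              ContMDiff 𝓘(ℝ, Fin (m + 1 + 1) → E) (cotangentModel (Fin (m + 1) → E)) ∞
                (leg L ∘ Ψ) ∧
              ∀ y, FHo (leg L (Ψ y)) = y)) := by
  have hm : m ≤ 2 * m + 1 := by omega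
  have hm' : m + 1 ≤ 2 * m + 1 := by omega
  refine ⟨fun hreg => ⟨exists_partialDiffeomorph_leg hL hreg, fun Φ hΦ => ?_⟩, fun h => ?_⟩
  · have hΦsymm : ∀ α ∈ Φ.target, leg L (Φ.toPartialEquiv.symm α) = α := fun α hα => by
      rw [← hΦ (Φ.toPartialEquiv.map_target hα)]
      exact Φ.toPartialEquiv.right_inv hα
    have hfib : ∀ α ∈ Φ.target, fiberDeriv (hamiltonian L Φ.toPartialEquiv.symm) α =
        canonicalImmersion (proj hm' (Φ.toPartialEquiv.symm α)) := fun α hα =>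
      fiberDeriv_hamiltonian hL Φ.open_target Φ.contMDiffOn_invFun hΦsymm hα
    refine ⟨(contMDiff_energy hL).comp_contMDiffOn Φ.contMDiffOn_invFun, fun α hα => ?_,
      fun G hG α hα => ?_⟩
    · rw [hfib α hα]; exact mem_range_self _
    · exact canonicalImmersion_injective ((hG α hα).symm.trans (hfib α hα))
  · obtain ⟨Φ, hΦ⟩ : ∃ Φ : Diffeomorph 𝓘(ℝ, Fin (2 * m + 1 + 1) → E)
        (cotangentModel (Fin (m + 1) → E)) (HOTangent E Q (2 * m + 1))
        (CotangentBundle (Fin (m + 1) → E) (HOTangent E Q m)) ∞,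
        ⇑Φ = leg L ∧ h.legInv = Φ.symm := ⟨h.choose, h.choose_spec, rfl⟩
    obtain ⟨hΦleg, hinv⟩ := hΦ
    have hsymm : ∀ α, leg L (Φ.symm α) = α := fun α => by
      rw [← hΦleg]; exact Φ.apply_symm_apply α
    have hfib : ∀ α, fiberDeriv (hamiltonian L Φ.symm) α =
        canonicalImmersion (proj hm' (Φ.symm α)) := fun α =>
      fiberDeriv_hamiltonian hL isOpen_univ Φ.symm.contMDiff.contMDiffOn (fun α _ => hsymm α)
        (mem_univ α)
    rw [hinv]
    refine ⟨(contMDiff_energy hL).comp Φ.symm.contMDiff, fun α => proj hm' (Φ.symm α),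
      fun α _ => hfib α, fun G hG => funext fun α =>
        canonicalImmersion_injective ((hG α (mem_univ α)).symm.trans (hfib α)),
      ⟨?_, ?_⟩, exists_contMDiff_section hm', fun Ψ hΨ hΨp => ⟨?_, fun y => ?_⟩⟩
    · let A : (Fin (2 * m + 1 + 1) → E) ≃L[ℝ] (Fin (m + 1) → E) × ((Fin (m + 1) → E) →L[ℝ] ℝ) :=
        ContinuousLinearEquiv.ofFinrankEq finrank_coordLeg
      have hA1 : ContMDiff 𝓘(ℝ, Fin (2 * m + 1 + 1) → E)
          𝓘(ℝ, (Fin (m + 1) → E) × ((Fin (m + 1) → E) →L[ℝ] ℝ)) ∞ A := A.contDiff.contMDiff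
      have hA2 : ContMDiff 𝓘(ℝ, (Fin (m + 1) → E) × ((Fin (m + 1) → E) →L[ℝ] ℝ))
          𝓘(ℝ, Fin (2 * m + 1 + 1) → E) ∞ A.symm := A.symm.contDiff.contMDiff
      rw [modelWithCornersSelf_prod] at hA1 hA2
      exact isSubmersion_proj_comp_diffeomorph (show 2 * m + 1 = m + 1 + m by omega) Φ.symm A
        A.toHomeomorph hA1 hA2 fun y => (A.apply_symm_apply y).symm
    · exact (proj_surjective hm').comp Φ.symm.surjective
    · rw [← hΦleg]; exact Φ.contMDiff.comp hΨ
    · change proj hm' (Φ.symm (leg L (Ψ y))) = y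
      rw [← hΦleg, Φ.symm_apply_apply, hΨp]
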